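/- **Network evolution with delay.** Fix $\beta\in[0,1)$, a probability measure $\mu$ on $[0,\infty)$ and a function $f:\{1,2,\dots\}\to(0,\infty)$; write $[x]_+=\max\{\lfloor x\rfloor,1\}$. Random trees $\mathcal T(n)$ on vertices $v_1,\dots,v_n$ are grown as follows. $\mathcal T(1)$ is the single vertex $v_1$ (the root), and in $\mathcal T(2)$ the vertex $v_2$ is attached to $v_1$. For $n\ge 2$, given $\mathcal T(n)$, a delay $\xi_{n+1}\sim\mu$ independent of $\mathcal T(n)$ is sampled, and, given $\mathcal T(n)$ and $\xi_{n+1}$, the new vertex $v_{n+1}$ attaches to a vertex $v$ of $\mathcal T(m)$, $m=[n-n^\beta\xi_{n+1}]_+$, with probability proportional to $f(\deg(v,m))$, where $\deg(v,m)$ is the degree of $v$ in $\mathcal T(m)$ (with $\deg(v_1,1)=1$). Let $N_k(n)$ be the number of vertices of degree $k$ in $\mathcal T(n)$. **Assumptions.** Let $\hat\rho(\lambda)=\sum_{k\ge1}\prod_{i=1}^k\frac{f(i)}{\lambda+f(i)}\in(0,\infty]$ for $\lambda>0$ and $\underline\lambda=\inf\{\lambda>0:\hat\rho(\lambda)<\infty\}$.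 Assume 1. $\inf_{i\ge1}f(i)>0$; there is $C<\infty$ with $f(i)\le Ci$ for all $i\ge1$; $\underline\lambda<\infty$ and $\lim_{\lambda\downarrow\underline\lambda}\hat\rho(\lambda)>1$; 2. for $\xi\sim\mu$, $\displaystyle\lim_{n\to\infty}\mathbb E\Big[\frac{n^\beta\xi\,\mathbf 1\{n-n^\beta\xi\ge1\}}{[n-n^\beta\xi]_+}\Big]=0$; 3. one of the following holds: (A) $f(k)=k+\alpha$ for all $k\ge1$, for some real $\alpha$; (B) $f(k)/k\to0$ and $f$ is Lipschitz; (C) $f(k)/k\to0$ and $f$ is non-decreasing. **Conclusion.** There is a unique $\lambda^*\in(0,\infty)$ with $\hat\rho(\lambda^*)=1$ (the Malthusian parameter), and for every $k\ge1$ $$\frac{N_k(n)}{n}\longrightarrow p_k(f)\quad\text{almost surely as }n\to\infty,$$ where $$p_k(f):=\int_0^\infty\lambda^*e^{-\lambda^*t}\,\mathbb P\big(\#\{i\ge1:\ E_1+\dots+E_i\le t\}=k-1\big)\,dt=\frac{\lambda^*}{\lambda^*+f(k)}\prod_{j=1}^{k-1}\frac{f(j)}{\lambda^*+f(j)},$$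 and $E_1,E_2,\dots$ are independent, $E_i$ being exponential with rate $f(i)$. -/

import Mathlib

open MeasureTheory ProbabilityTheory Filter Topology

namespace DelayTree

noncomputable section

/-! ### Growing labelled trees

The vertices are labelled `1, 2, 3, …` in order of arrival and `1` is the root.  The sequence of trees
`T(1), T(2), …` is encoded by `p : ℕ → ℕ`, where `p j` is the parent of vertex `j` (`j ≥ 2`); the
tree `T(m)` has vertices `1, …, m` and edges `j → p j` for `2 ≤ j ≤ m`. -/

/-- The number of children of vertex `i` in `T(m)`. -/
def childCount (p : ℕ → ℕ) (i m : ℕ) : ℕ :=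
  ((Finset.Icc 2 m).filter (fun j => p j = i)).card

/-- The degree of vertex `i` in `T(m)`, for `1 ≤ i ≤ m`: number of children plus one for a vertex
other than the root, and number of children for the root, except that the root, like every other
vertex, has degree `1` on arrival (the vertex `2` is always a child of the root, so the maximum
matters for `m = 1` only). -/
def deg (p : ℕ → ℕ) (i m : ℕ) : ℕ :=
  if i = 1 then max 1 (childCount p 1 m) else childCount p i m + 1

/-- `N_k(n)`, the number of vertices of degree `k` in `T(n)`. -/
def degreeCount (p : ℕ → ℕ) (k n : ℕ) : ℕ :=
  ((Finset.Icc 1 n).filter (fun i => deg p i n = k)).card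

/-! ### Network evolution with delay -/

/-- `max {⌊x⌋, 1}`. -/
def floorPlus (x : ℝ) : ℕ := max ⌊x⌋₊ 1

/-- The time of the snapshot seen by vertex `n + 1`, when its normalized delay is `x`. -/
def snapshot (β : ℝ) (n : ℕ) (x : ℝ) : ℕ := floorPlus ((n : ℝ) - (n : ℝ) ^ β * x)

/-- The probability of choosing `i` among the vertices `1, …, m` of the snapshot `T(m)`, with
probabilities proportional to `f (deg i)`. -/
def attachProb (f : ℕ → ℝ) (p : ℕ → ℕ) (m i : ℕ) : ℝ :=
  if i ∈ Finset.Icc 1 m then f (deg p i m) / ∑ j ∈ Finset.Icc 1 m, f (deg p j m) else 0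

/-- The random parents `par j` (`j ≥ 2`) and normalized delays `ξ j` (`j ≥ 3`), defined on the
probability space `(Ω, P)`, form a network evolution with delay with time scale exponent `β`, delay
distribution `μ` and attachment function `f`; that is, the trees they encode have law
`L(β, μ, f)`. -/
structure IsNetwork {Ω : Type*} [MeasurableSpace Ω] (P : Measure Ω) (β : ℝ) (μ : Measure ℝ)
    (f : ℕ → ℝ) (par : ℕ → Ω → ℕ) (ξ : ℕ → Ω → ℝ) : Prop where
  measurable_par : ∀ j, Measurable (par j)
  measurable_delay : ∀ j, Measurable (ξ j)
  /-- Vertex `2` is attached to the root. -/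
  par_two : ∀ᵐ ω ∂P, par 2 ω = 1
  /-- The delay `ξ (n + 1)` has law `μ` and is independent of `T(n)`; given `T(n)`, which determines
  all the earlier trees, and given `ξ (n + 1) = x`, vertex `n + 1` attaches to vertex `i` of the
  snapshot with probability proportional to `f` of the degree in the snapshot.  Here `h` is a
  possible value of `T(n)`. -/
  step : ∀ n : ℕ, 2 ≤ n → ∀ (h : ℕ → ℕ) (B : Set ℝ), MeasurableSet B → ∀ i : ℕ,
    P {ω | (∀ j ∈ Finset.Icc 2 n, par j ω = h j) ∧ ξ (n + 1) ω ∈ B ∧ par (n + 1) ω = i} =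
      P {ω | ∀ j ∈ Finset.Icc 2 n, par j ω = h j} *
        ∫⁻ x in B, ENNReal.ofReal (attachProb f h (snapshot β n x) i) ∂μ

/-! ### Assumptions on the attachment function and on the delay -/

/-- `ρ̂(λ) = ∑_{k ≥ 1} ∏_{i = 1}^k f(i) / (λ + f(i))`, with values in `[0, ∞]`. -/
def rhoHat (f : ℕ → ℝ) (l : ℝ) : ENNReal :=
  ∑' k : ℕ, ∏ i ∈ Finset.Icc 1 (k + 1), ENNReal.ofReal (f i / (l + f i))

/-- `λ̲ = inf {λ > 0 : ρ̂(λ) < ∞}`, meaningful when the set is non-empty. -/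
def lambdaLow (f : ℕ → ℝ) : ℝ := sInf {l : ℝ | 0 < l ∧ rhoHat f l < ⊤}

/-- Basic assumptions on the attachment function (its value at `0` plays no role). -/
structure AttachmentAssumption (f : ℕ → ℝ) : Prop where
  /-- `inf_{i ≥ 1} f(i) > 0`. -/
  inf_pos : ∃ c : ℝ, 0 < c ∧ ∀ i : ℕ, 1 ≤ i → c ≤ f i
  /-- `f` grows at most linearly. -/
  linear_growth : ∃ C : ℝ, ∀ i : ℕ, 1 ≤ i → f i ≤ C * i
  /-- `λ̲ < ∞`. -/
  lambdaLow_lt_top : ∃ l : ℝ, 0 < l ∧ rhoHat f l < ⊤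
  /-- `lim_{λ ↓ λ̲} ρ̂(λ) > 1`. -/
  one_lt_lim : ∃ r : ENNReal, Tendsto (rhoHat f) (𝓝[>] (lambdaLow f)) (𝓝 r) ∧ 1 < r

/-- `E[n^β ξ 1{n - n^β ξ ≥ 1} / max {⌊n - n^β ξ⌋, 1}] → 0` for `ξ` of law `μ`. -/
def DelayAssumption (β : ℝ) (μ : Measure ℝ) : Prop :=
  Tendsto (fun n : ℕ => ∫ x, (if 1 ≤ (n : ℝ) - (n : ℝ) ^ β * x then
      (n : ℝ) ^ β * x / (snapshot β n x : ℝ) else 0) ∂μ) atTop (𝓝 0)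

/-- `f(k) = k + α` for all `k ≥ 1`. -/
def IsLinear (f : ℕ → ℝ) : Prop := ∃ α : ℝ, ∀ k : ℕ, 1 ≤ k → f k = k + α

/-- `f(k) / k → 0`. -/
def IsSublinear (f : ℕ → ℝ) : Prop := Tendsto (fun k : ℕ => f k / (k : ℝ)) atTop (𝓝 0)

/-- `f` is Lipschitz on `{1, 2, …}`. -/
def IsLipschitz (f : ℕ → ℝ) : Prop :=
  ∃ L : ℝ, ∀ j k : ℕ, 1 ≤ j → 1 ≤ k → |f j - f k| ≤ L * |(j : ℝ) - (k : ℝ)|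

/-- `f` is non-decreasing on `{1, 2, …}`. -/
def IsNondecreasing (f : ℕ → ℝ) : Prop := ∀ j k : ℕ, 1 ≤ j → j ≤ k → f j ≤ f k

/-! ### The limit degree distribution -/

/-- The law of the independent waiting times: coordinate `i` is exponential of rate `f(i + 1)`. -/
def waitingLaw (f : ℕ → ℝ) : Measure (ℕ → ℝ) :=
  Measure.infinitePi (fun i : ℕ => expMeasure (f (i + 1)))

/-- The number of points `σ_i = E_1 + ⋯ + E_i`, `i ≥ 1`, in `[0, t]` (`e i` is `E_{i+1}`). -/
def pointCount (e : ℕ → ℝ) (t : ℝ) : ℕ∞ :=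
  Set.encard {i : ℕ | 1 ≤ i ∧ ∑ j ∈ Finset.range i, e j ≤ t}

/-- `p_k = ∫_0^∞ λ e^{-λ t} P(ξ_f[0, t] = k - 1) dt`, where `ξ_f` is the point process with points
`σ_1, σ_2, …`; here `k ≥ 1`. -/
def limitDegree (f : ℕ → ℝ) (l : ℝ) (k : ℕ) : ℝ :=
  ∫ t in Set.Ioi (0 : ℝ),
    l * Real.exp (-l * t) * (waitingLaw f).real {e | pointCount e t = ((k - 1 : ℕ) : ℕ∞)}

end

end DelayTree

namespace DelayTree

noncomputable section

/-! ### Scalar recursions -/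

/-! The delay is removed first, pathwise, and the rest is deterministic. Call a vertex of `T(n)` of
class `k` if its degree in the current tree `T(n)` is `k`. Vertex `n + 1` sees a snapshot `T(m)`,
and since `β < 1` one has `m ≥ (1 - δ) n` with probability tending to `1`. The total degree grows by
`2 (n - m)` between the two times, so the snapshot and the current tree give class `k` nearly the
same attachment probability, uniformly over trees (`exists_classProb_close`,
`eventually_delayedProb_close`). The centered indicators of attachment to class `k` are bounded and
orthogonal to the past, hence average to zero almost surely (`ae_tendsto_sum_div_of_orthogonal`). So
almost surely the degree counts `N` differ by `o(n)` from a sequence `X` whose increments are the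
undelayed drift evaluated at `N`; this is `DegreeFlow`.

In the linear case the total rate `S n` is an explicit function of `n`, with `S n / n` tending to
the Malthusian parameter `l`, and the counts converge by induction on the degree
(`tendsto_of_total`).

In the sublinear case `S n / n` is not known in advance. The weights are the reproductive values:
the discounted expected number of future children, truncated at a high degree. The total
reproductive value `Z` of `X` grows at rate about `l`, because a newborn has value close to `1`.
Subtract from `X` the multiple of the limit profile having the same reproductive value, and let `V`
be the weighted `ℓ¹` norm of the remainder. Every low degree produces newborns at a rate at least
`κ` times its weight, and the positive and negative parts of the remainder carry equal weight, so
their newborns partly cancel and `V` grows only at rate `l - κ` (`lyapunov_step`). Sublinearity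
makes the weights of high degrees small relative to the degree, and the total degree is at most `2
n`, so the error from high degrees is small compared with the gain. Hence `V / Z` becomes small
(`eventually_le_of_contraction`), the counts are nearly proportional to the limit profile, and total
mass `n` fixes the factor (`tendsto_of_sublinear`).

The Malthusian parameter comes from the intermediate value theorem (`exists_malthusian`); the limit
law is a difference of two Laplace transforms of sums of exponentials (`limitDegree_succ`). -/

lemma tendsto_sum_range_one_div_nat :
    Tendsto (fun n : ℕ => ∑ j ∈ Finset.range n, 1 / (j : ℝ)) atTop atTop := by
  rw [← tendsto_add_atTop_iff_nat 1]
  refine Real.tendsto_sum_range_one_div_nat_succ_atTop.congr fun n => ?_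
  rw [Finset.sum_range_succ']
  simp

/-- Since `1 - θ / n ≤ exp (-θ / n)`, the product of `y n` with `exp (θ ∑ 1 / j)` is eventually
non-increasing, and the harmonic series diverges. -/
lemma tendsto_zero_of_le_one_sub_div {y : ℕ → ℝ} {θ : ℝ} (hθ : 0 < θ) (hy : ∀ᶠ n in atTop, 0 ≤ y n)
    (hstep : ∀ᶠ n : ℕ in atTop, y (n + 1) ≤ (1 - θ / n) * y n) : Tendsto y atTop (𝓝 0) := by
  obtain ⟨n₀, h₀⟩ := eventually_atTop.1 (hy.and hstep)
  set q : ℕ → ℝ := fun n => ∑ j ∈ Finset.range n, 1 / (j : ℝ) with hq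
  have hmono : ∀ n, n₀ ≤ n → y n * Real.exp (θ * q n) ≤ y n₀ * Real.exp (θ * q n₀) := by
    intro n hn
    induction n, hn using Nat.le_induction with
    | base => exact le_rfl
    | succ n hn ih =>
      refine le_trans ?_ ih
      have h1 : q (n + 1) = q n + 1 / (n : ℝ) := Finset.sum_range_succ _ _
      have h2 : 1 - θ / n ≤ Real.exp (-(θ / n)) := by
        have := Real.add_one_le_exp (-(θ / (n : ℝ))); linarith
      have h3 : y (n + 1) ≤ Real.exp (-(θ / n)) * y n :=
        (h₀ n hn).2.trans (mul_le_mul_of_nonneg_right h2 (h₀ n hn).1)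
      calc y (n + 1) * Real.exp (θ * q (n + 1))
          ≤ Real.exp (-(θ / n)) * y n * Real.exp (θ * q (n + 1)) :=
            mul_le_mul_of_nonneg_right h3 (Real.exp_nonneg _)
        _ = y n * (Real.exp (-(θ / n)) * Real.exp (θ * q (n + 1))) := by ring
        _ = y n * Real.exp (θ * q n) := by
            rw [← Real.exp_add, h1]; congr 2; ring
  have hexp : Tendsto (fun n => y n₀ * Real.exp (θ * q n₀) * Real.exp (-(θ * q n))) atTop (𝓝 0) := by
    have h1 : Tendsto (fun n => Real.exp (-(θ * q n))) atTop (𝓝 0) :=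
      Real.tendsto_exp_neg_atTop_nhds_zero.comp
        (tendsto_sum_range_one_div_nat.const_mul_atTop hθ)
    simpa using h1.const_mul (y n₀ * Real.exp (θ * q n₀))
  refine squeeze_zero' hy ?_ hexp
  filter_upwards [eventually_ge_atTop n₀] with n hn
  rw [Real.exp_neg, ← div_eq_mul_inv, le_div_iff₀ (Real.exp_pos _)]
  exact hmono n hn

/-- If `Y (n + 1) = (1 - a n / n) Y n + o(1)` with `a n ≥ 0` bounded, then `Y n = o(n)`. -/
lemma tendsto_div_of_recursion {Y a e : ℕ → ℝ} {A : ℝ} (ha : ∀ᶠ n in atTop, 0 ≤ a n ∧ a n ≤ A)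
    (he : Tendsto e atTop (𝓝 0))
    (hstep : ∀ᶠ n : ℕ in atTop, Y (n + 1) = (1 - a n / n) * Y n + e n) :
    Tendsto (fun n : ℕ => Y n / n) atTop (𝓝 0) := by
  rw [Metric.tendsto_atTop']
  intro ε hε
  have hsmall : ∀ᶠ n in atTop, |e n| ≤ ε / 2 := by
    have := (Metric.tendsto_nhds.1 he (ε / 2) (by positivity))
    filter_upwards [this] with n hn
    rw [Real.dist_eq, sub_zero] at hn
    exact hn.le
  have hbig : ∀ᶠ n : ℕ in atTop, A ≤ n ∧ 0 < n :=
    (tendsto_natCast_atTop_atTop.eventually_ge_atTop A).and (eventually_gt_atTop 0)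
  obtain ⟨n₀, h₀⟩ := eventually_atTop.1 ((ha.and hstep).and (hsmall.and hbig))
  -- From `n ≥ A` on, the factor `1 - a n / n` lies in `[0, 1]`, so `|Y|` gains at most `ε / 2` per
  -- step.
  have hbound : ∀ n, n₀ ≤ n → |Y n| ≤ ε / 2 * n + |Y n₀| := by
    intro n hn
    induction n, hn using Nat.le_induction with
    | base => have : 0 ≤ ε / 2 * (n₀ : ℝ) := by positivity
              linarith
    | succ n hn ih =>
      obtain ⟨⟨⟨ha0, haA⟩, hs⟩, hse, hAn, hn0⟩ := h₀ n hn
      have hnR : (0 : ℝ) < n := by exact_mod_cast hn0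
      have h1 : 0 ≤ 1 - a n / n := by
        rw [sub_nonneg, div_le_one hnR]; linarith
      have h2 : 1 - a n / n ≤ 1 := by
        have : 0 ≤ a n / n := by positivity
        linarith
      rw [hs]
      calc |(1 - a n / n) * Y n + e n| ≤ (1 - a n / n) * |Y n| + |e n| := by
            refine (abs_add_le _ _).trans ?_
            rw [abs_mul, abs_of_nonneg h1]
        _ ≤ 1 * |Y n| + ε / 2 := by gcongr
        _ ≤ ε / 2 * ((n + 1 : ℕ) : ℝ) + |Y n₀| := by push_cast; linarith
  obtain ⟨n₁, hn₁⟩ := exists_nat_gt (|Y n₀| / (ε / 2))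
  refine ⟨max n₀ n₁, fun n hn => ?_⟩
  have hn0 : n₀ ≤ n := (le_max_left _ _).trans hn.le
  have hn1 : (n₁ : ℝ) ≤ n := by exact_mod_cast (le_max_right n₀ n₁).trans hn.le
  have hnR : (0 : ℝ) < n := by exact_mod_cast (h₀ n hn0).2.2.2
  rw [Real.dist_eq, sub_zero, abs_div, Nat.abs_cast, div_lt_iff₀ hnR]
  have h3 : |Y n₀| < ε / 2 * n := by
    rw [div_lt_iff₀ (by positivity)] at hn₁
    nlinarith
  linarith [hbound n hn0]

/-- A Lyapunov functional `V` growing at a slower rate than `Z`, up to small errors, is eventually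
small relative to `Z`. -/
lemma eventually_le_of_contraction {V Z S : ℕ → ℝ} {l κ c B z t ε γ : ℝ} (hl : 0 < l) (hκ : 0 < κ)
    (hc : 0 < c) (hz : 0 < z) (hγ : 0 < γ)
    (hS : ∀ᶠ n : ℕ in atTop, c * n ≤ S n ∧ S n ≤ B * n) (hZ : ∀ᶠ n : ℕ in atTop, z * n ≤ Z n)
    (hVstep : ∀ᶠ n : ℕ in atTop, S n * (V (n + 1) - V n) ≤ (l - κ) * V n + t * n)
    (hZstep : ∀ᶠ n : ℕ in atTop, l * Z n - ε * n ≤ S n * (Z (n + 1) - Z n))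
    (h1 : t + γ * ε ≤ κ * γ * z) (h2 : 2 * ε ≤ κ * z) :
    ∀ᶠ n in atTop, V n ≤ 2 * γ * Z n := by
  have hB : 0 < B + l + κ := by
    obtain ⟨n, hn, hn'⟩ := (hS.and (eventually_gt_atTop 0)).exists
    have hnR : (0 : ℝ) < n := by exact_mod_cast hn'
    have : c * n ≤ B * n := hn.1.trans hn.2
    have := le_of_mul_le_mul_right this hnR
    linarith
  -- The excess of `V` over `γ Z` grows at rate at most `l - κ`, and `Z` at rate at least `l - κ /
  -- 2`. As `S n ≤ B n`, the ratio shrinks by a factor `1 - θ / n`.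
  set y : ℕ → ℝ := fun n => max (V n - γ * Z n) 0 / Z n with hy
  have hpos : ∀ᶠ n in atTop, 0 < Z n := by
    filter_upwards [hZ, eventually_gt_atTop 0] with n hn hn'
    have hnR : (0 : ℝ) < n := by exact_mod_cast hn'
    exact lt_of_lt_of_le (by positivity) hn
  have hSbig : ∀ᶠ n in atTop, l + κ ≤ S n := by
    filter_upwards [hS, tendsto_natCast_atTop_atTop.eventually_ge_atTop ((l + κ) / c)] with n hn hn'
    rw [div_le_iff₀ hc] at hn'
    linarith [hn.1]
  have hstep : ∀ᶠ n : ℕ in atTop, y (n + 1) ≤ (1 - κ / (2 * (B + l + κ)) / n) * y n := by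
    filter_upwards [hpos, (tendsto_add_atTop_nat 1).eventually hpos, hSbig, hS, hZ, hVstep, hZstep,
      eventually_gt_atTop 0] with n hp hp' hSb hSn hZn hV hZs hn0
    have hnR : (1 : ℝ) ≤ n := by exact_mod_cast hn0
    have hSpos : 0 < S n := by linarith
    set U := V n - γ * Z n with hU
    set U' := V (n + 1) - γ * Z (n + 1) with hU'
    -- Passing from `V` to `V - γ Z` leaves a surplus `-κ γ Z ≤ -κ γ z n`, which `h1` makes large
    -- enough to absorb the errors `t n` and `γ ε n`.
    have e1 : S n * U' ≤ (S n + l - κ) * U := by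
      have e2 : κ * γ * (z * n) ≤ κ * γ * Z n := mul_le_mul_of_nonneg_left hZn (by positivity)
      have e3 : (t + γ * ε) * n ≤ κ * γ * z * n := mul_le_mul_of_nonneg_right h1 (by positivity)
      have e4 : γ * (l * Z n - ε * n) ≤ γ * (S n * (Z (n + 1) - Z n)) :=
        mul_le_mul_of_nonneg_left hZs hγ.le
      rw [hU, hU']
      nlinarith
    have e5 : S n * max U' 0 ≤ (S n + l - κ) * max U 0 := by
      rcases le_total U' 0 with h | h
      · rw [max_eq_right h, mul_zero]
        exact mul_nonneg (by linarith) (le_max_right _ _)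
      · rw [max_eq_left h]
        exact e1.trans (mul_le_mul_of_nonneg_left (le_max_left _ _) (by linarith))
    have e6 : (S n + l - κ / 2) * Z n ≤ S n * Z (n + 1) := by
      have e7 : ε * n ≤ κ / 2 * Z n := by
        have : 2 * ε * n ≤ κ * z * n := mul_le_mul_of_nonneg_right h2 (by positivity)
        have : κ * (z * n) ≤ κ * Z n := mul_le_mul_of_nonneg_left hZn hκ.le
        nlinarith
      nlinarith
    have hM : 0 < S n + l - κ / 2 := by linarith
    have e8 : y (n + 1) ≤ (S n + l - κ) / (S n + l - κ / 2) * y n := by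
      simp only [hy]
      rw [div_mul_div_comm, div_le_div_iff₀ hp' (by positivity)]
      have e9 : 0 ≤ max U 0 := le_max_right _ _
      have e10 : 0 ≤ max U' 0 := le_max_right _ _
      have e11 : S n * (max U' 0 * ((S n + l - κ / 2) * Z n)) ≤
          S n * ((S n + l - κ) * max U 0 * Z (n + 1)) := by
        calc S n * (max U' 0 * ((S n + l - κ / 2) * Z n))
            = (S n * max U' 0) * ((S n + l - κ / 2) * Z n) := by ring
          _ ≤ ((S n + l - κ) * max U 0) * (S n * Z (n + 1)) :=
            mul_le_mul e5 e6 (by positivity) (mul_nonneg (by linarith) e9)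
          _ = _ := by ring
      exact le_of_mul_le_mul_left e11 hSpos
    refine e8.trans (mul_le_mul_of_nonneg_right ?_ (div_nonneg (le_max_right _ _) hp.le))
    have e12 : (S n + l - κ) / (S n + l - κ / 2) = 1 - κ / 2 / (S n + l - κ / 2) := by
      rw [eq_sub_iff_add_eq, ← add_div, div_eq_one_iff_eq hM.ne']; ring
    rw [e12, div_div, div_div]
    have e13 : κ / (2 * (B + l + κ) * n) ≤ κ / (2 * (S n + l - κ / 2)) := by
      refine div_le_div_of_nonneg_left hκ.le (by positivity) ?_
      nlinarith [hSn.2]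
    linarith
  have hlim := tendsto_zero_of_le_one_sub_div (θ := κ / (2 * (B + l + κ))) (by positivity)
    (by filter_upwards [hpos] with n hn; exact div_nonneg (le_max_right _ _) hn.le) hstep
  filter_upwards [hlim.eventually_lt_const hγ, hpos] with n hn hp
  rw [hy] at hn
  simp only at hn
  rw [div_lt_iff₀ hp] at hn
  linarith [le_max_left (V n - γ * Z n) 0]

/-! ### Survival probabilities, limiting proportions and reproductive values

Here `F k` is the attachment function at degree `k + 1`. -/

/-- The probability that a vertex has at least `j` children before an exponential time of rate
`l`. -/
def survival (F : ℕ → ℝ) (l : ℝ) (j : ℕ) : ℝ := ∏ i ∈ Finset.range j, F i / (l + F i)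

/-- The probability that a vertex has exactly `k` children at an exponential time of rate `l`. -/
def limitProb (F : ℕ → ℝ) (l : ℝ) (k : ℕ) : ℝ := l / (l + F k) * survival F l k

/-- The expected number of children, discounted at rate `l`, of a vertex with `k` children, among
its next `m` children. -/
def reprod (F : ℕ → ℝ) (l : ℝ) : ℕ → ℕ → ℝ
  | 0, _ => 0
  | m + 1, k => F k / (l + F k) * (1 + reprod F l m (k + 1))

section Profile

variable {F : ℕ → ℝ} {l : ℝ}

lemma survival_zero : survival F l 0 = 1 := by simp [survival]

lemma survival_succ (j : ℕ) : survival F l (j + 1) = survival F l j * (F j / (l + F j)) :=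
  Finset.prod_range_succ _ _

lemma survival_pos (hl : 0 < l) (hF : ∀ k, 0 < F k) (j : ℕ) : 0 < survival F l j :=
  Finset.prod_pos fun i _ => div_pos (hF i) (add_pos hl (hF i))

lemma limitProb_pos (hl : 0 < l) (hF : ∀ k, 0 < F k) (j : ℕ) : 0 < limitProb F l j :=
  mul_pos (div_pos hl (add_pos hl (hF j))) (survival_pos hl hF j)

lemma limitProb_eq_sub (hl : 0 < l) (hF : ∀ k, 0 < F k) (k : ℕ) :
    limitProb F l k = survival F l k - survival F l (k + 1) := by
  have := (add_pos hl (hF k)).ne'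
  rw [limitProb, survival_succ]; field_simp; ring

lemma add_mul_limitProb (hl : 0 < l) (hF : ∀ k, 0 < F k) (k : ℕ) :
    (l + F k) * limitProb F l k = l * survival F l k := by
  have := (add_pos hl (hF k)).ne'
  rw [limitProb]; field_simp

lemma mul_limitProb (hl : 0 < l) (hF : ∀ k, 0 < F k) (k : ℕ) :
    F k * limitProb F l k = l * survival F l (k + 1) := by
  have := (add_pos hl (hF k)).ne'
  rw [limitProb, survival_succ]; field_simp

lemma survival_antitone (hl : 0 < l) (hF : ∀ k, 0 < F k) : Antitone (survival F l) :=
  antitone_nat_of_succ_le fun k => by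
    linarith [limitProb_eq_sub hl hF k, limitProb_pos hl hF k]

lemma sum_limitProb (hl : 0 < l) (hF : ∀ k, 0 < F k) (K : ℕ) :
    ∑ k ∈ Finset.range K, limitProb F l k = 1 - survival F l K := by
  rw [Finset.sum_congr rfl fun k _ => limitProb_eq_sub hl hF k, Finset.sum_range_sub',
    survival_zero]

lemma sum_survival_le (hl : 0 < l) (hF : ∀ k, 0 < F k)
    (hsum : HasSum (fun j => survival F l (j + 1)) 1) (K : ℕ) :
    ∑ k ∈ Finset.range K, survival F l (k + 1) ≤ 1 :=
  sum_le_hasSum _ (fun _ _ => (survival_pos hl hF _).le) hsum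

/-- The survival probabilities decrease and sum to `1` from index `1` on, so `K` copies of the
`K`-th are at most `1`; one more copy is at most `1`. -/
lemma mul_survival_le (hl : 0 < l) (hF : ∀ k, 0 < F k)
    (hsum : HasSum (fun j => survival F l (j + 1)) 1) (K : ℕ) :
    ((K : ℝ) + 1) * survival F l K ≤ 2 := by
  have h1 : (K : ℝ) * survival F l K ≤ ∑ k ∈ Finset.range K, survival F l (k + 1) := by
    rw [← nsmul_eq_mul]
    have := Finset.card_nsmul_le_sum (Finset.range K) (fun k => survival F l (k + 1))
      (survival F l K) (fun k hk => survival_antitone hl hF (by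
        have := Finset.mem_range.1 hk; omega))
    simpa using this
  have h2 := sum_survival_le hl hF hsum K
  have h3 : survival F l K ≤ 1 := by
    have := survival_antitone hl hF (Nat.zero_le K)
    rwa [survival_zero] at this
  linarith

/-- Summation by parts: the mean degree of the limit law is at most the sum of all survival
probabilities, which is `1 + 1`. -/
lemma sum_mul_limitProb_le (hl : 0 < l) (hF : ∀ k, 0 < F k)
    (hsum : HasSum (fun j => survival F l (j + 1)) 1) (K : ℕ) :
    ∑ k ∈ Finset.range K, ((k : ℝ) + 1) * limitProb F l k ≤ 2 := by
  have key : ∀ K : ℕ, ∑ k ∈ Finset.range K, ((k : ℝ) + 1) * limitProb F l k =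
      1 + ∑ k ∈ Finset.range K, survival F l (k + 1) - ((K : ℝ) + 1) * survival F l K := by
    intro K
    induction K with
    | zero => simp [survival_zero]
    | succ K ih =>
      rw [Finset.sum_range_succ, Finset.sum_range_succ, ih, limitProb_eq_sub hl hF]
      push_cast; ring
  have h2 := sum_survival_le hl hF hsum K
  have h3 : 0 ≤ ((K : ℝ) + 1) * survival F l K :=
    mul_nonneg (by positivity) (survival_pos hl hF K).le
  linarith [key K]

lemma reprod_nonneg (hl : 0 < l) (hF : ∀ k, 0 < F k) (m k : ℕ) : 0 ≤ reprod F l m k := by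
  induction m generalizing k with
  | zero => exact le_rfl
  | succ m ih =>
    have := hF k; have := ih (k + 1)
    simp only [reprod]; positivity

/-- The eigenvalue equation behind the weights: at rate `F k` the value `reprod` at `k` is exchanged
for a newborn of value `1` and the value at `k + 1`, and the mean gain is `l` times the present
value. -/
lemma reprod_rec (hl : 0 < l) (hF : ∀ k, 0 < F k) (m k : ℕ) :
    F k * (1 + reprod F l m (k + 1) - reprod F l (m + 1) k) = l * reprod F l (m + 1) k := by
  have := (add_pos hl (hF k)).ne'
  simp only [reprod]; field_simp; ring

lemma div_le_reprod_succ (hl : 0 < l) (hF : ∀ k, 0 < F k) {c : ℝ} (hc : 0 < c)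
    (hcF : ∀ k, c ≤ F k) (m k : ℕ) : c / (l + c) ≤ reprod F l (m + 1) k := by
  have h1 := hF k
  have h2 := reprod_nonneg hl hF m (k + 1)
  have h3 : c / (l + c) ≤ F k / (l + F k) := by
    rw [div_le_div_iff₀ (by positivity) (by positivity)]
    nlinarith [hcF k]
  simp only [reprod]
  have : 0 ≤ F k / (l + F k) := by positivity
  nlinarith

lemma reprod_succ_le (hl : 0 < l) (hF : ∀ k, 0 < F k) (m k : ℕ) :
    reprod F l (m + 1) k ≤ 1 + reprod F l m (k + 1) := by
  have h1 := hF k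
  have h2 := reprod_nonneg hl hF m (k + 1)
  have h3 : F k / (l + F k) ≤ 1 := by rw [div_le_one (by positivity)]; linarith
  simp only [reprod]
  nlinarith

/-- The factor `survival` unrolls the recursion into a partial sum of the series for `ρ̂`. At `k =
0` this shows that a newborn has value close to `1` at the Malthusian parameter. -/
lemma reprod_mul_survival (m k : ℕ) :
    reprod F l m k * survival F l k = ∑ j ∈ Finset.range m, survival F l (k + j + 1) := by
  induction m generalizing k with
  | zero => simp [reprod]
  | succ m ih =>
    have := ih (k + 1)
    rw [survival_succ] at this
    rw [Finset.sum_range_succ', add_zero, survival_succ, reprod]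
    have h2 : ∑ j ∈ Finset.range m, survival F l (k + (j + 1) + 1) =
      ∑ j ∈ Finset.range m, survival F l (k + 1 + j + 1) :=
      Finset.sum_congr rfl fun j _ => by ring_nf
    rw [h2, ← this]; ring

/-- The right-hand side solves the recursion exactly when `F k = ε (k + 1)`, and the recursion is
monotone in `F` and in the next value. -/
lemma reprod_le_of_small (hl : 0 < l) (hF : ∀ k, 0 < F k) {ε : ℝ} (hε : 0 < ε) (hεl : ε < l) {L : ℕ}
    (hL : ∀ k, L ≤ k → F k ≤ ε * (k + 1)) (m k : ℕ) (hk : L ≤ k) :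
    reprod F l m k ≤ ε / (l - ε) * (k + 1) := by
  have hd : 0 < l - ε := by linarith
  induction m generalizing k with
  | zero => simp only [reprod]; positivity
  | succ m ih =>
    have h1 := ih (k + 1) (by omega)
    push_cast at h1
    have h0 := hF k
    have h2 : F k / (l + F k) ≤ ε * (k + 1) / (l + ε * (k + 1)) := by
      rw [div_le_div_iff₀ (by positivity) (by positivity)]
      nlinarith [hL k hk]
    simp only [reprod]
    calc F k / (l + F k) * (1 + reprod F l m (k + 1))
        ≤ ε * (k + 1) / (l + ε * (k + 1)) * (1 + ε / (l - ε) * (k + 1 + 1)) :=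
          mul_le_mul h2 (by linarith) (by linarith [reprod_nonneg hl hF m (k + 1)]) (by positivity)
      _ = ε / (l - ε) * (k + 1) := by field_simp; ring

/-- Beyond some `L` the previous bound with `ε = l / 2` gives `k + 1`. Below `L`, each step down in
degree adds at most one child to the value. -/
lemma exists_reprod_le (hl : 0 < l) (hF : ∀ k, 0 < F k)
    (hsub : ∀ ε : ℝ, 0 < ε → ∀ᶠ k : ℕ in atTop, F k ≤ ε * (k + 1)) :
    ∃ B : ℝ, 0 < B ∧ ∀ m k, reprod F l m k ≤ B * (k + 1) := by
  obtain ⟨L, hL⟩ := eventually_atTop.1 (hsub (l / 2) (by positivity))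
  have h1 : ∀ m k, L ≤ k → reprod F l m k ≤ k + 1 := by
    intro m k hk
    have := reprod_le_of_small hl hF (half_pos hl) (half_lt_self hl) hL m k hk
    have h2 : l / 2 / (l - l / 2) = 1 := by field_simp; ring
    rwa [h2, one_mul] at this
  have h2 : ∀ m k, k ≤ L → reprod F l m k ≤ 2 * L + 1 - k := by
    intro m
    induction m with
    | zero =>
      intro k hk
      have : (k : ℝ) ≤ L := by exact_mod_cast hk
      have : (0 : ℝ) ≤ L := by positivity
      simp only [reprod]; linarith
    | succ m ih =>
      intro k hk
      rcases hk.lt_or_eq with h | h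
      · have := ih (k + 1) h
        push_cast at this
        linarith [reprod_succ_le hl hF m k]
      · have := h1 (m + 1) k h.ge
        rw [h] at this ⊢
        linarith
  refine ⟨2 * L + 1, by positivity, fun m k => ?_⟩
  have hk0 : (0 : ℝ) ≤ k := by positivity
  have hL0 : (0 : ℝ) ≤ L := by positivity
  rcases le_total k L with h | h
  · have := h2 m k h
    nlinarith [mul_nonneg hL0 hk0]
  · have := h1 m k h
    nlinarith [mul_nonneg hL0 hk0]

end Profile

/-! ### The Lyapunov functional -/

/-- The reproductive value of degree `k + 1`, if vertices are sterile from degree `K + 2` on. -/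
def weight (F : ℕ → ℝ) (l : ℝ) (K k : ℕ) : ℝ := reprod F l (K + 1 - k) k

/-- The total reproductive value of a population. -/
def totalWeight (F : ℕ → ℝ) (l : ℝ) (K : ℕ) (X : ℕ → ℝ) : ℝ :=
  ∑ k ∈ Finset.range (K + 1), weight F l K k * X k

/-- The deviation of a population from the multiple of the limiting profile of the same total
reproductive value. -/
def deviation (F : ℕ → ℝ) (l : ℝ) (K : ℕ) (X : ℕ → ℝ) (k : ℕ) : ℝ :=
  X k - limitProb F l k * (totalWeight F l K X / totalWeight F l K (limitProb F l))

/-- The weighted `ℓ¹`-norm of the deviation. -/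
def lyapunov (F : ℕ → ℝ) (l : ℝ) (K : ℕ) (X : ℕ → ℝ) : ℝ :=
  ∑ k ∈ Finset.range (K + 1), weight F l K k * |deviation F l K X k|

section Step

variable {F : ℕ → ℝ} {l : ℝ}

lemma weight_nonneg (hl : 0 < l) (hF : ∀ k, 0 < F k) (K k : ℕ) : 0 ≤ weight F l K k :=
  reprod_nonneg hl hF _ _

lemma weight_last (K : ℕ) : weight F l K (K + 1) = 0 := by simp [weight, reprod]

lemma weight_rec (hl : 0 < l) (hF : ∀ k, 0 < F k) {K k : ℕ} (hk : k < K + 1) :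
    F k * (1 + weight F l K (k + 1) - weight F l K k) = l * weight F l K k := by
  have h1 : K + 1 - k = (K + 1 - (k + 1)) + 1 := by omega
  rw [weight, weight, h1]
  exact reprod_rec hl hF _ _

lemma div_le_weight (hl : 0 < l) (hF : ∀ k, 0 < F k) {c : ℝ} (hc : 0 < c)
    (hcF : ∀ k, c ≤ F k) {K k : ℕ} (hk : k < K + 1) : c / (l + c) ≤ weight F l K k := by
  have h1 : K + 1 - k = (K + 1 - (k + 1)) + 1 := by omega
  rw [weight, h1]
  exact div_le_reprod_succ hl hF hc hcF _ _

lemma weight_zero (K : ℕ) :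
    weight F l K 0 = ∑ j ∈ Finset.range (K + 1), survival F l (j + 1) := by
  have := reprod_mul_survival (F := F) (l := l) (K + 1) 0
  rw [survival_zero, mul_one] at this
  rw [weight, Nat.sub_zero, this]
  simp

lemma sum_mul_limitProb (hl : 0 < l) (hF : ∀ k, 0 < F k) (K : ℕ) :
    ∑ k ∈ Finset.range (K + 1), F k * limitProb F l k = l * weight F l K 0 := by
  rw [weight_zero, Finset.mul_sum]
  exact Finset.sum_congr rfl fun k _ => mul_limitProb hl hF k

lemma totalWeight_limitProb_pos (hl : 0 < l) (hF : ∀ k, 0 < F k) (K : ℕ) :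
    0 < totalWeight F l K (limitProb F l) := by
  refine Finset.sum_pos (fun k hk => mul_pos ?_ (limitProb_pos hl hF k)) (by simp)
  have h1 : K + 1 - k = (K + 1 - (k + 1)) + 1 := by
    have := Finset.mem_range.1 hk; omega
  have h2 := hF k
  have h3 := reprod_nonneg hl hF (K + 1 - (k + 1)) (k + 1)
  rw [weight, h1]
  simp only [reprod]; positivity

/-- The multiple of the profile was chosen for this cancellation, the source of the contraction in
`lyapunov_step`. -/
lemma sum_weight_mul_deviation (hl : 0 < l) (hF : ∀ k, 0 < F k) (K : ℕ) (X : ℕ → ℝ) :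
    ∑ k ∈ Finset.range (K + 1), weight F l K k * deviation F l K X k = 0 := by
  have h := (totalWeight_limitProb_pos hl hF K).ne'
  have h1 : ∀ k, weight F l K k * deviation F l K X k = weight F l K k * X k -
      (weight F l K k * limitProb F l k) *
        (totalWeight F l K X / totalWeight F l K (limitProb F l)) := fun k => by
    rw [deviation]; ring
  rw [Finset.sum_congr rfl fun k _ => h1 k, Finset.sum_sub_distrib, ← Finset.sum_mul]
  change totalWeight F l K X - totalWeight F l K (limitProb F l) * _ = 0
  field_simp; ring

/-- Summation by parts against the reproductive values. -/
lemma sum_weight_shift (hl : 0 < l) (hF : ∀ k, 0 < F k) (K : ℕ) (y : ℕ → ℝ) :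
    ∑ k ∈ Finset.range K, weight F l K (k + 1) * (F k * y k) -
      ∑ k ∈ Finset.range (K + 1), weight F l K k * (F k * y k) =
    l * ∑ k ∈ Finset.range (K + 1), weight F l K k * y k -
      ∑ k ∈ Finset.range (K + 1), F k * y k := by
  -- The truncated weight vanishes at `K + 1`, so there is no boundary term.
  have h1 : ∑ k ∈ Finset.range K, weight F l K (k + 1) * (F k * y k) =
      ∑ k ∈ Finset.range (K + 1), weight F l K (k + 1) * (F k * y k) := by
    rw [Finset.sum_range_succ _ K, weight_last]; ring
  rw [h1, Finset.mul_sum, ← Finset.sum_sub_distrib, ← Finset.sum_sub_distrib]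
  refine Finset.sum_congr rfl fun k hk => ?_
  have := weight_rec (l := l) hl hF (Finset.mem_range.1 hk)
  linear_combination y k * this

lemma totalWeight_step (hl : 0 < l) (hF : ∀ k, 0 < F k) (K : ℕ) {X X' e : ℕ → ℝ} {S J : ℝ}
    (h0 : S * (X' 0 - X 0) = -(F 0 * X 0) + J + e 0)
    (hs : ∀ k, S * (X' (k + 1) - X (k + 1)) = F k * X k - F (k + 1) * X (k + 1) + e (k + 1)) :
    S * (totalWeight F l K X' - totalWeight F l K X) = l * totalWeight F l K X -
      ∑ k ∈ Finset.range (K + 1), F k * X k + weight F l K 0 * J +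
      ∑ k ∈ Finset.range (K + 1), weight F l K k * e k := by
  have h1 := sum_weight_shift hl hF K X
  have h2 : S * (totalWeight F l K X' - totalWeight F l K X) =
      ∑ k ∈ Finset.range (K + 1), weight F l K k * (S * (X' k - X k)) := by
    rw [totalWeight, totalWeight, ← Finset.sum_sub_distrib, Finset.mul_sum]
    exact Finset.sum_congr rfl fun k _ => by ring
  rw [h2, Finset.sum_range_succ', h0, Finset.sum_congr rfl fun k _ => by rw [hs k]]
  have h3 : ∀ k, weight F l K (k + 1) * (F k * X k - F (k + 1) * X (k + 1) + e (k + 1)) =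
      weight F l K (k + 1) * (F k * X k) - weight F l K (k + 1) * (F (k + 1) * X (k + 1)) +
      weight F l K (k + 1) * e (k + 1) := fun k => by ring
  rw [Finset.sum_congr rfl fun k _ => h3 k, Finset.sum_add_distrib, Finset.sum_sub_distrib]
  rw [Finset.sum_range_succ' (fun k => weight F l K k * (F k * X k))] at h1
  rw [Finset.sum_range_succ' (fun k => weight F l K k * e k)]
  rw [totalWeight]
  linear_combination h1

/-- By `hFS` the coefficients `S - F k` are nonnegative, so the triangle inequality turns the
recursion of `C` into the same recursion, as an inequality, for `|C|`; then `sum_weight_shift`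
applies. The newborn term `J` is left for the caller to bound. -/
lemma sum_weight_abs_step (hl : 0 < l) (hF : ∀ k, 0 < F k) (K : ℕ) {C C' e : ℕ → ℝ} {S J : ℝ}
    (hS : 0 < S) (hFS : ∀ k < K + 1, F k ≤ S)
    (h0 : S * (C' 0 - C 0) = -(F 0 * C 0) + J + e 0)
    (hs : ∀ k, S * (C' (k + 1) - C (k + 1)) = F k * C k - F (k + 1) * C (k + 1) + e (k + 1)) :
    S * (∑ k ∈ Finset.range (K + 1), weight F l K k * |C' k| -
      ∑ k ∈ Finset.range (K + 1), weight F l K k * |C k|) ≤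
      l * ∑ k ∈ Finset.range (K + 1), weight F l K k * |C k| -
      ∑ k ∈ Finset.range (K + 1), F k * |C k| + weight F l K 0 * |J| +
      ∑ k ∈ Finset.range (K + 1), weight F l K k * |e k| := by
  have hw := weight_nonneg hl hF K
  have h1 := sum_weight_shift hl hF K (fun k => |C k|)
  have t0 : S * |C' 0| ≤ (S - F 0) * |C 0| + |J| + |e 0| := by
    rw [← abs_of_pos hS, ← abs_mul, abs_of_pos hS,
      show S * C' 0 = (S - F 0) * C 0 + J + e 0 by linarith]
    refine (abs_add_three _ _ _).trans ?_
    rw [abs_mul, abs_of_nonneg (sub_nonneg.2 (hFS 0 (by omega)))]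
  have ts : ∀ k < K, S * |C' (k + 1)| ≤
      (S - F (k + 1)) * |C (k + 1)| + F k * |C k| + |e (k + 1)| := by
    intro k hk
    rw [← abs_of_pos hS, ← abs_mul, abs_of_pos hS,
      show S * C' (k + 1) = (S - F (k + 1)) * C (k + 1) + F k * C k + e (k + 1) by linarith [hs k]]
    refine (abs_add_three _ _ _).trans ?_
    rw [abs_mul, abs_mul, abs_of_nonneg (sub_nonneg.2 (hFS (k + 1) (by omega))),
      abs_of_pos (hF k)]
  have h2 : S * ∑ k ∈ Finset.range (K + 1), weight F l K k * |C' k| ≤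
      ∑ k ∈ Finset.range K, weight F l K (k + 1) *
        ((S - F (k + 1)) * |C (k + 1)| + F k * |C k| + |e (k + 1)|) +
      weight F l K 0 * ((S - F 0) * |C 0| + |J| + |e 0|) := by
    rw [Finset.sum_range_succ', mul_add, Finset.mul_sum]
    refine add_le_add (Finset.sum_le_sum fun k hk => ?_) ?_
    · rw [mul_left_comm]
      exact mul_le_mul_of_nonneg_left (ts k (Finset.mem_range.1 hk)) (hw _)
    · rw [mul_left_comm]
      exact mul_le_mul_of_nonneg_left t0 (hw _)
  have h3 : ∀ k, weight F l K (k + 1) *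
        ((S - F (k + 1)) * |C (k + 1)| + F k * |C k| + |e (k + 1)|) =
      S * (weight F l K (k + 1) * |C (k + 1)|) - weight F l K (k + 1) * (F (k + 1) * |C (k + 1)|) +
      weight F l K (k + 1) * (F k * |C k|) + weight F l K (k + 1) * |e (k + 1)| :=
    fun k => by ring
  rw [Finset.sum_congr rfl fun k _ => h3 k, Finset.sum_add_distrib, Finset.sum_add_distrib,
    Finset.sum_sub_distrib, ← Finset.mul_sum] at h2
  rw [Finset.sum_range_succ' (fun k => weight F l K k * (F k * |C k|))] at h1
  rw [Finset.sum_range_succ' (fun k => weight F l K k * |e k|), mul_sub]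
  rw [Finset.sum_range_succ' (fun k => weight F l K k * |C k|)] at h1 ⊢
  linarith

/-- One step of the recursion of the degree counts `N`, perturbed to `X`: decay of the Lyapunov
functional and growth of the total reproductive value. -/
lemma lyapunov_step (hl : 0 < l) (hF : ∀ k, 0 < F k) (K L : ℕ) {N X X' : ℕ → ℝ} {S η κ : ℝ}
    (hS : 0 < S) (hFS : ∀ k < K + 1, F k ≤ S)
    (h0 : S * (X' 0 - X 0) = S - F 0 * N 0)
    (hs : ∀ k, S * (X' (k + 1) - X (k + 1)) = F k * N k - F (k + 1) * N (k + 1))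
    (hXN : ∀ k < K + 1, |X k - N k| ≤ η) (hκ : 0 ≤ κ)
    (hκF : ∀ k < L, k < K + 1 → κ * weight F l K k ≤ F k) {R : ℝ}
    (hR : |weight F l K 0 * S - ∑ k ∈ Finset.range (K + 1), F k * N k| +
      (1 + 2 * ∑ k ∈ Finset.range (K + 1), weight F l K k) *
        (∑ k ∈ Finset.range (K + 1), F k) * η ≤ R) :
    S * (lyapunov F l K X' - lyapunov F l K X) ≤ (l - κ) * lyapunov F l K X +
      2 * κ * ∑ k ∈ (Finset.range (K + 1)).filter (L ≤ ·),
        weight F l K k * |deviation F l K X k| + 2 * R ∧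
    l * totalWeight F l K X - R ≤ S * (totalWeight F l K X' - totalWeight F l K X) := by
  have hw := weight_nonneg hl hF K
  set Φ := ∑ k ∈ Finset.range (K + 1), F k with hΦ
  have hFΦ : ∀ k < K + 1, F k ≤ Φ := fun k hk =>
    Finset.single_le_sum (f := F) (fun i _ => (hF i).le) (Finset.mem_range.2 hk)
  set σ := totalWeight F l K (limitProb F l) with hσ
  have hσ0 : 0 < σ := totalWeight_limitProb_pos hl hF K
  set Z := totalWeight F l K X with hZ
  set Z' := totalWeight F l K X' with hZ'
  set W := ∑ k ∈ Finset.range (K + 1), weight F l K k with hW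
  -- the error from replacing `N` by `X` in the drift
  let e : ℕ → ℝ := fun k => k.casesOn (F 0 * (X 0 - N 0))
    (fun j => F j * (N j - X j) + F (j + 1) * (X (j + 1) - N (j + 1)))
  have he : ∀ k < K + 1, |e k| ≤ 2 * (Φ * η) := by
    have hb : ∀ k < K + 1, F k * |X k - N k| ≤ Φ * η := fun k hk =>
      mul_le_mul (hFΦ k hk) (hXN k hk) (abs_nonneg _) ((hF k).le.trans (hFΦ k hk))
    intro k hk
    cases k with
    | zero =>
      have := hb 0 hk
      have h2 : |e 0| = F 0 * |X 0 - N 0| := by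
        change |F 0 * (X 0 - N 0)| = _
        rw [abs_mul, abs_of_pos (hF 0)]
      have h3 : 0 ≤ F 0 * |X 0 - N 0| := mul_nonneg (hF 0).le (abs_nonneg _)
      linarith
    | succ j =>
      have h1 := hb (j + 1) hk
      have h2 := hb j (by omega)
      have h3 : |e (j + 1)| ≤ F j * |X j - N j| + F (j + 1) * |X (j + 1) - N (j + 1)| := by
        change |F j * (N j - X j) + F (j + 1) * (X (j + 1) - N (j + 1))| ≤ _
        refine (abs_add_le _ _).trans ?_
        rw [abs_mul, abs_mul, abs_of_pos (hF j), abs_of_pos (hF (j + 1)), abs_sub_comm]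
      linarith
  have hwe : ∑ k ∈ Finset.range (K + 1), weight F l K k * |e k| ≤ 2 * W * Φ * η := by
    calc ∑ k ∈ Finset.range (K + 1), weight F l K k * |e k|
        ≤ ∑ k ∈ Finset.range (K + 1), weight F l K k * (2 * (Φ * η)) :=
          Finset.sum_le_sum fun k hk =>
            mul_le_mul_of_nonneg_left (he k (Finset.mem_range.1 hk)) (hw k)
      _ = 2 * W * Φ * η := by rw [← Finset.sum_mul]; ring
  have hX0 : S * (X' 0 - X 0) = -(F 0 * X 0) + S + e 0 := by
    rw [h0]; change _ = -(F 0 * X 0) + S + F 0 * (X 0 - N 0); ring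
  have hXs : ∀ k, S * (X' (k + 1) - X (k + 1)) =
      F k * X k - F (k + 1) * X (k + 1) + e (k + 1) := by
    intro k
    rw [hs]
    change _ = F k * X k - F (k + 1) * X (k + 1) +
      (F k * (N k - X k) + F (k + 1) * (X (k + 1) - N (k + 1)))
    ring
  have hZstep := totalWeight_step hl hF K hX0 hXs
  set E := weight F l K 0 * S - ∑ k ∈ Finset.range (K + 1), F k * X k +
      ∑ k ∈ Finset.range (K + 1), weight F l K k * e k with hE
  have hZstep' : S * (Z' - Z) = l * Z + E := by rw [hZstep, hE]; ring
  have hXNsum : |∑ k ∈ Finset.range (K + 1), F k * N k - ∑ k ∈ Finset.range (K + 1), F k * X k| ≤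
      Φ * η := by
    rw [← Finset.sum_sub_distrib, hΦ, Finset.sum_mul]
    refine (Finset.abs_sum_le_sum_abs _ _).trans (Finset.sum_le_sum fun k hk => ?_)
    rw [← mul_sub, abs_mul, abs_of_pos (hF k), abs_sub_comm]
    exact mul_le_mul_of_nonneg_left (hXN k (Finset.mem_range.1 hk)) (hF k).le
  set G := |weight F l K 0 * S - ∑ k ∈ Finset.range (K + 1), F k * X k| with hG
  have hGR : G + 2 * W * Φ * η ≤ R := by
    have : G ≤ |weight F l K 0 * S - ∑ k ∈ Finset.range (K + 1), F k * N k| + Φ * η := by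
      refine le_trans ?_ (add_le_add le_rfl hXNsum)
      refine le_trans (le_of_eq ?_) (abs_add_le _ _)
      rw [hG]; congr 1; ring
    refine le_trans ?_ hR
    linarith
  have hEwe : |E| ≤ G + ∑ k ∈ Finset.range (K + 1), weight F l K k * |e k| := by
    refine (abs_add_le _ _).trans (add_le_add le_rfl ?_)
    refine (Finset.abs_sum_le_sum_abs _ _).trans (Finset.sum_le_sum fun k _ => ?_)
    rw [abs_mul, abs_of_nonneg (hw k)]
  have hER : |E| ≤ R := by linarith
  refine ⟨?_, by rw [hZstep']; linarith [neg_abs_le E]⟩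
  -- the recursion of the deviation
  set C := deviation F l K X with hC
  set C' := deviation F l K X' with hC'
  have hCk : ∀ k, C k = X k - limitProb F l k * (Z / σ) := fun _ => rfl
  have hCk' : ∀ k, C' k = X' k - limitProb F l k * (Z' / σ) := fun _ => rfl
  have hζ : S * (Z' / σ - Z / σ) = l * (Z / σ) + E / σ := by
    rw [← sub_div, ← mul_div_assoc, hZstep', add_div, mul_div_assoc]
  have hC0 : S * (C' 0 - C 0) =
      -(F 0 * C 0) + (S - l * (Z / σ)) + (e 0 - limitProb F l 0 * (E / σ)) := by
    have h1 := add_mul_limitProb hl hF 0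
    rw [survival_zero] at h1
    rw [hCk, hCk']
    linear_combination hX0 - limitProb F l 0 * hζ - (Z / σ) * h1
  have hCs : ∀ k, S * (C' (k + 1) - C (k + 1)) = F k * C k - F (k + 1) * C (k + 1) +
      (e (k + 1) - limitProb F l (k + 1) * (E / σ)) := by
    intro k
    have h1 := add_mul_limitProb hl hF (k + 1)
    have h2 := mul_limitProb hl hF k
    rw [hCk, hCk', hCk]
    linear_combination hXs k - limitProb F l (k + 1) * hζ - (Z / σ) * h1 + (Z / σ) * h2
  have hstep := sum_weight_abs_step hl hF K (e := fun k => e k - limitProb F l k * (E / σ))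
    hS hFS hC0 hCs
  -- The profile produces newborns at total rate `l * weight F l K 0`, so the newborn term of the
  -- deviation equals, up to `G`, the signed sum of `F k * C k`. Bounding it by the sum of absolute
  -- values would give no decay.
  have hJ : weight F l K 0 * |S - l * (Z / σ)| ≤
      |∑ k ∈ Finset.range (K + 1), F k * C k| + G := by
    have h1 : weight F l K 0 * (S - l * (Z / σ)) = ∑ k ∈ Finset.range (K + 1), F k * C k +
        (weight F l K 0 * S - ∑ k ∈ Finset.range (K + 1), F k * X k) := by
      have h2 := sum_mul_limitProb hl hF K
      have h3 : ∑ k ∈ Finset.range (K + 1), F k * C k = ∑ k ∈ Finset.range (K + 1), F k * X k -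
          (∑ k ∈ Finset.range (K + 1), F k * limitProb F l k) * (Z / σ) := by
        rw [Finset.sum_mul, ← Finset.sum_sub_distrib]
        exact Finset.sum_congr rfl fun k _ => by rw [hCk]; ring
      rw [h3, h2]; ring
    rw [← abs_of_nonneg (hw 0), ← abs_mul, h1]
    exact abs_add_le _ _
  -- The error `E` of `Z` is spread over the profile, whose total weight is `σ`; it therefore costs
  -- exactly `|E|`.
  have herr : ∑ k ∈ Finset.range (K + 1), weight F l K k * |e k - limitProb F l k * (E / σ)| ≤
      ∑ k ∈ Finset.range (K + 1), weight F l K k * |e k| + |E| := by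
    have h1 : |E| = ∑ k ∈ Finset.range (K + 1), weight F l K k * (limitProb F l k * (|E| / σ)) := by
      have : ∀ k, weight F l K k * (limitProb F l k * (|E| / σ)) =
        weight F l K k * limitProb F l k * (|E| / σ) := fun k => by ring
      rw [Finset.sum_congr rfl fun k _ => this k, ← Finset.sum_mul]
      change _ = σ * (|E| / σ)
      field_simp
    rw [h1, ← Finset.sum_add_distrib]
    refine Finset.sum_le_sum fun k _ => ?_
    rw [← mul_add]
    refine mul_le_mul_of_nonneg_left ((abs_sub _ _).trans ?_) (hw k)
    rw [abs_mul, abs_of_pos (limitProb_pos hl hF k), abs_div, abs_of_pos hσ0]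
  set T := ∑ k ∈ (Finset.range (K + 1)).filter (L ≤ ·), weight F l K k * |C k| with hT
  -- the contraction, from a uniform reset rate at low degrees
  have hreset : |∑ k ∈ Finset.range (K + 1), F k * C k| ≤
      ∑ k ∈ Finset.range (K + 1), F k * |C k| - κ * lyapunov F l K X + 2 * κ * T := by
    have h1 := sum_weight_mul_deviation hl hF K X
    -- Subtracting `κ` times the vanishing total weight changes nothing in the sum, but lowers each
    -- low-degree coefficient while keeping it nonnegative. Degrees from `L` on may get a negative
    -- coefficient, whence `T`.
    have h2 : ∑ k ∈ Finset.range (K + 1), F k * C k =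
        ∑ k ∈ Finset.range (K + 1), (F k - κ * weight F l K k) * C k := by
      have : ∀ k, (F k - κ * weight F l K k) * C k =
        F k * C k - κ * (weight F l K k * C k) := fun k => by ring
      rw [Finset.sum_congr rfl fun k _ => this k, Finset.sum_sub_distrib, ← Finset.mul_sum, h1]
      ring
    have h3 : ∀ k ∈ Finset.range (K + 1), |(F k - κ * weight F l K k) * C k| ≤
        F k * |C k| - κ * (weight F l K k * |C k|) +
          2 * κ * (if L ≤ k then weight F l K k * |C k| else 0) := by
      intro k hk
      rw [abs_mul]
      split_ifs with hLk
      · have h4 : |F k - κ * weight F l K k| ≤ F k + κ * weight F l K k :=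
          (abs_sub _ _).trans (by rw [abs_of_pos (hF k), abs_of_nonneg (mul_nonneg hκ (hw k))])
        nlinarith [mul_le_mul_of_nonneg_right h4 (abs_nonneg (C k))]
      · rw [abs_of_nonneg (sub_nonneg.2 (hκF k (by omega) (Finset.mem_range.1 hk)))]
        linarith
    rw [h2]
    refine (Finset.abs_sum_le_sum_abs _ _).trans ((Finset.sum_le_sum h3).trans (le_of_eq ?_))
    rw [Finset.sum_add_distrib, Finset.sum_sub_distrib, ← Finset.mul_sum, ← Finset.mul_sum, hT,
      Finset.sum_filter, lyapunov]
  change S * (lyapunov F l K X' - lyapunov F l K X) ≤ l * lyapunov F l K X - _ + _ + _ at hstep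
  linarith

end Step

/-! ### Convergence of the degree proportions -/

/-- The degree counts `N n k` (of degree `k + 1` at time `n`) and the total attachment rate `S n`
of a growing tree whose degree counts are, up to an error `N n - X n` of smaller order, driven by
attachment with probabilities proportional to `F`. -/
structure DegreeFlow (F : ℕ → ℝ) (N X : ℕ → ℕ → ℝ) (S : ℕ → ℝ) (c B : ℝ) : Prop where
  rate_lower_pos : 0 < c
  le_rate : ∀ k, c ≤ F k
  nonneg : ∀ n k, 0 ≤ N n k
  mass_le : ∀ n K, ∑ k ∈ Finset.range K, N n k ≤ n
  le_mass : ∀ᶠ n : ℕ in atTop, ∀ K : ℕ,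
    ((K : ℝ) + 1) * (n - ∑ k ∈ Finset.range K, N n k) ≤ 2 * n
  moment_le : ∀ᶠ n : ℕ in atTop, ∀ K, ∑ k ∈ Finset.range K, ((k : ℝ) + 1) * N n k ≤ 2 * n
  total_bounds : ∀ᶠ n : ℕ in atTop, c * n ≤ S n ∧ S n ≤ B * n
  step_zero : ∀ᶠ n in atTop, S n * (X (n + 1) 0 - X n 0) = S n - F 0 * N n 0
  step_succ : ∀ᶠ n in atTop, ∀ k, S n * (X (n + 1) (k + 1) - X n (k + 1)) =
    F k * N n k - F (k + 1) * N n (k + 1)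
  close : ∀ k, Tendsto (fun n : ℕ => (X n k - N n k) / n) atTop (𝓝 0)

namespace DegreeFlow

variable {F : ℕ → ℝ} {N X : ℕ → ℕ → ℝ} {S : ℕ → ℝ} {c B : ℝ}

lemma eventually_close (h : DegreeFlow F N X S c B) (K : ℕ) {η : ℝ} (hη : 0 < η) :
    ∀ᶠ n : ℕ in atTop, ∀ k < K, |X n k - N n k| ≤ η * n := by
  have h1 : ∀ k ∈ Finset.range K, ∀ᶠ n : ℕ in atTop, |X n k - N n k| ≤ η * n := by
    intro k _
    filter_upwards [Metric.tendsto_nhds.1 (h.close k) η hη, eventually_gt_atTop 0] with n hn hn0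
    have hnR : (0 : ℝ) < n := by exact_mod_cast hn0
    rw [Real.dist_eq, sub_zero, abs_div, Nat.abs_cast, div_lt_iff₀ hnR] at hn
    exact hn.le
  filter_upwards [(Finset.eventually_all _).2 h1] with n hn k hk
  exact hn k (Finset.mem_range.2 hk)

set_option maxHeartbeats 1000000 in
/-- If the attachment function is sublinear, the low degree counts are eventually almost
proportional to the limiting profile. -/
lemma eventually_exists_profile (h : DegreeFlow F N X S c B) {l : ℝ} (hl : 0 < l)
    (hsub : ∀ ε : ℝ, 0 < ε → ∀ᶠ k : ℕ in atTop, F k ≤ ε * (k + 1))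
    (hsum : HasSum (fun j => survival F l (j + 1)) 1)
    (htail : ∀ ε : ℝ, 0 < ε → ∀ᶠ K : ℕ in atTop, ∀ᶠ n : ℕ in atTop,
      |S n - ∑ k ∈ Finset.range K, F k * N n k| ≤ ε * n)
    (M : ℕ) {δ : ℝ} (hδ : 0 < δ) :
    ∀ᶠ n : ℕ in atTop, ∃ ζ : ℝ, ∀ k < M, |N n k - limitProb F l k * ζ| ≤ δ * n := by
  have hc := h.rate_lower_pos
  have hF : ∀ k, 0 < F k := fun k => hc.trans_le (h.le_rate k)
  have hBpos : 0 < B := by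
    obtain ⟨n, hn, hn'⟩ := (h.total_bounds.and (eventually_gt_atTop 0)).exists
    have hnR : (0 : ℝ) < n := by exact_mod_cast hn'
    exact hc.trans_le (le_of_mul_le_mul_right (hn.1.trans hn.2) hnR)
  obtain ⟨H, hH, hHle⟩ := exists_reprod_le hl hF hsub
  obtain ⟨c₀, hc₀def⟩ : ∃ c₀, c₀ = c / (l + c) := ⟨_, rfl⟩
  have hc₀ : 0 < c₀ := by rw [hc₀def]; positivity
  obtain ⟨z, hz⟩ : ∃ z, z = c₀ / 4 := ⟨_, rfl⟩
  have hz0 : 0 < z := by rw [hz]; positivity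
  -- At the end `c₀ |deviation| ≤ V ≤ 2 γ Z ≤ 6 γ H n`, which this choice makes equal to `c₀ (δ / 2)
  -- n`.
  obtain ⟨γ, hγ⟩ : ∃ γ, γ = δ * c₀ / (12 * H) := ⟨_, rfl⟩
  have hγ0 : 0 < γ := by rw [hγ]; positivity
  obtain ⟨C₁, hC₁⟩ : ∃ C₁, C₁ = 3 + 12 * H / c₀ := ⟨_, rfl⟩
  have hC₁0 : 0 < C₁ := by rw [hC₁]; positivity
  -- The high-degree error `2 κ A C₁` is then half of the budget `κ γ z`, whatever `κ` is. So `A`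
  -- can be fixed before `L` and `κ`, which depend on it.
  obtain ⟨A, hA⟩ : ∃ A, A = γ * z / (4 * C₁) := ⟨_, rfl⟩
  have hA0 : 0 < A := by rw [hA]; positivity
  -- the degree beyond which the reproductive values are small relative to the degree
  have hεA : l * (A / (1 + A)) < l := by
    have : A / (1 + A) < 1 := by rw [div_lt_one (by positivity)]; linarith
    nlinarith
  obtain ⟨L, hL⟩ := eventually_atTop.1 (hsub (l * (A / (1 + A))) (by positivity))
  have hwA : ∀ K k, L ≤ k → weight F l K k ≤ A * (k + 1) := by
    intro K k hk
    have := reprod_le_of_small hl hF (by positivity) hεA hL (K + 1 - k) k hk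
    have h2 : l * (A / (1 + A)) / (l - l * (A / (1 + A))) = A := by
      have : l - l * (A / (1 + A)) = l / (1 + A) := by field_simp; ring
      rw [this]; field_simp
    rwa [h2] at this
  obtain ⟨κ, hκ⟩ : ∃ κ, κ = c / (H * (L + 1)) := ⟨_, rfl⟩
  have hκ0 : 0 < κ := by rw [hκ]; positivity
  have hκF : ∀ K k, k < L → κ * weight F l K k ≤ F k := by
    intro K k hk
    refine le_trans ?_ (h.le_rate k)
    have hkL : (k : ℝ) + 1 ≤ L + 1 := by have : (k : ℝ) ≤ L := by exact_mod_cast hk.le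
                                         linarith
    calc κ * weight F l K k ≤ κ * (H * (L + 1)) :=
          mul_le_mul_of_nonneg_left ((hHle _ _).trans (mul_le_mul_of_nonneg_left hkL hH.le)) hκ0.le
      _ = c := by rw [hκ]; field_simp
  -- The other half of the budget: `(2 + γ) ε = κ γ z / 2`.
  obtain ⟨ε, hε⟩ : ∃ ε, ε = κ * γ * z / (2 * (2 + γ)) := ⟨_, rfl⟩
  have hε0 : 0 < ε := by rw [hε]; positivity
  -- the truncation level
  have hKw : ∀ᶠ K in atTop, B * |weight F l K 0 - 1| ≤ ε / 3 := by
    have h1 : Tendsto (fun K => weight F l K 0) atTop (𝓝 1) := by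
      have := (hsum.tendsto_sum_nat).comp (tendsto_add_atTop_nat 1)
      refine this.congr fun K => ?_
      rw [weight_zero]; rfl
    filter_upwards [Metric.tendsto_nhds.1 h1 (ε / 3 / B) (by positivity)] with K hK
    rw [Real.dist_eq, lt_div_iff₀ hBpos] at hK
    linarith
  obtain ⟨K, hKw, hKt, hKM, hK2⟩ := (hKw.and (((tendsto_add_atTop_nat 1).eventually
    (htail (ε / 3) (by positivity))).and
    ((eventually_ge_atTop M).and (eventually_ge_atTop 2)))).exists
  have hw := weight_nonneg hl hF K
  have hwc : ∀ k < K + 1, c₀ ≤ weight F l K k := fun k hk => by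
    rw [hc₀def]; exact div_le_weight hl hF hc h.le_rate hk
  set W := ∑ k ∈ Finset.range (K + 1), weight F l K k with hW
  have hW0 : 0 ≤ W := Finset.sum_nonneg fun k _ => hw k
  set Φ := ∑ k ∈ Finset.range (K + 1), F k with hΦ
  have hΦ0 : 0 ≤ Φ := Finset.sum_nonneg fun k _ => (hF k).le
  -- the tolerance for the error of `X`
  obtain ⟨η, hη0, hη1, hη2, hη3, hη4, hη5⟩ : ∃ η : ℝ, 0 < η ∧ W * η ≤ z ∧ W * η ≤ H ∧ W * η ≤ A ∧
      (1 + 2 * W) * Φ * η ≤ ε / 3 ∧ η ≤ δ / 2 := by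
    have hlim : ∀ a b : ℝ, 0 < b → ∀ᶠ η : ℝ in 𝓝[>] 0, a * η ≤ b := by
      intro a b hb
      have : Tendsto (fun η : ℝ => a * η) (𝓝[>] 0) (𝓝 0) := by
        have := (continuous_const_mul a).tendsto (0 : ℝ)
        rw [mul_zero] at this
        exact this.mono_left nhdsWithin_le_nhds
      exact (this.eventually_lt_const hb).mono fun _ h => h.le
    obtain ⟨η, h0, h1, h2, h3, h4, h5⟩ := ((eventually_mem_nhdsWithin (a := (0 : ℝ)) (s := Set.Ioi 0)).and
      ((hlim W z hz0).and ((hlim W H hH).and ((hlim W A hA0).and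
      ((hlim ((1 + 2 * W) * Φ) (ε / 3) (by positivity)).and
        (hlim 1 (δ / 2) (by positivity))))))).exists
    exact ⟨η, h0, h1, h2, h3, h4, by linarith⟩
  set σ := totalWeight F l K (limitProb F l) with hσ
  have hσ0 : 0 < σ := totalWeight_limitProb_pos hl hF K
  have hK4 : (4 : ℝ) ≤ ((K + 1 : ℕ) : ℝ) + 1 := by
    have : (2 : ℝ) ≤ K := by exact_mod_cast hK2
    push_cast; linarith
  -- As `K ≥ 2`, the limit law gives at least half of its mass to the retained degrees, each of
  -- weight at least `c₀`.
  have hσc : c₀ / 2 ≤ σ := by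
    have h1 : (1 : ℝ) / 2 ≤ ∑ k ∈ Finset.range (K + 1), limitProb F l k := by
      rw [sum_limitProb hl hF]
      have := mul_survival_le hl hF hsum (K + 1)
      have := survival_pos hl hF (K + 1)
      nlinarith
    calc c₀ / 2 = c₀ * (1 / 2) := by ring
      _ ≤ c₀ * ∑ k ∈ Finset.range (K + 1), limitProb F l k := by gcongr
      _ ≤ σ := by
        rw [Finset.mul_sum]
        exact Finset.sum_le_sum fun k hk =>
          mul_le_mul_of_nonneg_right (hwc k (Finset.mem_range.1 hk)) (limitProb_pos hl hF k).le
  have hclose := h.eventually_close (K + 1) hη0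
  have hdiff : ∀ᶠ n : ℕ in atTop, |totalWeight F l K (X n) - totalWeight F l K (N n)| ≤ W * η * n := by
    filter_upwards [hclose] with n hn
    rw [totalWeight, totalWeight, ← Finset.sum_sub_distrib, mul_assoc, hW, Finset.sum_mul]
    refine (Finset.abs_sum_le_sum_abs _ _).trans (Finset.sum_le_sum fun k hk => ?_)
    rw [← mul_sub, abs_mul, abs_of_nonneg (hw k)]
    exact mul_le_mul_of_nonneg_left (hn k (Finset.mem_range.1 hk)) (hw k)
  -- At least half of the vertices have a retained degree, so `N` has value at least `c₀ n / 2 = 2 z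
  -- n`; replacing `N` by `X` loses at most `z n`.
  have hZlow : ∀ᶠ n : ℕ in atTop, z * n ≤ totalWeight F l K (X n) := by
    filter_upwards [hdiff, h.le_mass] with n hn hm
    have h1 : (n : ℝ) / 2 ≤ ∑ k ∈ Finset.range (K + 1), N n k := by
      have h2 := hm (K + 1)
      have h3 := h.mass_le n (K + 1)
      nlinarith
    have h4 : c₀ * ((n : ℝ) / 2) ≤ totalWeight F l K (N n) := by
      refine (mul_le_mul_of_nonneg_left h1 hc₀.le).trans ?_
      rw [Finset.mul_sum]
      exact Finset.sum_le_sum fun k hk =>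
        mul_le_mul_of_nonneg_right (hwc k (Finset.mem_range.1 hk)) (h.nonneg n k)
    have h5 : W * η * n ≤ z * n := by gcongr
    have := (abs_le.1 hn).1
    rw [hz] at h5 ⊢
    linarith
  have hZup : ∀ᶠ n : ℕ in atTop, totalWeight F l K (X n) ≤ 3 * H * n := by
    filter_upwards [hdiff, h.moment_le] with n hn hm
    have h4 : totalWeight F l K (N n) ≤ H * (2 * n) := by
      refine le_trans ?_ (mul_le_mul_of_nonneg_left (hm (K + 1)) hH.le)
      rw [Finset.mul_sum]
      refine Finset.sum_le_sum fun k hk => ?_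
      rw [← mul_assoc]
      exact mul_le_mul_of_nonneg_right (hHle _ _) (h.nonneg n k)
    have h5 : W * η * n ≤ H * n := by gcongr
    have := (abs_le.1 hn).2
    linarith
  -- Beyond `L` the weights are at most `A (k + 1)`, and the first moments of `N n` and of the limit
  -- law are at most `2 n` and `2`. The constant `C₁` does not depend on `K`.
  have hT : ∀ᶠ n : ℕ in atTop, ∑ k ∈ (Finset.range (K + 1)).filter (L ≤ ·),
      weight F l K k * |deviation F l K (X n) k| ≤ A * C₁ * n := by
    filter_upwards [hclose, hZup, hZlow, h.moment_le] with n hn hZ hZ0 hm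
    set Z := totalWeight F l K (X n) with hZdef
    have hZ0' : 0 ≤ Z := le_trans (by positivity) hZ0
    have hζ : Z / σ ≤ 6 * H / c₀ * n := by
      calc Z / σ ≤ 3 * H * n / (c₀ / 2) := div_le_div₀ (by positivity) hZ (by positivity) hσc
        _ = 6 * H / c₀ * n := by field_simp; ring
    have hζ0 : 0 ≤ Z / σ := by positivity
    have h1 : ∀ k ∈ (Finset.range (K + 1)).filter (L ≤ ·),
        weight F l K k * |deviation F l K (X n) k| ≤ A * (((k : ℝ) + 1) * N n k) +
          weight F l K k * (η * n) + A * (((k : ℝ) + 1) * limitProb F l k) * (Z / σ) := by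
      intro k hk
      rw [Finset.mem_filter, Finset.mem_range] at hk
      have h2 : |deviation F l K (X n) k| ≤ N n k + η * n + limitProb F l k * (Z / σ) := by
        have : deviation F l K (X n) k =
          N n k + (X n k - N n k) + -(limitProb F l k * (Z / σ)) := by rw [deviation]; ring
        rw [this]
        refine (abs_add_three _ _ _).trans ?_
        rw [abs_of_nonneg (h.nonneg n k), abs_neg,
          abs_of_nonneg (mul_nonneg (limitProb_pos hl hF k).le hζ0)]
        linarith [hn k hk.1]
      have h3 := hwA K k hk.2
      have h4 := mul_le_mul_of_nonneg_left h2 (hw k)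
      have h5 := mul_le_mul_of_nonneg_right h3 (h.nonneg n k)
      have h6 := mul_le_mul_of_nonneg_right h3
        (mul_nonneg (limitProb_pos hl hF k).le hζ0)
      linarith
    have h7 : ∀ k : ℕ, 0 ≤ A * (((k : ℝ) + 1) * N n k) +
          weight F l K k * (η * n) + A * (((k : ℝ) + 1) * limitProb F l k) * (Z / σ) := by
      intro k
      have := h.nonneg n k
      have := hw k
      have := (limitProb_pos hl hF k).le
      positivity
    refine (Finset.sum_le_sum h1).trans ((Finset.sum_le_sum_of_subset_of_nonneg
      (Finset.filter_subset _ _) fun k _ _ => h7 k).trans ?_)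
    rw [Finset.sum_add_distrib, Finset.sum_add_distrib, ← Finset.mul_sum, ← Finset.sum_mul,
      ← Finset.sum_mul, ← Finset.mul_sum]
    have h8 := mul_le_mul_of_nonneg_left (hm (K + 1)) hA0.le
    have h9 : W * (η * n) ≤ A * n := by rw [← mul_assoc]; gcongr
    have h10 : A * (∑ k ∈ Finset.range (K + 1), ((k : ℝ) + 1) * limitProb F l k) * (Z / σ) ≤
        A * 2 * (6 * H / c₀ * n) := by
      refine mul_le_mul (mul_le_mul_of_nonneg_left (sum_mul_limitProb_le hl hF hsum _) hA0.le)
        hζ hζ0 (by positivity)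
    have h11 : A * C₁ * n = A * (2 * n) + A * n + A * 2 * (6 * H / c₀ * n) := by
      rw [hC₁]; ring
    linarith
  have hSF : ∀ᶠ n in atTop, 0 < S n ∧ ∀ k < K + 1, F k ≤ S n := by
    filter_upwards [h.total_bounds, eventually_gt_atTop 0,
      tendsto_natCast_atTop_atTop.eventually_ge_atTop (Φ / c)] with n hn hn0 hnΦ
    have hnR : (0 : ℝ) < n := by exact_mod_cast hn0
    refine ⟨lt_of_lt_of_le (by positivity) hn.1, fun k hk => ?_⟩
    rw [div_le_iff₀ hc] at hnΦ
    have := Finset.single_le_sum (f := F) (fun i _ => (hF i).le) (Finset.mem_range.2 hk)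
    linarith [hn.1]
  have hstep : ∀ᶠ n : ℕ in atTop,
      S n * (lyapunov F l K (X (n + 1)) - lyapunov F l K (X n)) ≤
        (l - κ) * lyapunov F l K (X n) + (2 * κ * A * C₁ + 2 * ε) * n ∧
      l * totalWeight F l K (X n) - ε * n ≤
        S n * (totalWeight F l K (X (n + 1)) - totalWeight F l K (X n)) := by
    filter_upwards [hclose, hT, hSF, hKt, h.total_bounds, h.step_zero, h.step_succ]
      with n hn hTn hSn hKn hSb h0 hs
    have hR : |weight F l K 0 * S n - ∑ k ∈ Finset.range (K + 1), F k * N n k| +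
        (1 + 2 * W) * Φ * (η * n) ≤ ε * n := by
      have h1 : |weight F l K 0 * S n - ∑ k ∈ Finset.range (K + 1), F k * N n k| ≤
          ε / 3 * n + ε / 3 * n := by
        have : weight F l K 0 * S n - ∑ k ∈ Finset.range (K + 1), F k * N n k =
          (weight F l K 0 - 1) * S n + (S n - ∑ k ∈ Finset.range (K + 1), F k * N n k) := by ring
        rw [this]
        refine (abs_add_le _ _).trans (add_le_add ?_ hKn)
        rw [abs_mul, abs_of_pos hSn.1]
        calc |weight F l K 0 - 1| * S n ≤ |weight F l K 0 - 1| * (B * n) :=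
              mul_le_mul_of_nonneg_left hSb.2 (abs_nonneg _)
          _ = B * |weight F l K 0 - 1| * n := by ring
          _ ≤ ε / 3 * n := by gcongr
      have h2 : (1 + 2 * W) * Φ * (η * n) ≤ ε / 3 * n := by rw [← mul_assoc]; gcongr
      linarith
    obtain ⟨hV, hZ⟩ := lyapunov_step hl hF K L hSn.1 hSn.2 h0 hs hn hκ0.le
      (fun k hk _ => hκF K k hk) hR
    refine ⟨hV.trans ?_, hZ⟩
    have := mul_le_mul_of_nonneg_left hTn (by positivity : 0 ≤ 2 * κ)
    linarith
  have hfinal := eventually_le_of_contraction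
    (V := fun n => lyapunov F l K (X n)) (Z := fun n => totalWeight F l K (X n))
    (t := 2 * κ * A * C₁ + 2 * ε) hl hκ0 hc hz0 hγ0 h.total_bounds hZlow
    (hstep.mono fun _ h => h.1) (hstep.mono fun _ h => h.2)
    (by
      have e1 : 2 * κ * A * C₁ = κ * γ * z / 2 := by rw [hA]; field_simp; ring
      have e2 : (2 + γ) * ε = κ * γ * z / 2 := by rw [hε]; field_simp
      linarith)
    (by
      have e2 : (2 + γ) * (2 * ε) = γ * (κ * z) := by rw [hε]; field_simp
      have e3 : 0 < κ * z := by positivity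
      nlinarith)
  filter_upwards [hfinal, hZup, hclose] with n hV hZ hn
  refine ⟨totalWeight F l K (X n) / σ, fun k hk => ?_⟩
  have hkK : k < K + 1 := by omega
  have h1 : c₀ * |deviation F l K (X n) k| ≤ c₀ * (δ / 2 * n) := by
    calc c₀ * |deviation F l K (X n) k| ≤ weight F l K k * |deviation F l K (X n) k| :=
          mul_le_mul_of_nonneg_right (hwc k hkK) (abs_nonneg _)
      _ ≤ lyapunov F l K (X n) :=
          Finset.single_le_sum (f := fun k => weight F l K k * |deviation F l K (X n) k|)
            (fun i _ => mul_nonneg (hw i) (abs_nonneg _)) (Finset.mem_range.2 hkK)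
      _ ≤ 2 * γ * totalWeight F l K (X n) := hV
      _ ≤ 2 * γ * (3 * H * n) := by gcongr
      _ = c₀ * (δ / 2 * n) := by rw [hγ]; field_simp; ring
  have h2 := le_of_mul_le_mul_left h1 hc₀
  have h3 : N n k - limitProb F l k * (totalWeight F l K (X n) / σ) =
      deviation F l K (X n) k - (X n k - N n k) := by rw [deviation]; ring
  rw [h3]
  refine (abs_sub _ _).trans ?_
  have h4 : η * (n : ℝ) ≤ δ / 2 * n := by gcongr
  linarith [hn k hkK]

/-- Up to a small fraction, both the counts and the limit law have all their mass below a fixed `M`.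
Summing the approximate proportionality over `k < M` thus forces `ζ` to be close to `n`. -/
theorem tendsto_of_sublinear (h : DegreeFlow F N X S c B) {l : ℝ} (hl : 0 < l)
    (hsub : ∀ ε : ℝ, 0 < ε → ∀ᶠ k : ℕ in atTop, F k ≤ ε * (k + 1))
    (hsum : HasSum (fun j => survival F l (j + 1)) 1)
    (htail : ∀ ε : ℝ, 0 < ε → ∀ᶠ K : ℕ in atTop, ∀ᶠ n : ℕ in atTop,
      |S n - ∑ k ∈ Finset.range K, F k * N n k| ≤ ε * n) (k : ℕ) :
    Tendsto (fun n : ℕ => N n k / n) atTop (𝓝 (limitProb F l k)) := by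
  have hF : ∀ k, 0 < F k := fun k => h.rate_lower_pos.trans_le (h.le_rate k)
  rw [Metric.tendsto_nhds]
  intro ε' hε'
  obtain ⟨ε, hεdef⟩ : ∃ ε, ε = min (ε' / 8) (1 / 4) := ⟨_, rfl⟩
  have hε : 0 < ε := by rw [hεdef]; positivity
  have hε1 : ε ≤ ε' / 8 := by rw [hεdef]; exact min_le_left _ _
  have hε2 : ε ≤ 1 / 4 := by rw [hεdef]; exact min_le_right _ _
  obtain ⟨M, hkM, hM⟩ : ∃ M : ℕ, k < M ∧ 2 ≤ ε * (M + 1) := by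
    obtain ⟨M, hM⟩ := exists_nat_gt (2 / ε)
    refine ⟨max M (k + 1), by omega, ?_⟩
    rw [div_lt_iff₀ hε] at hM
    have : (M : ℝ) ≤ (max M (k + 1) : ℕ) := by exact_mod_cast le_max_left _ _
    nlinarith
  have hM0 : (0 : ℝ) < M := by exact_mod_cast (Nat.zero_le k).trans_lt hkM
  -- The tolerance is divided by `M` because the `M` errors are added in `hQP`.
  have hprof := h.eventually_exists_profile hl hsub hsum htail M (δ := ε / M) (by positivity)
  filter_upwards [hprof, h.le_mass, eventually_gt_atTop 0] with n ⟨ζ, hζ⟩ hm hn0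
  have hn : (0 : ℝ) < n := by exact_mod_cast hn0
  set P := ∑ k ∈ Finset.range M, limitProb F l k with hP
  set Q := ∑ k ∈ Finset.range M, N n k with hQ
  have hP1 : P ≤ 1 := by
    rw [hP, sum_limitProb hl hF]; linarith [survival_pos hl hF M]
  have hP2 : 1 - ε ≤ P := by
    rw [hP, sum_limitProb hl hF]
    have h1 := mul_survival_le hl hF hsum M
    have h2 : ((M : ℝ) + 1) * survival F l M ≤ (M + 1) * ε := by linarith
    linarith [le_of_mul_le_mul_left h2 (by positivity)]
  have hQ1 : Q ≤ n := h.mass_le n M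
  have hQ2 : (1 - ε) * n ≤ Q := by
    have h1 := hm M
    have h2 : ((M : ℝ) + 1) * (n - Q) ≤ (M + 1) * (ε * n) := by nlinarith
    linarith [le_of_mul_le_mul_left h2 (by positivity)]
  have hQP : |Q - P * ζ| ≤ ε * n := by
    rw [hQ, hP, Finset.sum_mul, ← Finset.sum_sub_distrib]
    refine (Finset.abs_sum_le_sum_abs _ _).trans ((Finset.sum_le_sum fun k hk =>
      hζ k (Finset.mem_range.1 hk)).trans (le_of_eq ?_))
    rw [Finset.sum_const, Finset.card_range, nsmul_eq_mul]
    field_simp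
  obtain ⟨hQP1, hQP2⟩ := abs_le.1 hQP
  have hζ0 : 0 ≤ ζ := by
    by_contra hneg
    have : P * ζ ≤ 0 := mul_nonpos_of_nonneg_of_nonpos (by linarith) (by linarith)
    nlinarith
  have hζ3 : ζ ≤ 2 * n := by
    have h1 : (1 - ε) * ζ ≤ P * ζ := mul_le_mul_of_nonneg_right hP2 hζ0
    nlinarith
  have hζn : |n - ζ| ≤ 4 * (ε * n) := by
    have h1 : (1 - ε) * ζ ≤ P * ζ := mul_le_mul_of_nonneg_right hP2 hζ0
    have h2 : P * ζ ≤ 1 * ζ := mul_le_mul_of_nonneg_right hP1 hζ0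
    have h3 : ε * ζ ≤ ε * (2 * n) := mul_le_mul_of_nonneg_left hζ3 hε.le
    rw [abs_le]; constructor <;> linarith
  have hpk : limitProb F l k ≤ 1 :=
    (Finset.single_le_sum (f := limitProb F l) (fun i _ => (limitProb_pos hl hF i).le)
      (Finset.mem_range.2 hkM)).trans hP1
  have hk := hζ k hkM
  have hεM : ε / M * n ≤ ε * n := by
    have h1 : (1 : ℝ) ≤ M := by exact_mod_cast (Nat.zero_le k).trans_lt hkM
    have : ε / M ≤ ε := div_le_self hε.le h1
    gcongr
  rw [Real.dist_eq, show N n k / n - limitProb F l k = (N n k - limitProb F l k * n) / n by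
    field_simp, abs_div, Nat.abs_cast, div_lt_iff₀ hn]
  have h5 : N n k - limitProb F l k * n =
      (N n k - limitProb F l k * ζ) + -(limitProb F l k * (n - ζ)) := by ring
  rw [h5]
  refine (abs_add_le _ _).trans_lt ?_
  rw [abs_neg, abs_mul, abs_of_pos (limitProb_pos hl hF k)]
  have h6 : limitProb F l k * |↑n - ζ| ≤ 1 * (4 * (ε * n)) :=
    mul_le_mul hpk hζn (abs_nonneg _) zero_le_one
  nlinarith

/-- If the total attachment rate is asymptotically linear, the degree proportions converge. -/
theorem tendsto_of_total (h : DegreeFlow F N X S c B) {l : ℝ} (hl : 0 < l)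
    (hS : Tendsto (fun n : ℕ => S n / n) atTop (𝓝 l)) (k : ℕ) :
    Tendsto (fun n : ℕ => N n k / n) atTop (𝓝 (limitProb F l k)) := by
  have hF : ∀ k, 0 < F k := fun k => h.rate_lower_pos.trans_le (h.le_rate k)
  have hc := h.rate_lower_pos
  have hinv : Tendsto (fun n : ℕ => n / S n) atTop (𝓝 (1 / l)) := by
    have := hS.inv₀ hl.ne'
    rw [← one_div] at this
    exact this.congr fun n => by rw [inv_div]
  -- one coordinate, given the convergence of the inflow
  have key : ∀ (k : ℕ) (u : ℕ → ℝ) (q : ℝ), Tendsto u atTop (𝓝 ((1 + F k / l) * q)) →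
      (∀ᶠ n in atTop, S n * (X (n + 1) k - X n k) = S n * u n - F k * N n k) →
      Tendsto (fun n : ℕ => N n k / n) atTop (𝓝 q) := by
    intro k u q hu hstep
    -- With `S n` close to `l n`, the line `q n` balances an inflow `u` exactly when `u = (1 + F k /
    -- l) q`; the residual `e` therefore tends to zero.
    have hrec : Tendsto (fun n : ℕ => (X n k - q * n) / n) atTop (𝓝 0) := by
      refine tendsto_div_of_recursion (Y := fun n : ℕ => X n k - q * n)
        (a := fun n => F k * (n / S n)) (A := F k / c)
        (e := fun n => u n - q - F k * (n / S n) * q +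
          F k * (n / S n) * ((X n k - N n k) / n)) ?_ ?_ ?_
      · filter_upwards [h.total_bounds, eventually_gt_atTop 0] with n hn hn0
        have hnR : (0 : ℝ) < n := by exact_mod_cast hn0
        have hSn : 0 < S n := lt_of_lt_of_le (by positivity) hn.1
        have := hF k
        refine ⟨by positivity, ?_⟩
        rw [← mul_div_assoc, div_le_div_iff₀ hSn hc]
        nlinarith [hn.1]
      · have h1 := ((hu.sub_const q).sub ((hinv.const_mul (F k)).mul_const q)).add
          ((hinv.const_mul (F k)).mul (h.close k))
        have h2 : (1 + F k / l) * q - q - F k * (1 / l) * q + F k * (1 / l) * 0 = 0 := by ring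
        rwa [h2] at h1
      · filter_upwards [hstep, h.total_bounds, eventually_gt_atTop 0] with n hn hb hn0
        have hnR : (0 : ℝ) < n := by exact_mod_cast hn0
        have hSn : 0 < S n := lt_of_lt_of_le (by positivity) hb.1
        have h1 : X (n + 1) k = X n k + (u n - F k * N n k / S n) := by
          field_simp; linarith
        rw [h1]
        push_cast
        field_simp
        ring
    have h1 := (hrec.sub (h.close k)).add_const q
    rw [sub_zero, zero_add] at h1
    refine h1.congr' ?_
    filter_upwards [eventually_gt_atTop 0] with n hn0
    have hnR : (n : ℝ) ≠ 0 := by exact_mod_cast hn0.ne'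
    field_simp; ring
  induction k with
  | zero =>
    refine key 0 (fun _ => 1) _ ?_ ?_
    · have h1 := add_mul_limitProb hl hF 0
      rw [survival_zero] at h1
      have h2 : (1 + F 0 / l) * limitProb F l 0 = 1 := by field_simp; linarith
      rw [h2]
      exact tendsto_const_nhds
    · filter_upwards [h.step_zero] with n hn
      rw [hn]; ring
  | succ k ih =>
    refine key (k + 1) (fun n => F k * (N n k / n) * (n / S n)) _ ?_ ?_
    · have h1 := add_mul_limitProb hl hF (k + 1)
      have h2 := mul_limitProb hl hF k
      have h3 : (1 + F (k + 1) / l) * limitProb F l (k + 1) =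
          F k * limitProb F l k * (1 / l) := by field_simp; linarith
      rw [h3]
      exact (ih.const_mul _).mul hinv
    · filter_upwards [h.step_succ, h.total_bounds, eventually_gt_atTop 0] with n hn hb hn0
      have hnR : (0 : ℝ) < n := by exact_mod_cast hn0
      have hSn : 0 < S n := lt_of_lt_of_le (by positivity) hb.1
      rw [hn k]
      field_simp

end DegreeFlow

/-! ### Growing trees -/

/-- Every vertex other than the root is attached to an earlier vertex. -/
def IsRecursive (p : ℕ → ℕ) : Prop := ∀ j, 2 ≤ j → 1 ≤ p j ∧ p j < j

/-- The sum of the attachment weights of the vertices of `T(n)`. -/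
def totalRate (f : ℕ → ℝ) (p : ℕ → ℕ) (n : ℕ) : ℝ := ∑ i ∈ Finset.Icc 1 n, f (deg p i n)

lemma childCount_succ (p : ℕ → ℕ) (i : ℕ) {n : ℕ} (hn : 1 ≤ n) :
    childCount p i (n + 1) = childCount p i n + if p (n + 1) = i then 1 else 0 := by
  have h : Finset.Icc 2 (n + 1) = insert (n + 1) (Finset.Icc 2 n) := by
    ext j; simp only [Finset.mem_Icc, Finset.mem_insert]; omega
  rw [childCount, childCount, h, Finset.filter_insert]
  split_ifs with hp
  · rw [Finset.card_insert_of_notMem (by simp)]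
  · simp

lemma childCount_mono (p : ℕ → ℕ) (i : ℕ) {m n : ℕ} (h : m ≤ n) :
    childCount p i m ≤ childCount p i n :=
  Finset.card_le_card (Finset.filter_subset_filter _ (Finset.Icc_subset_Icc le_rfl h))

lemma one_le_deg (p : ℕ → ℕ) (i n : ℕ) : 1 ≤ deg p i n := by
  rw [deg]; split_ifs
  · exact le_max_left _ _
  · omega

lemma deg_mono (p : ℕ → ℕ) (i : ℕ) {m n : ℕ} (h : m ≤ n) : deg p i m ≤ deg p i n := by
  rw [deg, deg]; split_ifs
  · exact max_le_max le_rfl (childCount_mono p 1 h)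
  · exact Nat.add_le_add_right (childCount_mono p i h) 1

lemma deg_congr {p q : ℕ → ℕ} {n : ℕ} (h : ∀ j ∈ Finset.Icc 2 n, p j = q j) (i : ℕ) {m : ℕ}
    (hm : m ≤ n) : deg p i m = deg q i m := by
  have h1 : ∀ i, childCount p i m = childCount q i m := fun i => by
    rw [childCount, childCount]
    congr 1
    refine Finset.filter_congr fun j hj => ?_
    rw [h j (Finset.Icc_subset_Icc le_rfl hm hj)]
  rw [deg, deg, h1, h1]

namespace IsRecursive

variable {p : ℕ → ℕ}

lemma parent_two (hp : IsRecursive p) : p 2 = 1 := by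
  have := hp 2 le_rfl; omega

lemma childCount_eq_zero (hp : IsRecursive p) {i n : ℕ} (h : n ≤ i) : childCount p i n = 0 := by
  rw [childCount, Finset.card_eq_zero, Finset.filter_eq_empty_iff]
  intro j hj
  rw [Finset.mem_Icc] at hj
  have := hp j hj.1
  omega

lemma one_le_childCount_root (hp : IsRecursive p) {n : ℕ} (hn : 2 ≤ n) : 1 ≤ childCount p 1 n :=
  Finset.card_pos.2 ⟨2, by simp [hp.parent_two, hn]⟩

lemma deg_succ (hp : IsRecursive p) (i : ℕ) {n : ℕ} (hn : 2 ≤ n) :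
    deg p i (n + 1) = deg p i n + if p (n + 1) = i then 1 else 0 := by
  rw [deg, deg]
  by_cases hi : i = 1
  · subst hi
    have h1 := hp.one_le_childCount_root hn
    have h2 := hp.one_le_childCount_root (n := n + 1) (by omega)
    rw [if_pos rfl, if_pos rfl, max_eq_right h1, max_eq_right h2, childCount_succ p 1 (by omega)]
  · rw [if_neg hi, if_neg hi, childCount_succ p i (by omega)]
    ring

lemma deg_self (hp : IsRecursive p) (n : ℕ) : deg p n n = 1 := by
  rw [deg]
  split_ifs with h
  · subst h; rw [hp.childCount_eq_zero le_rfl]; rfl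
  · rw [hp.childCount_eq_zero le_rfl]

/-- Each new edge adds one to the degree of the parent and one for the newcomer. The `2` is on the
left to avoid natural subtraction. -/
lemma sum_deg (hp : IsRecursive p) {n : ℕ} (hn : 2 ≤ n) :
    ∑ i ∈ Finset.Icc 1 n, deg p i n + 2 = 2 * n := by
  induction n, hn using Nat.le_induction with
  | base =>
    have h1 : deg p 1 2 = 1 := by
      rw [deg, if_pos rfl, childCount_succ p 1 le_rfl, hp.childCount_eq_zero le_rfl, hp.parent_two]
      rfl
    rw [Finset.sum_Icc_succ_top (by norm_num), Finset.Icc_self, Finset.sum_singleton, h1,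
      hp.deg_self]
  | succ n hn ih =>
    rw [Finset.sum_Icc_succ_top (by omega), hp.deg_self,
      Finset.sum_congr rfl fun i _ => hp.deg_succ i hn, Finset.sum_add_distrib,
      Finset.sum_ite_eq, if_pos]
    · omega
    · have := hp (n + 1) (by omega)
      rw [Finset.mem_Icc]; omega

lemma sum_deg_real (hp : IsRecursive p) {n : ℕ} (hn : 2 ≤ n) :
    ∑ i ∈ Finset.Icc 1 n, (deg p i n : ℝ) = 2 * n - 2 := by
  have := hp.sum_deg hn
  rw [eq_sub_iff_add_eq]
  exact_mod_cast this

/-- The growth of the degrees between times `m` and `n`, where vertices born after `m` start at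
`0`. -/
lemma sum_growth (hp : IsRecursive p) {m n : ℕ} (hm : 2 ≤ m) (hmn : m ≤ n) :
    ∑ i ∈ Finset.Icc 1 n, ((deg p i n : ℝ) - if i ≤ m then (deg p i m : ℝ) else 0) =
      2 * ((n : ℝ) - m) := by
  rw [Finset.sum_sub_distrib, hp.sum_deg_real (hm.trans hmn), ← Finset.sum_filter]
  have h : (Finset.Icc 1 n).filter (· ≤ m) = Finset.Icc 1 m := by
    ext i; simp only [Finset.mem_filter, Finset.mem_Icc]; omega
  rw [h, hp.sum_deg_real hm]; ring

lemma degreeCount_succ (hp : IsRecursive p) (k : ℕ) {n : ℕ} (hn : 2 ≤ n) :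
    (degreeCount p k (n + 1) : ℝ) = degreeCount p k n +
      (if deg p (p (n + 1)) n + 1 = k then 1 else 0) - (if deg p (p (n + 1)) n = k then 1 else 0) +
      if k = 1 then 1 else 0 := by
  have hcast : ∀ m, (degreeCount p k m : ℝ) =
      ∑ i ∈ Finset.Icc 1 m, if deg p i m = k then (1 : ℝ) else 0 := fun m => by
    rw [degreeCount, Finset.sum_boole]
  have h1 : ∀ i ∈ Finset.Icc 1 n, (if deg p i (n + 1) = k then (1 : ℝ) else 0) =
      (if deg p i n = k then (1 : ℝ) else 0) + if p (n + 1) = i then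
        ((if deg p i n + 1 = k then (1 : ℝ) else 0) - if deg p i n = k then (1 : ℝ) else 0)
        else 0 := by
    intro i _
    rw [hp.deg_succ i hn]
    by_cases h : p (n + 1) = i
    · simp [h]
    · simp [h]
  rw [hcast, hcast, Finset.sum_Icc_succ_top (by omega), hp.deg_self, Finset.sum_congr rfl h1,
    Finset.sum_add_distrib, Finset.sum_ite_eq, if_pos]
  · simp only [eq_comm (a := (1 : ℕ)) (b := k)]; ring
  · have := hp (n + 1) (by omega)
    rw [Finset.mem_Icc]; omega

end IsRecursive

lemma sum_mul_degreeCount (φ : ℕ → ℝ) (p : ℕ → ℕ) (K n : ℕ) :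
    ∑ k ∈ Finset.range K, φ (k + 1) * (degreeCount p (k + 1) n : ℝ) =
      ∑ i ∈ Finset.Icc 1 n, if deg p i n ≤ K then φ (deg p i n) else 0 := by
  have hcast : ∀ k, (degreeCount p k n : ℝ) =
      ∑ i ∈ Finset.Icc 1 n, if deg p i n = k then (1 : ℝ) else 0 := fun k => by
    rw [degreeCount, Finset.sum_boole]
  simp_rw [hcast, Finset.mul_sum]
  rw [Finset.sum_comm]
  refine Finset.sum_congr rfl fun i _ => ?_
  obtain ⟨d, hd⟩ : ∃ d, deg p i n = d + 1 := ⟨deg p i n - 1, by have := one_le_deg p i n; omega⟩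
  rw [hd]
  simp only [mul_ite, mul_one, mul_zero, Nat.add_right_cancel_iff]
  rw [Finset.sum_ite_eq]
  simp only [Finset.mem_range, Nat.succ_le_iff]

lemma degreeCount_zero (p : ℕ → ℕ) (n : ℕ) : degreeCount p 0 n = 0 := by
  rw [degreeCount, Finset.card_eq_zero, Finset.filter_eq_empty_iff]
  intro i _
  have := one_le_deg p i n
  omega

lemma sum_degreeCount_le (p : ℕ → ℕ) (K n : ℕ) :
    ∑ k ∈ Finset.range K, (degreeCount p (k + 1) n : ℝ) ≤ n := by
  have h := sum_mul_degreeCount (fun _ => 1) p K n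
  simp only [one_mul] at h
  rw [h]
  calc _ ≤ ∑ i ∈ Finset.Icc 1 n, (1 : ℝ) := Finset.sum_le_sum fun i _ => by split_ifs <;> norm_num
    _ = n := by simp

/-- Markov's inequality for the degree, whose sum over the tree is `2 n - 2`. -/
lemma IsRecursive.le_sum_degreeCount {p : ℕ → ℕ} (hp : IsRecursive p) (K : ℕ) {n : ℕ} (hn : 2 ≤ n) :
    ((K : ℝ) + 1) * (n - ∑ k ∈ Finset.range K, (degreeCount p (k + 1) n : ℝ)) ≤ 2 * n := by
  have h := sum_mul_degreeCount (fun _ => 1) p K n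
  simp only [one_mul] at h
  have h1 : (n : ℝ) = ∑ i ∈ Finset.Icc 1 n, (1 : ℝ) := by simp
  have h2 : ((K : ℝ) + 1) * (n - ∑ k ∈ Finset.range K, (degreeCount p (k + 1) n : ℝ)) ≤
      ∑ i ∈ Finset.Icc 1 n, (deg p i n : ℝ) := by
    rw [h, h1, ← Finset.sum_sub_distrib, Finset.mul_sum]
    refine Finset.sum_le_sum fun i _ => ?_
    split_ifs with hi
    · simp
    · have : ((K : ℝ) + 1) ≤ deg p i n := by exact_mod_cast (by omega : K + 1 ≤ deg p i n)
      linarith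
  rw [hp.sum_deg_real hn] at h2
  linarith

lemma IsRecursive.sum_mul_degreeCount_le {p : ℕ → ℕ} (hp : IsRecursive p) (K : ℕ) {n : ℕ}
    (hn : 2 ≤ n) :
    ∑ k ∈ Finset.range K, ((k : ℝ) + 1) * (degreeCount p (k + 1) n : ℝ) ≤ 2 * n := by
  have h := sum_mul_degreeCount (fun k => (k : ℝ)) p K n
  simp only [Nat.cast_add, Nat.cast_one] at h
  have h2 : ∑ k ∈ Finset.range K, ((k : ℝ) + 1) * (degreeCount p (k + 1) n : ℝ) ≤
      ∑ i ∈ Finset.Icc 1 n, (deg p i n : ℝ) := by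
    rw [h]
    exact Finset.sum_le_sum fun i _ => by split_ifs <;> simp
  rw [hp.sum_deg_real hn] at h2
  linarith

lemma IsRecursive.totalRate_le {p : ℕ → ℕ} (hp : IsRecursive p) {f : ℕ → ℝ} {C : ℝ} (hC : 0 ≤ C)
    (hf : ∀ k, 1 ≤ k → f k ≤ C * k) {n : ℕ} (hn : 2 ≤ n) : totalRate f p n ≤ 2 * C * n := by
  have h : totalRate f p n ≤ C * ∑ i ∈ Finset.Icc 1 n, (deg p i n : ℝ) := by
    rw [totalRate, Finset.mul_sum]
    exact Finset.sum_le_sum fun i _ => hf _ (one_le_deg p i n)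
  rw [hp.sum_deg_real hn] at h
  linarith

lemma le_totalRate {f : ℕ → ℝ} {c : ℝ} (hf : ∀ k, 1 ≤ k → c ≤ f k) (p : ℕ → ℕ) (n : ℕ) :
    c * n ≤ totalRate f p n := by
  have h := Finset.card_nsmul_le_sum (Finset.Icc 1 n) (fun i => f (deg p i n)) c
    (fun i _ => hf _ (one_le_deg p i n))
  rw [nsmul_eq_mul, Nat.card_Icc, Nat.add_sub_cancel] at h
  rw [totalRate]; linarith

lemma IsRecursive.abs_totalRate_sub_le {p : ℕ → ℕ} (hp : IsRecursive p) {f : ℕ → ℝ} {ε : ℝ} {K : ℕ}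
    (hf0 : ∀ k, 1 ≤ k → 0 ≤ f k) (hf : ∀ k, K < k → f k ≤ ε * k) (hε : 0 ≤ ε) {n : ℕ} (hn : 2 ≤ n) :
    |totalRate f p n - ∑ k ∈ Finset.range K, f (k + 1) * (degreeCount p (k + 1) n : ℝ)| ≤
      2 * ε * n := by
  rw [sum_mul_degreeCount, totalRate, ← Finset.sum_sub_distrib]
  have h1 : ∀ i, |f (deg p i n) - if deg p i n ≤ K then f (deg p i n) else 0| ≤
      ε * (deg p i n : ℝ) := by
    intro i
    split_ifs with h
    · rw [sub_self, abs_zero]; positivity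
    · rw [sub_zero, abs_of_nonneg (hf0 _ (one_le_deg p i n))]
      exact hf _ (by omega)
  refine (Finset.abs_sum_le_sum_abs _ _).trans ((Finset.sum_le_sum fun i _ => h1 i).trans ?_)
  rw [← Finset.mul_sum, hp.sum_deg_real hn]
  nlinarith

/-! ### Comparison of the delayed and the current attachment probabilities -/

/-- `f` is Lipschitz up to an arbitrarily small linear error. -/
def IsAlmostLipschitz (f : ℕ → ℝ) : Prop :=
  ∀ ε : ℝ, 0 < ε → ∃ K : ℝ, ∀ j k : ℕ, 1 ≤ j → j ≤ k →
    |f k - f j| ≤ K * ((k : ℝ) - j) + ε * k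

/-- The probability that a vertex attaching to the snapshot `T(m)` chooses a vertex which has
degree `k` in `T(n)`. -/
def classProb (f : ℕ → ℝ) (p : ℕ → ℕ) (n k m : ℕ) : ℝ :=
  ∑ i ∈ (Finset.Icc 1 n).filter (fun i => deg p i n = k), attachProb f p m i

lemma attachProb_nonneg {f : ℕ → ℝ} (hf : ∀ k, 1 ≤ k → 0 < f k) (p : ℕ → ℕ) (m i : ℕ) :
    0 ≤ attachProb f p m i := by
  rw [attachProb]
  split_ifs
  · exact div_nonneg (hf _ (one_le_deg p i m)).le
      (Finset.sum_nonneg fun j _ => (hf _ (one_le_deg p j m)).le)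
  · exact le_rfl

lemma sum_attachProb_le {f : ℕ → ℝ} (hf : ∀ k, 1 ≤ k → 0 < f k) (p : ℕ → ℕ) (m : ℕ) (s : Finset ℕ) :
    ∑ i ∈ s, attachProb f p m i ≤ 1 := by
  have h0 : 0 ≤ ∑ j ∈ Finset.Icc 1 m, f (deg p j m) :=
    Finset.sum_nonneg fun j _ => (hf _ (one_le_deg p j m)).le
  calc ∑ i ∈ s, attachProb f p m i ≤ ∑ i ∈ s ∪ Finset.Icc 1 m, attachProb f p m i :=
        Finset.sum_le_sum_of_subset_of_nonneg Finset.subset_union_left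
          fun i _ _ => attachProb_nonneg hf p m i
    _ = ∑ i ∈ Finset.Icc 1 m, attachProb f p m i :=
        (Finset.sum_subset Finset.subset_union_right fun i _ hi => by
          rw [attachProb, if_neg hi]).symm
    _ = ∑ i ∈ Finset.Icc 1 m, f (deg p i m) / ∑ j ∈ Finset.Icc 1 m, f (deg p j m) :=
        Finset.sum_congr rfl fun i hi => by rw [attachProb, if_pos hi]
    _ ≤ 1 := by
        rw [← Finset.sum_div]
        exact div_self_le_one _

/-- Vertices present at time `m` are controlled by `hK`, later ones by `f k ≤ C k` with their degree
counted as growth from `0`. `sum_growth` then adds up the total. -/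
lemma IsRecursive.abs_totalRate_sub_totalRate_le {p : ℕ → ℕ} (hp : IsRecursive p) {f : ℕ → ℝ}
    {C K ε : ℝ} (hf0 : ∀ k, 1 ≤ k → 0 ≤ f k) (hC : ∀ k : ℕ, 1 ≤ k → f k ≤ C * k) (hε : 0 ≤ ε)
    (hK : ∀ j k : ℕ, 1 ≤ j → j ≤ k → |f k - f j| ≤ K * ((k : ℝ) - j) + ε * k)
    {m n : ℕ} (hm : 2 ≤ m) (hmn : m ≤ n) :
    |totalRate f p n - totalRate f p m| ≤ 2 * max K C * ((n : ℝ) - m) + 2 * ε * n := by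
  have h : totalRate f p m = ∑ i ∈ Finset.Icc 1 n, if i ≤ m then f (deg p i m) else 0 := by
    rw [totalRate, ← Finset.sum_filter]
    congr 1
    ext i; simp only [Finset.mem_filter, Finset.mem_Icc]; omega
  rw [h, totalRate, ← Finset.sum_sub_distrib]
  have h1 : ∀ i, |f (deg p i n) - if i ≤ m then f (deg p i m) else 0| ≤
      max K C * ((deg p i n : ℝ) - if i ≤ m then (deg p i m : ℝ) else 0) +
        ε * (deg p i n : ℝ) := by
    intro i
    split_ifs with hi
    · refine (hK _ _ (one_le_deg p i m) (deg_mono p i hmn)).trans ?_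
      have : (deg p i m : ℝ) ≤ deg p i n := by exact_mod_cast deg_mono p i hmn
      linarith [mul_le_mul_of_nonneg_right (le_max_left K C) (sub_nonneg.2 this)]
    · rw [sub_zero, sub_zero, abs_of_nonneg (hf0 _ (one_le_deg p i n))]
      have h2 := hC _ (one_le_deg p i n)
      have h3 : C * (deg p i n : ℝ) ≤ max K C * deg p i n := by gcongr; exact le_max_right _ _
      have : 0 ≤ ε * (deg p i n : ℝ) := by positivity
      linarith
  refine (Finset.abs_sum_le_sum_abs _ _).trans ((Finset.sum_le_sum fun i _ => h1 i).trans ?_)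
  rw [Finset.sum_add_distrib, ← Finset.mul_sum, ← Finset.mul_sum, hp.sum_growth hm hmn,
    hp.sum_deg_real (hm.trans hmn)]
  nlinarith

/-- In the numerator, only vertices that are new or changed degree after time `m` contribute. Each
accounts for at least one unit of the growth `2 (n - m)` and costs at most `∑ f j` over `j ≤ k`. The
change of the denominator gives the second term. -/
lemma IsRecursive.abs_classProb_sub_le {p : ℕ → ℕ} (hp : IsRecursive p) {f : ℕ → ℝ} {c : ℝ}
    (hc : 0 < c) (hcf : ∀ k, 1 ≤ k → c ≤ f k) (k : ℕ) {m n : ℕ} (hm : 2 ≤ m) (hmn : m ≤ n) :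
    |classProb f p n k m - f k * degreeCount p k n / totalRate f p n| ≤
      (2 * (∑ j ∈ Finset.Icc 1 k, f j) * ((n : ℝ) - m) +
        |totalRate f p n - totalRate f p m|) / (c * m) := by
  have hf0 : ∀ k, 1 ≤ k → 0 < f k := fun k hk => hc.trans_le (hcf k hk)
  have hmR : (0 : ℝ) < m := by exact_mod_cast (by omega : 0 < m)
  have hnR : (0 : ℝ) < n := by exact_mod_cast (by omega : 0 < n)
  have hSm : c * m ≤ totalRate f p m := le_totalRate hcf p m
  have hSn : c * n ≤ totalRate f p n := le_totalRate hcf p n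
  have hSm0 : 0 < totalRate f p m := lt_of_lt_of_le (by positivity) hSm
  have hSn0 : 0 < totalRate f p n := lt_of_lt_of_le (by positivity) hSn
  set Φ := ∑ j ∈ Finset.Icc 1 k, f j with hΦ
  have hΦle : ∀ j, 1 ≤ j → j ≤ k → f j ≤ Φ := fun j h1 h2 =>
    Finset.single_le_sum (f := f) (fun i hi => (hf0 i (Finset.mem_Icc.1 hi).1).le)
      (Finset.mem_Icc.2 ⟨h1, h2⟩)
  have hΦ0 : 0 ≤ Φ := Finset.sum_nonneg fun i hi => (hf0 i (Finset.mem_Icc.1 hi).1).le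
  set num := ∑ i ∈ Finset.Icc 1 n, if deg p i n = k then (if i ≤ m then f (deg p i m) else 0) else 0
    with hnum
  have h1 : classProb f p n k m = num / totalRate f p m := by
    rw [classProb, Finset.sum_filter, hnum, Finset.sum_div]
    refine Finset.sum_congr rfl fun i hi => ?_
    rw [Finset.mem_Icc] at hi
    split_ifs with h2 h3
    · rw [attachProb, if_pos (Finset.mem_Icc.2 ⟨hi.1, h3⟩), totalRate]
    · rw [attachProb, if_neg (by rw [Finset.mem_Icc]; omega), zero_div]
    · rw [zero_div]
  set A := f k * (degreeCount p k n : ℝ) with hA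
  have h2 : A = ∑ i ∈ Finset.Icc 1 n, if deg p i n = k then f k else 0 := by
    rw [hA, degreeCount, ← Finset.sum_filter, Finset.sum_const, nsmul_eq_mul, mul_comm]
  have h3 : |num - A| ≤ 2 * Φ * ((n : ℝ) - m) := by
    rw [hnum, h2, ← Finset.sum_sub_distrib]
    have h4 : ∀ i, |(if deg p i n = k then (if i ≤ m then f (deg p i m) else 0) else 0) -
        (if deg p i n = k then f k else 0)| ≤
        Φ * ((deg p i n : ℝ) - if i ≤ m then (deg p i m : ℝ) else 0) := by
      intro i
      have hmono : (deg p i m : ℝ) ≤ deg p i n := by exact_mod_cast deg_mono p i hmn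
      have hone : (1 : ℝ) ≤ deg p i n := by exact_mod_cast one_le_deg p i n
      by_cases hk : deg p i n = k
      · have hfk := hΦle k (by rw [← hk]; exact one_le_deg p i n) le_rfl
        have hfk0 := hf0 k (by rw [← hk]; exact one_le_deg p i n)
        rw [if_pos hk, if_pos hk]
        split_ifs with him
        · have hdle := deg_mono p i hmn
          rcases hdle.eq_or_lt with h | h
          · rw [h, hk, sub_self, abs_zero, sub_self, mul_zero]
          · have h5 : f (deg p i m) ≤ Φ := hΦle _ (one_le_deg p i m) (by omega)
            have h6 := hf0 _ (one_le_deg p i m)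
            have h7 : (1 : ℝ) ≤ (deg p i n : ℝ) - deg p i m := by
              rw [le_sub_iff_add_le]; exact_mod_cast (by omega : 1 + deg p i m ≤ deg p i n)
            have h8 : |f (deg p i m) - f k| ≤ Φ := by rw [abs_le]; constructor <;> linarith
            nlinarith
        · rw [zero_sub, abs_neg, abs_of_pos hfk0, sub_zero]
          nlinarith
      · rw [if_neg hk, if_neg hk, sub_zero, abs_zero]
        refine mul_nonneg hΦ0 ?_
        split_ifs <;> linarith
    refine (Finset.abs_sum_le_sum_abs _ _).trans ((Finset.sum_le_sum fun i _ => h4 i).trans ?_)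
    rw [← Finset.mul_sum, hp.sum_growth hm hmn]
    linarith
  have hA0 : 0 ≤ A := by
    rw [h2]
    refine Finset.sum_nonneg fun i _ => ?_
    split_ifs with hk
    · rw [← hk]; exact (hf0 _ (one_le_deg p i n)).le
    · exact le_rfl
  have hAS : A ≤ totalRate f p n := by
    rw [h2, totalRate]
    refine Finset.sum_le_sum fun i _ => ?_
    split_ifs with hk
    · rw [hk]
    · exact (hf0 _ (one_le_deg p i n)).le
  have h5 : num / totalRate f p m - A / totalRate f p n =
      ((num - A) + A / totalRate f p n * (totalRate f p n - totalRate f p m)) /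
        totalRate f p m := by
    field_simp; ring
  rw [h1, h5, abs_div, abs_of_pos hSm0]
  refine div_le_div₀ ?_ ?_ (by positivity) hSm
  · have : (m : ℝ) ≤ n := by exact_mod_cast hmn
    have : 0 ≤ (n : ℝ) - m := by linarith
    positivity
  · refine (abs_add_le _ _).trans (add_le_add h3 ?_)
    rw [abs_mul, abs_of_nonneg (by positivity : 0 ≤ A / totalRate f p n)]
    refine mul_le_of_le_one_left (abs_nonneg _) ?_
    rw [div_le_one hSn0]; exact hAS

lemma exists_classProb_close {f : ℕ → ℝ} {c C : ℝ} (hc : 0 < c) (hcf : ∀ k, 1 ≤ k → c ≤ f k)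
    (hC : ∀ k : ℕ, 1 ≤ k → f k ≤ C * k) (hlip : IsAlmostLipschitz f) (k : ℕ) {ε : ℝ} (hε : 0 < ε) :
    ∃ δ : ℝ, 0 < δ ∧ ∀ᶠ n : ℕ in atTop, ∀ p, IsRecursive p → ∀ m : ℕ, m ≤ n →
      (1 - δ) * n ≤ m →
      |classProb f p n k m - f k * degreeCount p k n / totalRate f p n| ≤ ε := by
  have hf0 : ∀ k, 1 ≤ k → 0 ≤ f k := fun k hk => hc.le.trans (hcf k hk)
  -- The almost Lipschitz error contributes `ε c n / 4` and the choice of `δ` another `ε c n / 4`;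
  -- together they are at most `ε c m`, as `m ≥ n / 2`.
  obtain ⟨K, hK⟩ := hlip (ε * c / 8) (by positivity)
  set Φ := ∑ j ∈ Finset.Icc 1 k, f j with hΦ
  have hΦ0 : 0 ≤ Φ := Finset.sum_nonneg fun i hi => hf0 i (Finset.mem_Icc.1 hi).1
  have hM0 : 0 ≤ max K C := by
    refine le_trans ?_ (le_max_right K C)
    have h1 := hC 1 le_rfl
    have h2 := hf0 1 le_rfl
    simp only [Nat.cast_one, mul_one] at h1
    linarith
  obtain ⟨δ, hδ⟩ : ∃ δ, δ = min (1 / 2) (ε * c / (8 * (Φ + max K C + 1))) := ⟨_, rfl⟩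
  have hδ0 : 0 < δ := by rw [hδ]; positivity
  have hδ1 : δ ≤ 1 / 2 := by rw [hδ]; exact min_le_left _ _
  have hδ2 : δ * (8 * (Φ + max K C + 1)) ≤ ε * c := by
    rw [← le_div_iff₀ (by positivity), hδ]; exact min_le_right _ _
  refine ⟨δ, hδ0, ?_⟩
  filter_upwards [eventually_ge_atTop 4] with n hn p hp m hmn hm
  have hnR : (4 : ℝ) ≤ n := by exact_mod_cast hn
  have hm2 : (n : ℝ) / 2 ≤ m := by nlinarith
  have hm2' : 2 ≤ m := by
    have : (2 : ℝ) ≤ m := by linarith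
    exact_mod_cast this
  refine (hp.abs_classProb_sub_le hc hcf k hm2' hmn).trans ?_
  have h1 := hp.abs_totalRate_sub_totalRate_le hf0 hC (by positivity) hK hm2' hmn
  have hmR : (0 : ℝ) < m := by linarith
  rw [div_le_iff₀ (by positivity)]
  have h2 : (n : ℝ) - m ≤ δ * n := by linarith
  have h3 : (2 * Φ + 2 * max K C) * ((n : ℝ) - m) ≤ (2 * Φ + 2 * max K C) * (δ * n) := by gcongr
  have h4 : δ * (8 * (Φ + max K C + 1)) * n ≤ ε * c * n := by gcongr
  have h5 : ε * c * ((n : ℝ) / 2) ≤ ε * c * m := by gcongr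
  have h6 : 0 ≤ δ * n := by positivity
  linarith

/-! ### A law of large numbers for bounded orthogonal increments -/

section LargeNumbers

variable {Ω : Type*} [MeasurableSpace Ω] {P : Measure Ω} [IsProbabilityMeasure P]

lemma integrable_of_abs_le {g : Ω → ℝ} (hg : Measurable g) {C : ℝ} (hC : ∀ ω, |g ω| ≤ C) :
    Integrable g P :=
  Integrable.of_bound hg.aestronglyMeasurable C (Eventually.of_forall hC)

lemma abs_sum_range_le {d : ℕ → ℝ} (hd : ∀ n, |d n| ≤ 1) (n : ℕ) :
    |∑ j ∈ Finset.range n, d j| ≤ n :=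
  (Finset.abs_sum_le_sum_abs _ _).trans ((Finset.sum_le_sum fun j _ => hd j).trans (by simp))

lemma integral_sq_sum_le {d : ℕ → Ω → ℝ} (hm : ∀ n, Measurable (d n)) (hd : ∀ n ω, |d n ω| ≤ 1)
    (horth : ∀ n, ∫ ω, (∑ j ∈ Finset.range n, d j ω) * d n ω ∂P = 0) (n : ℕ) :
    ∫ ω, (∑ j ∈ Finset.range n, d j ω) ^ 2 ∂P ≤ n := by
  have hmT : ∀ n, Measurable fun ω => ∑ j ∈ Finset.range n, d j ω := fun n =>
    Finset.measurable_fun_sum _ fun j _ => hm j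
  have hT : ∀ n ω, |∑ j ∈ Finset.range n, d j ω| ≤ n := fun n ω =>
    abs_sum_range_le (fun j => hd j ω) n
  induction n with
  | zero => simp
  | succ n ih =>
    have e : ∀ ω, (∑ j ∈ Finset.range (n + 1), d j ω) ^ 2 = (∑ j ∈ Finset.range n, d j ω) ^ 2 +
        2 * ((∑ j ∈ Finset.range n, d j ω) * d n ω) + d n ω ^ 2 := fun ω => by
      rw [Finset.sum_range_succ]; ring
    have i1 : Integrable (fun ω => (∑ j ∈ Finset.range n, d j ω) ^ 2) P :=
      integrable_of_abs_le ((hmT n).pow_const 2) (C := (n : ℝ) ^ 2) fun ω => by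
        rw [abs_pow]; exact pow_le_pow_left₀ (abs_nonneg _) (hT n ω) 2
    have i2 : Integrable (fun ω => (∑ j ∈ Finset.range n, d j ω) * d n ω) P :=
      integrable_of_abs_le ((hmT n).mul (hm n)) (C := (n : ℝ) * 1) fun ω => by
        rw [abs_mul]; exact mul_le_mul (hT n ω) (hd n ω) (abs_nonneg _) (by positivity)
    have hd2 : ∀ ω, d n ω ^ 2 ≤ 1 := fun ω => by
      rw [← sq_abs]; exact pow_le_one₀ (abs_nonneg _) (hd n ω)
    have i3 : Integrable (fun ω => d n ω ^ 2) P :=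
      integrable_of_abs_le ((hm n).pow_const 2) (C := 1) fun ω => by
        rw [abs_of_nonneg (sq_nonneg _)]; exact hd2 ω
    have i4 : ∫ ω, d n ω ^ 2 ∂P ≤ 1 := by
      calc ∫ ω, d n ω ^ 2 ∂P ≤ ∫ _, (1 : ℝ) ∂P := integral_mono i3 (integrable_const _) hd2
        _ = 1 := by simp
    have i12 : Integrable (fun ω => (∑ j ∈ Finset.range n, d j ω) ^ 2 +
        2 * ((∑ j ∈ Finset.range n, d j ω) * d n ω)) P := i1.add (i2.const_mul 2)
    simp_rw [e]
    rw [integral_add i12 i3, integral_add i1 (i2.const_mul 2),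
      integral_const_mul, horth n]
    push_cast
    linarith

/-- Orthogonality bounds the second moment of the `n`-th partial sum by `n`. Along the squares the
normalized second moments are summable, so the averages tend to zero almost surely there;
monotonicity fills the gaps. -/
lemma ae_tendsto_sum_div_of_orthogonal {d : ℕ → Ω → ℝ} (hm : ∀ n, Measurable (d n))
    (hd : ∀ n ω, |d n ω| ≤ 1)
    (horth : ∀ n, ∫ ω, (∑ j ∈ Finset.range n, d j ω) * d n ω ∂P = 0) :
    ∀ᵐ ω ∂P, Tendsto (fun n : ℕ => (∑ j ∈ Finset.range n, d j ω) / n) atTop (𝓝 0) := by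
  have hmT : ∀ n, Measurable fun ω => ∑ j ∈ Finset.range n, d j ω := fun n =>
    Finset.measurable_fun_sum _ fun j _ => hm j
  have hT : ∀ n ω, |∑ j ∈ Finset.range n, d j ω| ≤ n := fun n ω =>
    abs_sum_range_le (fun j => hd j ω) n
  let c : ℕ → ℕ := fun n => (n + 1) ^ 2
  have hc0 : ∀ n, (0 : ℝ) < c n := fun n => by positivity
  let q : ℕ → Ω → ℝ := fun n ω => ((∑ j ∈ Finset.range (c n), d j ω) / c n) ^ 2
  have hqm : ∀ n, Measurable (q n) := fun n => ((hmT (c n)).div_const _).pow_const 2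
  have hq0 : ∀ n ω, 0 ≤ q n ω := fun n ω => sq_nonneg _
  have hqint : ∀ n, ∫⁻ ω, ENNReal.ofReal (q n ω) ∂P ≤ ENNReal.ofReal (1 / ((n : ℝ) + 1) ^ 2) := by
    intro n
    have hi : Integrable (q n) P := integrable_of_abs_le (hqm n) (C := 1) fun ω => by
      rw [abs_of_nonneg (hq0 n ω)]
      change ((∑ j ∈ Finset.range (c n), d j ω) / c n) ^ 2 ≤ 1
      rw [← sq_abs, abs_div, Nat.abs_cast]
      exact pow_le_one₀ (by positivity) ((div_le_one (hc0 n)).2 (hT _ ω))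
    rw [← ofReal_integral_eq_lintegral_ofReal hi (Eventually.of_forall (hq0 n))]
    refine ENNReal.ofReal_le_ofReal ?_
    have h1 := integral_sq_sum_le (P := P) hm hd horth (c n)
    have h2 : ∫ ω, q n ω ∂P = (∫ ω, (∑ j ∈ Finset.range (c n), d j ω) ^ 2 ∂P) / (c n : ℝ) ^ 2 := by
      rw [← integral_div]
      exact integral_congr_ae (Eventually.of_forall fun ω => by simp only [q, div_pow])
    have h3 : ((n : ℝ) + 1) ^ 2 = c n := by simp [c]
    rw [h2, h3, div_le_div_iff₀ (by have := hc0 n; positivity) (hc0 n)]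
    nlinarith [hc0 n]
  have hsum : ∑' n, ∫⁻ ω, ENNReal.ofReal (q n ω) ∂P ≠ ⊤ := by
    have h1 : Summable fun n : ℕ => 1 / ((n : ℝ) + 1) ^ 2 := by
      have := (summable_nat_add_iff 1).2 (Real.summable_one_div_nat_pow.2 (one_lt_two))
      exact this.congr fun n => by push_cast; rfl
    refine ne_top_of_le_ne_top ?_ (ENNReal.tsum_le_tsum hqint)
    exact h1.tsum_ofReal_ne_top
  rw [← lintegral_tsum fun n => (hqm n).ennreal_ofReal.aemeasurable] at hsum
  filter_upwards [ae_lt_top' (AEMeasurable.tsum fun n =>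
    (hqm n).ennreal_ofReal.aemeasurable) hsum] with ω hω
  have hq : Tendsto (fun n => q n ω) atTop (𝓝 0) := by
    have h1 := ENNReal.tendsto_atTop_zero_of_tsum_ne_top hω.ne
    have h2 := (ENNReal.tendsto_toReal ENNReal.zero_ne_top).comp h1
    refine h2.congr fun n => ?_
    simp only [Function.comp_apply]
    exact ENNReal.toReal_ofReal (hq0 n ω)
  have hsub : Tendsto (fun n => (∑ j ∈ Finset.range (c n), d j ω) / (c n : ℝ)) atTop (𝓝 0) := by
    have h1 := (Real.continuous_sqrt.tendsto 0).comp hq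
    rw [Real.sqrt_zero] at h1
    rw [tendsto_zero_iff_abs_tendsto_zero]
    exact h1.congr fun n => Real.sqrt_sq_eq_abs _
  -- As `d ≥ -1`, adding `n` makes the partial sums monotone and shifts the limit to `1`; ratios of
  -- consecutive squares tend to `1`.
  have hmain := tendsto_div_of_monotone_of_exists_subseq_tendsto_div
    (fun n => ∑ j ∈ Finset.range n, d j ω + n) 1
    (monotone_nat_of_le_succ fun n => by
      rw [Finset.sum_range_succ]
      push_cast
      linarith [(abs_le.1 (hd n ω)).1])
    (fun a ha => by
      refine ⟨c, ?_, ?_, ?_⟩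
      · obtain ⟨m, hm⟩ := exists_nat_gt (4 / (a - 1))
        filter_upwards [eventually_ge_atTop m] with n hn
        rw [div_lt_iff₀ (by linarith)] at hm
        have hnm : (m : ℝ) ≤ n := by exact_mod_cast hn
        have h2 : (4 : ℝ) ≤ (n + 1) * (a - 1) := by nlinarith
        simp only [c]
        push_cast
        nlinarith
      · exact tendsto_atTop_mono (fun n => by simp only [c, id]; nlinarith) tendsto_id
      · have := hsub.add_const 1
        rw [zero_add] at this
        refine this.congr fun n => ?_
        have := (hc0 n).ne'
        field_simp)
  have h2 := hmain.sub_const 1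
  rw [sub_self] at h2
  refine h2.congr' ?_
  filter_upwards [eventually_gt_atTop 0] with n hn
  have : (n : ℝ) ≠ 0 := by exact_mod_cast hn.ne'
  field_simp; ring

end LargeNumbers

/-! ### The effect of the delay -/

lemma measurable_snapshot (β : ℝ) (n : ℕ) : Measurable (snapshot β n) := by
  unfold snapshot floorPlus
  exact (Nat.measurable_floor.comp (measurable_const.sub
    (measurable_const.mul measurable_id))).max measurable_const

lemma snapshot_le (β : ℝ) {n : ℕ} (hn : 1 ≤ n) {x : ℝ} (hx : 0 ≤ x) : snapshot β n x ≤ n := by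
  refine max_le ?_ hn
  have h1 : (0 : ℝ) ≤ (n : ℝ) ^ β * x := mul_nonneg (Real.rpow_nonneg (by positivity) _) hx
  calc ⌊(n : ℝ) - (n : ℝ) ^ β * x⌋₊ ≤ ⌊(n : ℝ)⌋₊ := Nat.floor_le_floor (by linarith)
    _ = n := Nat.floor_natCast n

lemma ae_nonneg_delay {μ : Measure ℝ} (hμ : μ (Set.Iio 0) = 0) : ∀ᵐ x ∂μ, 0 ≤ x := by
  rw [ae_iff]
  convert hμ using 2
  ext x; simp

/-- The mean of `classProb` over the delay. -/
def delayedProb (f : ℕ → ℝ) (β : ℝ) (μ : Measure ℝ) (k n : ℕ) (p : ℕ → ℕ) : ℝ :=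
  ∫ x, classProb f p n k (snapshot β n x) ∂μ

/-- Delays are almost surely nonnegative, so the snapshot is contained in `T(n)`. -/
lemma delayedProb_congr {f : ℕ → ℝ} {β : ℝ} {μ : Measure ℝ} (hμ : μ (Set.Iio 0) = 0) {p q : ℕ → ℕ} {n : ℕ} (hn : 1 ≤ n)
    (h : ∀ j ∈ Finset.Icc 2 n, p j = q j) (k : ℕ) :
    delayedProb f β μ k n p = delayedProb f β μ k n q := by
  refine integral_congr_ae ?_
  filter_upwards [ae_nonneg_delay hμ] with x hx
  have hm := snapshot_le β hn hx
  have h1 : (Finset.Icc 1 n).filter (fun i => deg p i n = k) =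
      (Finset.Icc 1 n).filter (fun i => deg q i n = k) :=
    Finset.filter_congr fun i _ => by rw [deg_congr h i le_rfl]
  rw [classProb, classProb, h1]
  refine Finset.sum_congr rfl fun i _ => ?_
  rw [attachProb, attachProb]
  simp_rw [fun i => deg_congr h i hm]

section Delay

variable {f : ℕ → ℝ} {β : ℝ} {μ : Measure ℝ} [IsProbabilityMeasure μ]

lemma classProb_mem (hf : ∀ k, 1 ≤ k → 0 < f k) (p : ℕ → ℕ) (n k m : ℕ) :
    0 ≤ classProb f p n k m ∧ classProb f p n k m ≤ 1 :=
  ⟨Finset.sum_nonneg fun i _ => attachProb_nonneg hf p m i, sum_attachProb_le hf p m _⟩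

lemma measurable_comp_snapshot (β : ℝ) (n : ℕ) (g : ℕ → ℝ) :
    Measurable fun x => g (snapshot β n x) :=
  (measurable_of_countable g).comp (measurable_snapshot β n)

lemma integrable_classProb (hf : ∀ k, 1 ≤ k → 0 < f k) (p : ℕ → ℕ) (n k : ℕ) :
    Integrable (fun x => classProb f p n k (snapshot β n x)) μ :=
  integrable_of_abs_le (measurable_comp_snapshot β n _) (C := 1) fun x => by
    have := classProb_mem hf p n k (snapshot β n x)
    rw [abs_of_nonneg this.1]; exact this.2

lemma delayedProb_mem (hf : ∀ k, 1 ≤ k → 0 < f k) (p : ℕ → ℕ) (n k : ℕ) :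
    0 ≤ delayedProb f β μ k n p ∧ delayedProb f β μ k n p ≤ 1 := by
  refine ⟨integral_nonneg fun x => (classProb_mem hf p n k _).1, ?_⟩
  calc delayedProb f β μ k n p ≤ ∫ _, (1 : ℝ) ∂μ :=
        integral_mono (integrable_classProb hf p n k) (integrable_const _)
          fun x => (classProb_mem hf p n k _).2
    _ = 1 := by simp

lemma tendsto_measureReal_Ioi : Tendsto (fun t : ℝ => μ.real (Set.Ioi t)) atTop (𝓝 0) := by
  have h := (tendsto_cdf_atTop μ).const_sub 1
  rw [sub_self] at h
  refine h.congr fun t => ?_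
  rw [cdf_eq_real, ← probReal_compl_eq_one_sub measurableSet_Iic, Set.compl_Iic]

/-- A loss of more than `δ n` needs a delay above `(δ / 2) n ^ (1 - β)`, which tends to infinity;
the other `δ n / 2` pays for the floor. -/
lemma tendsto_measureReal_snapshot_lt (hβ1 : β < 1) {δ : ℝ} (hδ : 0 < δ) :
    Tendsto (fun n : ℕ => μ.real {x | (snapshot β n x : ℝ) < (1 - δ) * n}) atTop (𝓝 0) := by
  have h1 : Tendsto (fun n : ℕ => δ / 2 * (n : ℝ) ^ (1 - β)) atTop atTop :=
    ((tendsto_rpow_atTop (by linarith)).comp tendsto_natCast_atTop_atTop).const_mul_atTop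
      (by positivity)
  refine squeeze_zero' (Eventually.of_forall fun n => measureReal_nonneg) ?_
    ((tendsto_measureReal_Ioi (μ := μ)).comp h1)
  filter_upwards [tendsto_natCast_atTop_atTop.eventually_ge_atTop (2 / δ),
    eventually_gt_atTop 0] with n hn hn0
  have hnR : (0 : ℝ) < n := by exact_mod_cast hn0
  refine measureReal_mono fun x hx => ?_
  rw [Set.mem_ofPred_eq] at hx
  simp only [Set.mem_Ioi]
  by_contra! hle
  rw [div_le_iff₀ hδ] at hn
  have h2 : (n : ℝ) ^ β * x ≤ δ / 2 * n := by
    calc (n : ℝ) ^ β * x ≤ (n : ℝ) ^ β * (δ / 2 * (n : ℝ) ^ (1 - β)) := by gcongr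
      _ = δ / 2 * ((n : ℝ) ^ β * (n : ℝ) ^ (1 - β)) := by ring
      _ = δ / 2 * n := by rw [← Real.rpow_add hnR]; simp
  have h3 : (n : ℝ) - (n : ℝ) ^ β * x < ⌊(n : ℝ) - (n : ℝ) ^ β * x⌋₊ + 1 := Nat.lt_floor_add_one _
  have h4 : (⌊(n : ℝ) - (n : ℝ) ^ β * x⌋₊ : ℝ) ≤ snapshot β n x := by
    exact_mod_cast le_max_left _ _
  linarith

/-- The delay has a negligible effect on the attachment probabilities, uniformly over all trees. -/
lemma eventually_delayedProb_close (hβ1 : β < 1) (hμ : μ (Set.Iio 0) = 0) {c C : ℝ} (hc : 0 < c)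
    (hcf : ∀ k, 1 ≤ k → c ≤ f k) (hC : ∀ k : ℕ, 1 ≤ k → f k ≤ C * k) (hlip : IsAlmostLipschitz f)
    (k : ℕ) {ε : ℝ} (hε : 0 < ε) :
    ∀ᶠ n : ℕ in atTop, ∀ p, IsRecursive p →
      |delayedProb f β μ k n p - f k * degreeCount p k n / totalRate f p n| ≤ ε := by
  have hf : ∀ k, 1 ≤ k → 0 < f k := fun k hk => hc.trans_le (hcf k hk)
  obtain ⟨δ, hδ, hclose⟩ := exists_classProb_close hc hcf hC hlip k (half_pos hε)
  filter_upwards [hclose, (tendsto_measureReal_snapshot_lt (μ := μ) hβ1 hδ).eventually_lt_const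
    (half_pos hε), eventually_ge_atTop 1] with n hn hbad hn1 p hp
  set r := f k * degreeCount p k n / totalRate f p n with hr
  have hr01 : 0 ≤ r ∧ r ≤ 1 := by
    -- The undelayed probability is the case `m = n`, hence lies in `[0, 1]`.
    have h1 : r = classProb f p n k n := by
      rw [hr, classProb, Finset.sum_congr rfl fun i hi => by
        rw [attachProb, if_pos (Finset.mem_filter.1 hi).1, (Finset.mem_filter.1 hi).2],
        Finset.sum_const, nsmul_eq_mul, degreeCount, totalRate]
      ring
    rw [h1]; exact classProb_mem hf p n k n
  set bad := {x : ℝ | (snapshot β n x : ℝ) < (1 - δ) * n} with hbaddef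
  have hbadm : MeasurableSet bad :=
    measurableSet_lt (measurable_comp_snapshot β n fun m => (m : ℝ)) measurable_const
  have h1 : delayedProb f β μ k n p - r = ∫ x, (classProb f p n k (snapshot β n x) - r) ∂μ := by
    rw [integral_sub (integrable_classProb hf p n k) (integrable_const _)]
    simp [delayedProb]
  rw [h1]
  have h2 : ∫ x, (ε / 2 + bad.indicator (fun _ => (1 : ℝ)) x) ∂μ ≤ ε := by
    rw [integral_add (integrable_const _) ((integrable_const _).indicator hbadm),
      integral_indicator_const _ hbadm]
    simp only [integral_const, probReal_univ, smul_eq_mul, mul_one, one_mul]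
    linarith
  refine le_trans ?_ h2
  have hint : Integrable (fun x => ε / 2 + bad.indicator (fun _ => (1 : ℝ)) x) μ :=
    (integrable_const _).add ((integrable_const _).indicator hbadm)
  rw [← Real.norm_eq_abs]
  refine norm_integral_le_of_norm_le hint ?_
  filter_upwards [ae_nonneg_delay hμ] with x hx
  rw [Real.norm_eq_abs]
  by_cases hxb : x ∈ bad
  · rw [Set.indicator_of_mem hxb]
    have := classProb_mem hf p n k (snapshot β n x)
    rw [abs_le]; constructor <;> linarith
  · rw [Set.indicator_of_notMem hxb, add_zero]
    refine hn p hp _ (snapshot_le β hn1 hx) ?_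
    rw [hbaddef, Set.mem_ofPred_eq, not_lt] at hxb
    exact hxb

end Delay

/-! ### Almost sure behaviour of the attachments -/

/-- The parents in `T(n)`, and `0` elsewhere. -/
def truncate (n : ℕ) (p : ℕ → ℕ) (j : ℕ) : ℕ := if j ∈ Finset.Icc 2 n then p j else 0

lemma truncate_apply {n : ℕ} (p : ℕ → ℕ) {j : ℕ} (hj : j ∈ Finset.Icc 2 n) :
    truncate n p j = p j := if_pos hj

lemma truncate_truncate {m n : ℕ} (h : m ≤ n) (p : ℕ → ℕ) :
    truncate m (truncate n p) = truncate m p := by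
  funext j
  unfold truncate
  by_cases hj : j ∈ Finset.Icc 2 m
  · rw [if_pos hj, if_pos hj, if_pos (Finset.Icc_subset_Icc le_rfl h hj)]
  · rw [if_neg hj, if_neg hj]

/-- The vertices of `T(n)` of degree `k`. -/
def degreeClass (k n : ℕ) (p : ℕ → ℕ) : Finset ℕ := (Finset.Icc 1 n).filter (fun i => deg p i n = k)

/-- The indicator that vertex `n + 1` attaches to a vertex of degree `k`, centered by its
conditional mean. -/
def increment (f : ℕ → ℝ) (β : ℝ) (μ : Measure ℝ) (k n : ℕ) (p : ℕ → ℕ) : ℝ :=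
  if 2 ≤ n then (if p (n + 1) ∈ degreeClass k n (truncate n p) then 1 else 0) -
    delayedProb f β μ k n (truncate n p) else 0

lemma increment_truncate (f : ℕ → ℝ) (β : ℝ) (μ : Measure ℝ) (k : ℕ) {m n : ℕ} (h : m < n)
    (p : ℕ → ℕ) : increment f β μ k m (truncate n p) = increment f β μ k m p := by
  by_cases h2 : 2 ≤ m
  · have h3 : truncate n p (m + 1) = p (m + 1) :=
      truncate_apply p (Finset.mem_Icc.2 ⟨by omega, h⟩)
    simp only [increment, if_pos h2, truncate_truncate h.le, h3]
  · simp only [increment, if_neg h2]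

section Network

variable {Ω : Type*} {par : ℕ → Ω → ℕ}

/-- The parents of the vertices of `T(n)`, as an element of a countable type. -/
def history (par : ℕ → Ω → ℕ) (n : ℕ) (ω : Ω) (j : Finset.Icc 2 n) : ℕ := par j ω

/-- Extension by zero of a history. -/
def extendHistory {n : ℕ} (h : Finset.Icc 2 n → ℕ) (j : ℕ) : ℕ :=
  if hj : j ∈ Finset.Icc 2 n then h ⟨j, hj⟩ else 0

lemma extendHistory_history (n : ℕ) (ω : Ω) :
    extendHistory (history par n ω) = truncate n fun j => par j ω := by
  funext j
  unfold extendHistory truncate history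
  split_ifs <;> rfl

lemma history_eq_iff {n : ℕ} (h : Finset.Icc 2 n → ℕ) (ω : Ω) :
    history par n ω = h ↔ ∀ j ∈ Finset.Icc 2 n, par j ω = extendHistory h j := by
  constructor
  · rintro rfl j hj
    rw [extendHistory_history, truncate_apply _ hj]
  · intro H
    funext ⟨j, hj⟩
    rw [history, H j hj, extendHistory, dif_pos hj]

variable [MeasurableSpace Ω] {P : Measure Ω} {β : ℝ} {μ : Measure ℝ} {f : ℕ → ℝ}
  {ξ : ℕ → Ω → ℝ}

lemma measurable_history (h : ∀ j, Measurable (par j)) (n : ℕ) : Measurable (history par n) :=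
  measurable_pi_lambda _ fun j => h j

lemma measurable_truncate_comp (h : ∀ j, Measurable (par j)) (n : ℕ) (G : (ℕ → ℕ) → ℝ) :
    Measurable fun ω => G (truncate n fun j => par j ω) := by
  have : (fun ω => G (truncate n fun j => par j ω)) =
      (fun h : Finset.Icc 2 n → ℕ => G (extendHistory h)) ∘ history par n := by
    funext ω
    rw [Function.comp_apply, extendHistory_history]
  rw [this]
  exact (measurable_of_countable _).comp (measurable_history h n)

lemma IsNetwork.measure_history (hnet : IsNetwork P β μ f par ξ) {n : ℕ} (hn : 2 ≤ n)
    (h : Finset.Icc 2 n → ℕ) (i : ℕ) :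
    P (history par n ⁻¹' {h} ∩ par (n + 1) ⁻¹' {i}) = P (history par n ⁻¹' {h}) *
      ∫⁻ x, ENNReal.ofReal (attachProb f (extendHistory h) (snapshot β n x) i) ∂μ := by
  have := hnet.step n hn (extendHistory h) Set.univ MeasurableSet.univ i
  rw [Measure.restrict_univ] at this
  have h1 : history par n ⁻¹' {h} = {ω | ∀ j ∈ Finset.Icc 2 n, par j ω = extendHistory h j} := by
    ext ω; exact history_eq_iff h ω
  rw [h1, ← this]
  congr 1
  ext ω
  simp

lemma IsNetwork.ae_isRecursive (hnet : IsNetwork P β μ f par ξ) (hμ : μ (Set.Iio 0) = 0) :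
    ∀ᵐ ω ∂P, IsRecursive fun j => par j ω := by
  have key : ∀ n : ℕ, 2 ≤ n → ∀ᵐ ω ∂P, par (n + 1) ω ∈ Finset.Icc 1 n := by
    intro n hn
    have h0 : ∀ (h : Finset.Icc 2 n → ℕ) (i : ℕ), i ∉ Finset.Icc 1 n →
        P (history par n ⁻¹' {h} ∩ par (n + 1) ⁻¹' {i}) = 0 := by
      intro h i hi
      rw [hnet.measure_history hn h i]
      refine mul_eq_zero_of_right _ ?_
      rw [lintegral_eq_zero_iff' (measurable_comp_snapshot β n
        (fun m => attachProb f (extendHistory h) m i)).ennreal_ofReal.aemeasurable]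
      filter_upwards [ae_nonneg_delay hμ] with x hx
      have hm := snapshot_le β (by omega : 1 ≤ n) hx
      rw [attachProb, if_neg fun h' => hi (Finset.Icc_subset_Icc le_rfl hm h')]
      simp
    rw [ae_iff]
    refine measure_mono_null (t := ⋃ h : Finset.Icc 2 n → ℕ, ⋃ i : {i : ℕ // i ∉ Finset.Icc 1 n},
      history par n ⁻¹' {h} ∩ par (n + 1) ⁻¹' {(i : ℕ)}) (fun ω hω => ?_)
      (measure_iUnion_null fun h => measure_iUnion_null fun i => h0 h i i.2)
    exact Set.mem_iUnion.2 ⟨history par n ω, Set.mem_iUnion.2 ⟨⟨par (n + 1) ω, hω⟩, rfl, rfl⟩⟩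
  have hall : ∀ᵐ ω ∂P, ∀ n, 2 ≤ n → par (n + 1) ω ∈ Finset.Icc 1 n :=
    ae_all_iff.2 fun n => by
      by_cases hn : 2 ≤ n
      · filter_upwards [key n hn] with ω hω _ using hω
      · exact Eventually.of_forall fun ω h => absurd h hn
  filter_upwards [hall, hnet.par_two] with ω hω h2 j hj
  rcases hj.eq_or_lt with rfl | hlt
  · simp only [h2]; omega
  · have := hω (j - 1) (by omega)
    rw [Nat.sub_add_cancel (by omega), Finset.mem_Icc] at this
    exact ⟨this.1, by change par j ω < j; omega⟩

variable [IsProbabilityMeasure P] [IsProbabilityMeasure μ]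

lemma IsNetwork.measureReal_history_inter (hnet : IsNetwork P β μ f par ξ)
    (hf : ∀ k, 1 ≤ k → 0 < f k) {n : ℕ} (hn : 2 ≤ n) (h : Finset.Icc 2 n → ℕ) (s : Finset ℕ) :
    P.real (history par n ⁻¹' {h} ∩ par (n + 1) ⁻¹' s) = P.real (history par n ⁻¹' {h}) *
      ∫ x, ∑ i ∈ s, attachProb f (extendHistory h) (snapshot β n x) i ∂μ := by
  have hm : ∀ i, MeasurableSet (history par n ⁻¹' {h} ∩ par (n + 1) ⁻¹' {i}) := fun i =>
    (measurable_history hnet.measurable_par n (measurableSet_singleton h)).inter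
      (hnet.measurable_par _ (measurableSet_singleton i))
  have h1 : history par n ⁻¹' {h} ∩ par (n + 1) ⁻¹' s =
      ⋃ i ∈ s, history par n ⁻¹' {h} ∩ par (n + 1) ⁻¹' {i} := by
    ext ω; simp
  have hint : ∀ i, Integrable
      (fun x => attachProb f (extendHistory h) (snapshot β n x) i) μ := fun i =>
    integrable_of_abs_le (measurable_comp_snapshot β n
      fun m => attachProb f (extendHistory h) m i) (C := 1) fun x => by
        rw [abs_of_nonneg (attachProb_nonneg hf _ _ _)]
        simpa using sum_attachProb_le hf (extendHistory h) (snapshot β n x) {i}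
  rw [h1, measureReal_biUnion_finset (fun i _ j _ hij => ?_) (fun i _ => hm i),
    integral_finsetSum _ fun i _ => hint i, Finset.mul_sum]
  · refine Finset.sum_congr rfl fun i _ => ?_
    rw [measureReal_def, hnet.measure_history hn h i, ENNReal.toReal_mul, ← measureReal_def,
      integral_eq_lintegral_of_nonneg_ae
        (Eventually.of_forall fun x => attachProb_nonneg hf _ _ _) (hint i).aestronglyMeasurable]
  · refine Set.disjoint_left.2 fun ω h1 h2 => hij ?_
    exact h1.2.symm.trans h2.2

/-- The increments are orthogonal to functions of the past. -/
lemma IsNetwork.integral_mul_increment (hnet : IsNetwork P β μ f par ξ)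
    (hf : ∀ k, 1 ≤ k → 0 < f k) (k n : ℕ) (G : (ℕ → ℕ) → ℝ) {C : ℝ} (hG : ∀ p, |G p| ≤ C) :
    ∫ ω, G (truncate n fun j => par j ω) * increment f β μ k n (fun j => par j ω) ∂P = 0 := by
  unfold increment
  by_cases hn : 2 ≤ n
  swap
  · simp [hn]
  simp only [if_pos hn]
  set s : (Finset.Icc 2 n → ℕ) → Set Ω := fun h => history par n ⁻¹' {h} with hs
  have hsm : ∀ h, MeasurableSet (s h) := fun h =>
    measurable_history hnet.measurable_par n (measurableSet_singleton h)
  have hm : Measurable fun ω => G (truncate n fun j => par j ω) *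
      ((if par (n + 1) ω ∈ degreeClass k n (truncate n fun j => par j ω) then 1 else 0) -
        delayedProb f β μ k n (truncate n fun j => par j ω)) := by
    have := measurable_truncate_comp hnet.measurable_par (n + 1) fun p =>
      G (truncate n p) * ((if p (n + 1) ∈ degreeClass k n (truncate n p) then 1 else 0) -
        delayedProb f β μ k n (truncate n p))
    simp only [truncate_truncate (Nat.le_succ n)] at this
    have h2 : ∀ p : ℕ → ℕ, truncate (n + 1) p (n + 1) = p (n + 1) := fun p =>
      truncate_apply p (Finset.mem_Icc.2 ⟨by omega, le_rfl⟩)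
    simpa only [h2] using this
  have hint : Integrable (fun ω => G (truncate n fun j => par j ω) *
      ((if par (n + 1) ω ∈ degreeClass k n (truncate n fun j => par j ω) then 1 else 0) -
        delayedProb f β μ k n (truncate n fun j => par j ω))) P := by
    refine integrable_of_abs_le hm (C := C * 1) fun ω => ?_
    rw [abs_mul]
    refine mul_le_mul (hG _) ?_ (abs_nonneg _) ((abs_nonneg _).trans (hG (fun _ => 0)))
    have := delayedProb_mem (β := β) (μ := μ) hf (truncate n fun j => par j ω) n k
    split_ifs <;> rw [abs_le] <;> constructor <;> linarith
  -- There are countably many histories. On each, `G`, the degree class and its delayed probability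
  -- are constant, and `measureReal_history_inter` gives the probability of hitting the class.
  rw [← setIntegral_univ, ← show ⋃ h, s h = Set.univ from
    Set.eq_univ_of_forall fun ω => Set.mem_iUnion.2 ⟨history par n ω, rfl⟩,
    integral_iUnion hsm (fun h h' hne => Set.disjoint_left.2 fun ω h1 h2 =>
      hne (h1.symm.trans h2)) hint.integrableOn]
  refine (tsum_congr fun h => ?_).trans tsum_zero
  have htr : ∀ ω ∈ s h, (truncate n fun j => par j ω) = extendHistory h := fun ω hω => by
    rw [← extendHistory_history]; exact congrArg _ hω
  set cls := degreeClass k n (extendHistory h) with hcls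
  have hpm : MeasurableSet (par (n + 1) ⁻¹' (cls : Set ℕ)) :=
    hnet.measurable_par _ (Finset.measurableSet cls)
  have h1 : ∫ ω in s h, G (truncate n fun j => par j ω) *
      ((if par (n + 1) ω ∈ degreeClass k n (truncate n fun j => par j ω) then 1 else 0) -
        delayedProb f β μ k n (truncate n fun j => par j ω)) ∂P =
      ∫ ω in s h, G (extendHistory h) * ((par (n + 1) ⁻¹' (cls : Set ℕ)).indicator (fun _ => 1) ω -
        delayedProb f β μ k n (extendHistory h)) ∂P := by
    refine setIntegral_congr_fun (hsm h) fun ω hω => ?_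
    simp only [htr ω hω]
    congr 2
    by_cases hmem : par (n + 1) ω ∈ cls
    · rw [if_pos hmem, Set.indicator_of_mem (by exact hmem)]
    · rw [if_neg hmem, Set.indicator_of_notMem (by exact hmem)]
  rw [h1, integral_const_mul, integral_sub ((integrable_const _).indicator hpm)
    (integrable_const _), integral_indicator_const _ hpm, setIntegral_const,
    measureReal_restrict_apply hpm, Set.inter_comm,
    hnet.measureReal_history_inter hf hn h cls]
  simp only [smul_eq_mul, mul_one]
  change _ * (P.real (s h) * delayedProb f β μ k n (extendHistory h) - _) = 0
  ring

theorem IsNetwork.ae_tendsto_increment (hnet : IsNetwork P β μ f par ξ)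
    (hf : ∀ k, 1 ≤ k → 0 < f k) (k : ℕ) :
    ∀ᵐ ω ∂P, Tendsto (fun n : ℕ => (∑ j ∈ Finset.range n,
      increment f β μ k j (fun j => par j ω)) / n) atTop (𝓝 0) := by
  have hb : ∀ n p, |increment f β μ k n p| ≤ 1 := by
    intro n p
    have := delayedProb_mem (β := β) (μ := μ) hf (truncate n p) n k
    unfold increment
    split_ifs <;> rw [abs_le] <;> constructor <;> linarith
  refine ae_tendsto_sum_div_of_orthogonal (P := P)
    (d := fun n ω => increment f β μ k n (fun j => par j ω)) (fun n => ?_) (fun n ω => hb n _)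
    (fun n => ?_)
  · have := measurable_truncate_comp hnet.measurable_par (n + 1) (increment f β μ k n)
    simpa only [increment_truncate f β μ k (Nat.lt_succ_self n)] using this
  · have := hnet.integral_mul_increment hf k n
      (fun p => ∑ j ∈ Finset.range n, increment f β μ k j p) (C := n)
      (fun p => abs_sum_range_le (fun j => hb j p) n)
    rw [← this]
    refine integral_congr_ae (Eventually.of_forall fun ω => ?_)
    exact congrArg (· * _) (Finset.sum_congr rfl fun j hj =>
      (increment_truncate f β μ k (Finset.mem_range.1 hj) _).symm)

/-- Almost surely, the vertices of each degree are chosen as often as without delay, up to an error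
of smaller order. -/
theorem IsNetwork.ae_attachment (hnet : IsNetwork P β μ f par ξ) (hβ1 : β < 1)
    (hμ : μ (Set.Iio 0) = 0) {c C : ℝ} (hc : 0 < c) (hcf : ∀ k, 1 ≤ k → c ≤ f k)
    (hC : ∀ k : ℕ, 1 ≤ k → f k ≤ C * k) (hlip : IsAlmostLipschitz f) :
    ∀ᵐ ω ∂P, IsRecursive (fun j => par j ω) ∧ ∀ k, Tendsto (fun n : ℕ => (∑ j ∈ Finset.range n,
      ((if deg (fun j => par j ω) (par (j + 1) ω) j = k then (1 : ℝ) else 0) -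
        f k * degreeCount (fun j => par j ω) k j / totalRate f (fun j => par j ω) j)) / n)
      atTop (𝓝 0) := by
  have hf : ∀ k, 1 ≤ k → 0 < f k := fun k hk => hc.trans_le (hcf k hk)
  filter_upwards [hnet.ae_isRecursive hμ, ae_all_iff.2 (hnet.ae_tendsto_increment hf)]
    with ω hrec hinc
  refine ⟨hrec, fun k => ?_⟩
  set p : ℕ → ℕ := fun j => par j ω with hp
  set u : ℕ → ℝ := fun j => (if deg p (p (j + 1)) j = k then (1 : ℝ) else 0) -
    f k * degreeCount p k j / totalRate f p j with hu
  -- The two centerings differ by the effect of the delay, which tends to zero uniformly over trees;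
  -- Cesàro averaging then applies.
  have hlim : Tendsto (fun j => u j - increment f β μ k j p) atTop (𝓝 0) := by
    rw [Metric.tendsto_nhds]
    intro ε hε
    filter_upwards [eventually_delayedProb_close (μ := μ) hβ1 hμ hc hcf hC hlip k (half_pos hε),
      eventually_ge_atTop 2] with n hn hn2
    have h1 : u n - increment f β μ k n p =
        delayedProb f β μ k n p - f k * degreeCount p k n / totalRate f p n := by
      have hcong : ∀ j ∈ Finset.Icc 2 n, truncate n p j = p j := fun j hj => truncate_apply p hj
      have hmem : p (n + 1) ∈ degreeClass k n (truncate n p) ↔ deg p (p (n + 1)) n = k := by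
        have := hrec (n + 1) (by omega)
        rw [degreeClass, Finset.mem_filter, Finset.mem_Icc, deg_congr hcong _ le_rfl]
        constructor
        · exact fun h => h.2
        · exact fun h => ⟨by omega, h⟩
      simp only [hu, increment, if_pos hn2, hmem,
        delayedProb_congr (f := f) (β := β) hμ (by omega : 1 ≤ n) hcong k]
      ring
    rw [Real.dist_eq, sub_zero, h1]
    linarith [hn p hrec]
  have h2 := (hlim.cesaro).add (hinc k)
  rw [add_zero] at h2
  refine h2.congr fun n => ?_
  rw [inv_mul_eq_div, ← add_div, ← Finset.sum_add_distrib]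
  congr 1
  exact Finset.sum_congr rfl fun j _ => by ring

end Network

/-! ### The Malthusian parameter -/

section Malthusian

variable {F : ℕ → ℝ}

lemma survival_le_of_le (hF : ∀ k, 0 < F k) {l l' : ℝ} (hl : 0 < l) (hll : l ≤ l') (j : ℕ) :
    survival F l' j ≤ survival F l j := by
  refine Finset.prod_le_prod (fun i _ => ?_) fun i _ => ?_
  · have := hF i; have : 0 < l' := hl.trans_le hll; positivity
  · have := hF i
    exact div_le_div_of_nonneg_left (hF i).le (by positivity) (by linarith)

lemma survival_succ_lt (hF : ∀ k, 0 < F k) {l l' : ℝ} (hl : 0 < l) (hll : l < l') (j : ℕ) :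
    survival F l' (j + 1) < survival F l (j + 1) := by
  have h0 := hF j
  have hl' := hl.trans hll
  rw [survival_succ, survival_succ]
  refine mul_lt_mul_of_le_of_lt_of_pos_of_nonneg (survival_le_of_le hF hl hll.le j) ?_
    (survival_pos hl' hF j) (by positivity)
  exact div_lt_div_of_pos_left h0 (by positivity) (by linarith)

lemma continuousOn_survival (hF : ∀ k, 0 < F k) (j : ℕ) :
    ContinuousOn (fun l => survival F l j) (Set.Ioi 0) := by
  unfold survival
  refine continuousOn_finsetProd _ fun i _ => ?_
  refine continuousOn_const.div (continuousOn_id.add continuousOn_const) fun l hl => ?_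
  exact (add_pos hl (hF i)).ne'

lemma tendsto_survival_succ_atTop (hF : ∀ k, 0 < F k) (j : ℕ) :
    Tendsto (fun l => survival F l (j + 1)) atTop (𝓝 0) := by
  have h1 : Tendsto (fun l => F 0 / (l + F 0)) atTop (𝓝 0) :=
    tendsto_const_nhds.div_atTop (tendsto_atTop_add_const_right _ _ tendsto_id)
  refine squeeze_zero' ?_ ?_ h1
  · filter_upwards [eventually_gt_atTop 0] with l hl using (survival_pos hl hF _).le
  · filter_upwards [eventually_gt_atTop 0] with l hl
    have := survival_antitone hl hF (by omega : 1 ≤ j + 1)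
    rwa [survival_succ 0, survival_zero, one_mul] at this

/-- The series of survival probabilities takes the value `1` if it takes a value above `1`. -/
lemma exists_hasSum_survival_one (hF : ∀ k, 0 < F k) {l₀ : ℝ} (hl₀ : 0 < l₀)
    (hsum : Summable fun j => survival F l₀ (j + 1))
    (hgt : 1 < ∑' j, survival F l₀ (j + 1)) :
    ∃ l, 0 < l ∧ HasSum (fun j => survival F l (j + 1)) 1 := by
  have hbound : ∀ j, ∀ l ∈ Set.Ici l₀, ‖survival F l (j + 1)‖ ≤ survival F l₀ (j + 1) :=
    fun j l hl => by
      rw [Real.norm_of_nonneg (survival_pos (hl₀.trans_le hl) hF _).le]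
      exact survival_le_of_le hF hl₀ hl _
  have hcont : ContinuousOn (fun l => ∑' j, survival F l (j + 1)) (Set.Ici l₀) :=
    -- The summable series at `l₀` dominates all those with `l ≥ l₀`, giving both continuity here
    -- and the limit zero at infinity.
    continuousOn_tsum (fun j => (continuousOn_survival hF (j + 1)).mono fun l hl =>
      hl₀.trans_le hl) hsum hbound
  have hlim : Tendsto (fun l => ∑' j, survival F l (j + 1)) atTop (𝓝 (∑' _ : ℕ, (0 : ℝ))) :=
    tendsto_tsum_of_dominated_convergence hsum (tendsto_survival_succ_atTop hF)
      ((eventually_ge_atTop l₀).mono fun l hl j => hbound j l hl)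
  rw [tsum_zero] at hlim
  obtain ⟨l₁, hlt, hle⟩ := ((hlim.eventually_lt_const zero_lt_one).and
    (eventually_ge_atTop l₀)).exists
  obtain ⟨l, hl, hl1⟩ := intermediate_value_Icc' hle
    (hcont.mono Set.Icc_subset_Ici_self) ⟨hlt.le, hgt.le⟩
  have hs : Summable fun j => survival F l (j + 1) :=
    Summable.of_norm_bounded hsum fun j => hbound j l hl.1
  exact ⟨l, hl₀.trans_le hl.1, by have := hs.hasSum; simp only at hl1; rwa [hl1] at this⟩

end Malthusian

lemma prod_Icc_eq_survival (f : ℕ → ℝ) (l : ℝ) (k : ℕ) :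
    ∏ i ∈ Finset.Icc 1 k, f i / (l + f i) = survival (fun i => f (i + 1)) l k := by
  induction k with
  | zero => simp [survival]
  | succ k ih => rw [Finset.prod_Icc_succ_top (by omega), ih, survival_succ]

lemma rhoHat_eq_tsum {f : ℕ → ℝ} (hf : ∀ k, 1 ≤ k → 0 < f k) {l : ℝ} (hl : 0 < l) :
    rhoHat f l = ∑' k, ENNReal.ofReal (survival (fun i => f (i + 1)) l (k + 1)) := by
  refine tsum_congr fun k => ?_
  rw [← prod_Icc_eq_survival, ENNReal.ofReal_prod_of_nonneg]
  intro i hi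
  have := hf i (Finset.mem_Icc.1 hi).1
  positivity

lemma rhoHat_eq_one_iff {f : ℕ → ℝ} (hf : ∀ k, 1 ≤ k → 0 < f k) {l : ℝ} (hl : 0 < l) :
    rhoHat f l = 1 ↔ HasSum (fun k => survival (fun i => f (i + 1)) l (k + 1)) 1 := by
  have hF : ∀ k, 0 < f (k + 1) := fun k => hf _ (by omega)
  have h0 : ∀ k, 0 ≤ survival (fun i => f (i + 1)) l (k + 1) := fun k => (survival_pos hl hF _).le
  rw [rhoHat_eq_tsum hf hl]
  constructor
  · intro h
    have hs : Summable fun k => survival (fun i => f (i + 1)) l (k + 1) := by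
      have := ENNReal.summable_toReal (h.trans_ne ENNReal.one_ne_top)
      exact this.congr fun k => ENNReal.toReal_ofReal (h0 k)
    rw [← ENNReal.ofReal_tsum_of_nonneg h0 hs, ENNReal.ofReal_eq_one] at h
    rw [← h]; exact hs.hasSum
  · intro h
    rw [← ENNReal.ofReal_tsum_of_nonneg h0 h.summable, h.tsum_eq, ENNReal.ofReal_one]

/-- Existence and uniqueness of the Malthusian parameter. -/
theorem AttachmentAssumption.exists_malthusian {f : ℕ → ℝ} (hf : AttachmentAssumption f) :
    ∃ lam : ℝ, 0 < lam ∧ (∀ l : ℝ, 0 < l → (rhoHat f l = 1 ↔ l = lam)) ∧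
      HasSum (fun k => survival (fun i => f (i + 1)) lam (k + 1)) 1 := by
  obtain ⟨c, hc, hcf⟩ := hf.inf_pos
  have hf0 : ∀ k, 1 ≤ k → 0 < f k := fun k hk => hc.trans_le (hcf k hk)
  have hF : ∀ k, 0 < f (k + 1) := fun k => hf0 _ (by omega)
  obtain ⟨r, hr, h1r⟩ := hf.one_lt_lim
  obtain ⟨l₀, hl₀1, hl₀⟩ := ((hr.eventually_const_lt h1r).and self_mem_nhdsWithin).exists
  -- A point of finiteness below `l₀` makes `ρ̂` finite at `l₀`, since the survival probabilities
  -- decrease in `l`.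
  obtain ⟨l', ⟨hl'0, hl'⟩, hlt⟩ := exists_lt_of_csInf_lt hf.lambdaLow_lt_top hl₀
  have hl₀0 : 0 < l₀ := hl'0.trans hlt
  have hfin : rhoHat f l₀ ≠ ⊤ := by
    refine ne_top_of_le_ne_top hl'.ne ?_
    rw [rhoHat_eq_tsum hf0 hl₀0, rhoHat_eq_tsum hf0 hl'0]
    exact ENNReal.tsum_le_tsum fun k => ENNReal.ofReal_le_ofReal (survival_le_of_le hF hl'0 hlt.le _)
  have h0 : ∀ k, 0 ≤ survival (fun i => f (i + 1)) l₀ (k + 1) := fun k =>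
    (survival_pos hl₀0 hF _).le
  rw [rhoHat_eq_tsum hf0 hl₀0] at hfin hl₀1
  have hs : Summable fun k => survival (fun i => f (i + 1)) l₀ (k + 1) :=
    (ENNReal.summable_toReal hfin).congr fun k => ENNReal.toReal_ofReal (h0 k)
  rw [← ENNReal.ofReal_tsum_of_nonneg h0 hs, ENNReal.one_lt_ofReal] at hl₀1
  obtain ⟨lam, hlam, hsum⟩ := exists_hasSum_survival_one hF hl₀0 hs hl₀1
  refine ⟨lam, hlam, fun l hl => ?_, hsum⟩
  rw [rhoHat_eq_one_iff hf0 hl]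
  refine ⟨fun h => ?_, fun h => h ▸ hsum⟩
  rcases lt_trichotomy l lam with hlt | heq | hgt
  · exact absurd (hasSum_lt (fun k => (survival_succ_lt hF hl hlt k).le)
      (survival_succ_lt hF hl hlt 0) hsum h) (lt_irrefl _)
  · exact heq
  · exact absurd (hasSum_lt (fun k => (survival_succ_lt hF hlam hgt k).le)
      (survival_succ_lt hF hlam hgt 0) h hsum) (lt_irrefl _)

/-! ### The limit degree distribution -/

lemma integral_exp_indicator {l : ℝ} (hl : 0 < l) {s : ℝ} (hs : 0 ≤ s) :
    ∫ t in Set.Ioi (0 : ℝ), l * Real.exp (-l * t) * (Set.Ici s).indicator (fun _ => 1) t =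
      Real.exp (-l * s) := by
  have h1 : ∀ t, l * Real.exp (-l * t) * (Set.Ici s).indicator (fun _ => (1 : ℝ)) t =
      (Set.Ici s).indicator (fun t => l * Real.exp (-l * t)) t := fun t => by
    by_cases ht : t ∈ Set.Ici s
    · rw [Set.indicator_of_mem ht, Set.indicator_of_mem ht, mul_one]
    · rw [Set.indicator_of_notMem ht, Set.indicator_of_notMem ht, mul_zero]
  simp_rw [h1]
  have h2 : (Set.Ioi (0 : ℝ) ∩ Set.Ici s : Set ℝ) =ᵐ[volume] Set.Ioi s := by
    have : (Set.Ioi (0 : ℝ) ∩ Set.Ici s : Set ℝ) =ᵐ[volume] (Set.Ioi 0 ∩ Set.Ioi s : Set ℝ) :=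
      (ae_eq_refl _).inter Ioi_ae_eq_Ici.symm
    rwa [Set.Ioi_inter_Ioi, sup_eq_right.2 hs] at this
  rw [setIntegral_indicator measurableSet_Ici, setIntegral_congr_set h2, integral_const_mul,
    integral_exp_mul_Ioi (by linarith)]
  field_simp

/-- The Laplace transform of a nonnegative random variable from its distribution function. -/
lemma integral_exp_mul_measureReal {Ω : Type*} [MeasurableSpace Ω] {W : Measure Ω}
    [IsProbabilityMeasure W] {X : Ω → ℝ} (hX : Measurable X) (hX0 : ∀ᵐ ω ∂W, 0 ≤ X ω) {l : ℝ}
    (hl : 0 < l) :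
    IntegrableOn (fun t => l * Real.exp (-l * t) * W.real {ω | X ω ≤ t}) (Set.Ioi 0) ∧
    ∫ t in Set.Ioi (0 : ℝ), l * Real.exp (-l * t) * W.real {ω | X ω ≤ t} =
      ∫ ω, Real.exp (-l * X ω) ∂W := by
  have hexp : Integrable (fun t => l * Real.exp (-l * t)) (volume.restrict (Set.Ioi 0)) :=
    (integrableOn_exp_mul_Ioi (by linarith) 0).const_mul l
  have hset : MeasurableSet {z : ℝ × Ω | X z.2 ≤ z.1} :=
    measurableSet_le (hX.comp measurable_snd) measurable_fst
  have hint : Integrable (Function.uncurry fun (t : ℝ) (ω : Ω) =>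
      l * Real.exp (-l * t) * (Set.Ici (X ω)).indicator (fun _ => (1 : ℝ)) t)
      ((volume.restrict (Set.Ioi 0)).prod W) := by
    have h1 := (hexp.comp_fst W).indicator hset
    refine h1.congr (Eventually.of_forall fun z => ?_)
    by_cases hz : X z.2 ≤ z.1
    · rw [Set.indicator_of_mem (by exact hz), Function.uncurry,
        Set.indicator_of_mem (by exact hz), mul_one]
    · rw [Set.indicator_of_notMem (by exact hz), Function.uncurry,
        Set.indicator_of_notMem (by exact hz), mul_zero]
  have hin : ∀ t, ∫ ω, l * Real.exp (-l * t) * (Set.Ici (X ω)).indicator (fun _ => (1 : ℝ)) t ∂W =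
      l * Real.exp (-l * t) * W.real {ω | X ω ≤ t} := by
    intro t
    rw [integral_const_mul]
    congr 1
    have : ∀ ω, (Set.Ici (X ω)).indicator (fun _ => (1 : ℝ)) t =
        {ω | X ω ≤ t}.indicator (fun _ => (1 : ℝ)) ω := fun ω => by
      by_cases h : X ω ≤ t
      · rw [Set.indicator_of_mem (by exact h), Set.indicator_of_mem (by exact h)]
      · rw [Set.indicator_of_notMem (by exact h), Set.indicator_of_notMem (by exact h)]
    simp_rw [this]
    rw [integral_indicator_const _ (measurableSet_le hX measurable_const), smul_eq_mul, mul_one]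
  constructor
  · exact hint.integral_prod_left.congr (Eventually.of_forall hin)
  · simp_rw [← hin]
    rw [integral_integral_swap hint]
    refine integral_congr_ae ?_
    filter_upwards [hX0] with ω hω using integral_exp_indicator hl hω

lemma expMeasure_Iic_zero {r : ℝ} (hr : 0 < r) : expMeasure r (Set.Iic 0) = 0 := by
  have := isProbabilityMeasure_expMeasure hr
  rw [← ofReal_cdf, cdf_expMeasure_eq hr]
  simp

lemma integral_exp_expMeasure {r l : ℝ} (hr : 0 < r) (hl : 0 < l) :
    ∫ x, Real.exp (-l * x) ∂expMeasure r = r / (l + r) := by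
  have := isProbabilityMeasure_expMeasure hr
  have h0 : ∀ᵐ x ∂expMeasure r, 0 ≤ x := by
    rw [ae_iff]
    exact measure_mono_null (fun x hx => (not_le.1 hx).le) (expMeasure_Iic_zero hr)
  rw [← (integral_exp_mul_measureReal (X := fun x => x) measurable_id h0 hl).2]
  have h1 : ∀ t ∈ Set.Ioi (0 : ℝ), l * Real.exp (-l * t) * (expMeasure r).real {x | x ≤ t} =
      l * Real.exp (-l * t) - l * Real.exp (-(l + r) * t) := by
    intro t ht
    have : (expMeasure r).real {x | x ≤ t} = 1 - Real.exp (-(r * t)) := by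
      have h2 := cdf_expMeasure_eq hr t
      rw [if_pos (le_of_lt ht), cdf_eq_real] at h2
      exact h2
    rw [this, mul_sub, mul_one, mul_assoc, ← Real.exp_add]
    ring_nf
  rw [setIntegral_congr_fun measurableSet_Ioi h1, integral_sub
    ((integrableOn_exp_mul_Ioi (by linarith) 0).const_mul l)
    ((integrableOn_exp_mul_Ioi (by linarith) 0).const_mul l), integral_const_mul,
    integral_const_mul, integral_exp_mul_Ioi (by linarith), integral_exp_mul_Ioi (by linarith)]
  simp only [mul_zero, Real.exp_zero]
  have : l + r ≠ 0 := by positivity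
  rw [neg_div_neg_eq, neg_div_neg_eq]
  field_simp
  ring

/-- With positive waiting times the points increase, so those up to `t` form an initial segment of
the indices. -/
lemma pointCount_eq_iff {e : ℕ → ℝ} (he : ∀ i, 0 < e i) (q : ℕ) {t : ℝ} (ht : 0 ≤ t) :
    pointCount e t = (q : ℕ∞) ↔
      ∑ j ∈ Finset.range q, e j ≤ t ∧ ¬ ∑ j ∈ Finset.range (q + 1), e j ≤ t := by
  have hmono : Monotone fun i => ∑ j ∈ Finset.range i, e j :=
    monotone_nat_of_le_succ fun i => by rw [Finset.sum_range_succ]; linarith [he i]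
  have hcard : ∀ m : ℕ, (Set.Icc 1 m).encard = (m : ℕ∞) := fun m => by
    rw [← Finset.coe_Icc, Set.encard_coe_eq_coe_finsetCard, Nat.card_Icc, Nat.add_sub_cancel]
  have hge : ∀ m : ℕ, ∑ j ∈ Finset.range m, e j ≤ t → (m : ℕ∞) ≤ pointCount e t := fun m hm => by
    rw [← hcard m]
    exact Set.encard_le_encard fun i hi => ⟨hi.1, (hmono hi.2).trans hm⟩
  have hle : ∀ m : ℕ, ¬ ∑ j ∈ Finset.range (m + 1), e j ≤ t → pointCount e t ≤ (m : ℕ∞) :=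
    fun m hm => by
      rw [← hcard m]
      refine Set.encard_le_encard fun i hi => ⟨hi.1, ?_⟩
      by_contra! hlt
      exact hm ((hmono (by omega : m + 1 ≤ i)).trans hi.2)
  constructor
  · intro h
    constructor
    · by_contra hq
      cases q with
      | zero => exact hq (by simpa using ht)
      | succ q =>
        have := hle q hq
        rw [h] at this
        exact absurd (Nat.cast_le.1 this) (by omega)
    · intro hq
      have := hge (q + 1) hq
      rw [h] at this
      exact absurd (Nat.cast_le.1 this) (by omega)
  · rintro ⟨h1, h2⟩
    exact le_antisymm (hle q h2) (hge q h1)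

/-- The limit degree distribution in closed form. -/
theorem limitDegree_succ {f : ℕ → ℝ} (hf : ∀ k, 1 ≤ k → 0 < f k) {l : ℝ} (hl : 0 < l) (q : ℕ) :
    limitDegree f l (q + 1) = limitProb (fun i => f (i + 1)) l q := by
  have hF : ∀ k, 0 < f (k + 1) := fun k => hf _ (by omega)
  have : ∀ i : ℕ, IsProbabilityMeasure (expMeasure (f (i + 1))) := fun i =>
    isProbabilityMeasure_expMeasure (hF i)
  have : IsProbabilityMeasure (waitingLaw f) := by unfold waitingLaw; infer_instance
  have hpos : ∀ᵐ e ∂waitingLaw f, ∀ i, 0 < e i := by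
    refine ae_all_iff.2 fun i => ?_
    have h1 : (waitingLaw f).map (fun e => e i) = expMeasure (f (i + 1)) :=
      Measure.infinitePi_map_eval (fun i : ℕ => expMeasure (f (i + 1))) i
    rw [ae_iff]
    have h2 : {e : ℕ → ℝ | ¬ 0 < e i} = (fun e : ℕ → ℝ => e i) ⁻¹' Set.Iic 0 := by
      ext e; simp
    rw [h2, ← Measure.map_apply (measurable_pi_apply i) measurableSet_Iic, h1]
    exact expMeasure_Iic_zero (hF i)
  let σ : ℕ → (ℕ → ℝ) → ℝ := fun m e => ∑ j ∈ Finset.range m, e j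
  have hσm : ∀ m, Measurable (σ m) := fun m =>
    Finset.measurable_fun_sum _ fun j _ => measurable_pi_apply j
  have hσ0 : ∀ m, ∀ᵐ e ∂waitingLaw f, 0 ≤ σ m e := fun m => by
    filter_upwards [hpos] with e he using Finset.sum_nonneg fun j _ => (he j).le
  -- By independence the Laplace transform is a product, and an exponential of rate `r` contributes
  -- `r / (l + r)`.
  have hlap : ∀ m, ∫ e, Real.exp (-l * σ m e) ∂waitingLaw f =
      survival (fun i => f (i + 1)) l m := by
    intro m
    have hind : iIndepFun (fun (i : ℕ) (e : ℕ → ℝ) => e i) (waitingLaw f) :=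
      iIndepFun_infinitePi (P := fun i : ℕ => expMeasure (f (i + 1))) (X := fun _ x => x)
        fun _ => measurable_id
    have h1 := hind.mgf_sum (t := -l) (fun i => measurable_pi_apply i) (Finset.range m)
    have h2 : mgf (∑ i ∈ Finset.range m, fun e : ℕ → ℝ => e i) (waitingLaw f) (-l) =
        ∫ e, Real.exp (-l * σ m e) ∂waitingLaw f := by
      unfold mgf
      refine integral_congr_ae (Eventually.of_forall fun e => ?_)
      simp only [σ, Finset.sum_apply]
    rw [← h2, h1, survival]
    refine Finset.prod_congr rfl fun i _ => ?_
    have h3 : (waitingLaw f).map (fun e => e i) = expMeasure (f (i + 1)) :=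
      Measure.infinitePi_map_eval (fun i : ℕ => expMeasure (f (i + 1))) i
    rw [← integral_exp_expMeasure (hF i) hl, ← h3, integral_map
      (measurable_pi_apply i).aemeasurable (by fun_prop)]
    rfl
  have hprob : ∀ t ∈ Set.Ioi (0 : ℝ),
      l * Real.exp (-l * t) *
        (waitingLaw f).real {e | pointCount e t = ((q + 1 - 1 : ℕ) : ℕ∞)} =
      l * Real.exp (-l * t) * (waitingLaw f).real {e | σ q e ≤ t} -
      l * Real.exp (-l * t) * (waitingLaw f).real {e | σ (q + 1) e ≤ t} := by
    intro t ht
    have h1 : (waitingLaw f).real {e | pointCount e t = ((q + 1 - 1 : ℕ) : ℕ∞)} =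
        (waitingLaw f).real ({e | σ q e ≤ t} \ {e | σ (q + 1) e ≤ t}) := by
      refine measureReal_congr ?_
      filter_upwards [hpos] with e he
      exact propext (pointCount_eq_iff he q (le_of_lt ht))
    have h2 : (waitingLaw f).real ({e | σ q e ≤ t} ∩ {e | σ (q + 1) e ≤ t}) =
        (waitingLaw f).real {e | σ (q + 1) e ≤ t} := by
      refine measureReal_congr ?_
      filter_upwards [hpos] with e he
      refine propext ⟨fun h => h.2, fun h => ⟨le_trans ?_ h, h⟩⟩
      change σ q e ≤ σ (q + 1) e
      simp only [σ]
      rw [Finset.sum_range_succ]; linarith [he q]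
    have h3 := measureReal_inter_add_sdiff (μ := waitingLaw f) (s := {e | σ q e ≤ t})
      (measurableSet_le (hσm (q + 1)) (measurable_const (a := t)))
    rw [h1, ← mul_sub]
    congr 1
    linarith
  obtain ⟨i1, e1⟩ := integral_exp_mul_measureReal (W := waitingLaw f) (hσm q) (hσ0 q) hl
  obtain ⟨i2, e2⟩ := integral_exp_mul_measureReal (W := waitingLaw f) (hσm (q + 1)) (hσ0 (q + 1)) hl
  rw [limitDegree, setIntegral_congr_fun measurableSet_Ioi hprob, integral_sub i1 i2, e1, e2,
    hlap, hlap, limitProb_eq_sub hl hF]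

/-! ### Regularity of the attachment function -/

lemma IsLinear.isAlmostLipschitz {f : ℕ → ℝ} (h : IsLinear f) : IsAlmostLipschitz f := by
  obtain ⟨α, hα⟩ := h
  intro ε hε
  refine ⟨1, fun j k hj hjk => ?_⟩
  have h1 : (j : ℝ) ≤ k := by exact_mod_cast hjk
  have h2 : 0 ≤ ε * (k : ℝ) := by positivity
  rw [hα k (hj.trans hjk), hα j hj, show (k : ℝ) + α - (j + α) = k - j by ring,
    abs_of_nonneg (by linarith)]
  linarith

lemma IsSublinear.eventually_le {f : ℕ → ℝ} (h : IsSublinear f) {ε : ℝ} (hε : 0 < ε) :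
    ∀ᶠ k : ℕ in atTop, f k ≤ ε * k := by
  filter_upwards [h.eventually_lt_const hε, eventually_gt_atTop 0] with k hk hk0
  have : (0 : ℝ) < k := by exact_mod_cast hk0
  rw [div_lt_iff₀ this] at hk
  exact hk.le

/-- Both values lie between `0` and `K + ε k`, and for `j < k` the gap is at least `1`, so `K` is
absorbed by `K (k - j)`. -/
lemma IsSublinear.isAlmostLipschitz {f : ℕ → ℝ} (h : IsSublinear f)
    (hf : ∀ k, 1 ≤ k → 0 < f k) : IsAlmostLipschitz f := by
  intro ε hε
  obtain ⟨k₀, hk₀⟩ := eventually_atTop.1 (h.eventually_le hε)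
  set K := ∑ i ∈ Finset.Icc 1 k₀, f i with hK
  have hK0 : 0 ≤ K := Finset.sum_nonneg fun i hi => (hf i (Finset.mem_Icc.1 hi).1).le
  have hle : ∀ k : ℕ, 1 ≤ k → f k ≤ K + ε * k := by
    intro k hk
    have h2 : 0 ≤ ε * (k : ℝ) := by positivity
    rcases le_total k k₀ with h1 | h1
    · have := Finset.single_le_sum (f := f) (fun i hi => (hf i (Finset.mem_Icc.1 hi).1).le)
        (Finset.mem_Icc.2 ⟨hk, h1⟩)
      linarith
    · linarith [hk₀ k h1]
  refine ⟨K, fun j k hj hjk => ?_⟩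
  rcases hjk.eq_or_lt with rfl | hlt
  · rw [sub_self, abs_zero, sub_self, mul_zero, zero_add]; positivity
  · have h1 : (1 : ℝ) ≤ (k : ℝ) - j := by
      rw [le_sub_iff_add_le]; exact_mod_cast (by omega : 1 + j ≤ k)
    have h2 : K + ε * k ≤ K * ((k : ℝ) - j) + ε * k := by nlinarith
    have h3 : ε * (j : ℝ) ≤ ε * k := by
      have : (j : ℝ) ≤ k := by exact_mod_cast hjk
      gcongr
    have h4 := hle k (hj.trans hjk)
    have h5 := hle j hj
    have h6 := hf k (hj.trans hjk)
    have h7 := hf j hj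
    rw [abs_le]; constructor <;> linarith

/-- The Malthusian parameter of a linear attachment function. -/
lemma malthusian_of_linear {F : ℕ → ℝ} {α l : ℝ} (hl : 0 < l) (hF : ∀ k, 0 < F k)
    (hα : ∀ k : ℕ, F k = k + 1 + α) (hsum : HasSum (fun j => survival F l (j + 1)) 1) :
    l = 2 + α := by
  -- A telescoping identity special to linear rates. Its limit is `τ = 2 + α - l ≥ 0`; if `τ > 0`,
  -- the survival probabilities are at least of order `1 / J`, contradicting summability.
  have hpart : ∀ J : ℕ, survival F l J * F J =
      (1 + α) - (l - 1) * ∑ j ∈ Finset.range J, survival F l (j + 1) := by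
    intro J
    induction J with
    | zero => simp [survival_zero, hα]
    | succ J ih =>
      have h1 : (l + F J) * survival F l (J + 1) = survival F l J * F J := by
        have := (add_pos hl (hF J)).ne'
        rw [survival_succ]; field_simp
      have h2 : F (J + 1) = F J + 1 := by rw [hα, hα]; push_cast; ring
      rw [Finset.sum_range_succ, mul_add, ← sub_sub, ← ih, h2]
      linear_combination h1
  have hlim : Tendsto (fun J => survival F l J * F J) atTop (𝓝 ((1 + α) - (l - 1) * 1)) := by
    refine ((hsum.tendsto_sum_nat.const_mul (l - 1)).const_sub (1 + α)).congr fun J => ?_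
    exact (hpart J).symm
  have h0 : 0 ≤ (1 + α) - (l - 1) * 1 :=
    ge_of_tendsto' hlim fun J => (mul_pos (survival_pos hl hF J) (hF J)).le
  by_contra hne
  obtain ⟨τ, hτ⟩ : ∃ τ, τ = (1 + α) - (l - 1) * 1 := ⟨_, rfl⟩
  have hτ0 : 0 < τ := by
    rw [hτ]
    refine lt_of_le_of_ne h0 fun h => hne ?_
    linarith
  rw [← hτ] at hlim
  have hD : 0 < l + 1 + |α| := by positivity
  have hev : ∀ᶠ J : ℕ in atTop, ‖1 / ((J + 1 : ℕ) : ℝ)‖ ≤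
      2 * (l + 1 + |α|) / τ * survival F l (J + 1) := by
    filter_upwards [hlim.eventually_const_lt (half_lt_self hτ0)] with J hJ
    have h1 : (l + F J) * survival F l (J + 1) = survival F l J * F J := by
      have := (add_pos hl (hF J)).ne'
      rw [survival_succ]; field_simp
    have h2 : l + F J ≤ (l + 1 + |α|) * ((J : ℝ) + 1) := by
      rw [hα]
      have : (0 : ℝ) ≤ (l + |α|) * J := by positivity
      nlinarith [le_abs_self α]
    have h3 := mul_le_mul_of_nonneg_right h2 (survival_pos hl hF (J + 1)).le
    rw [Real.norm_of_nonneg (by positivity), div_mul_eq_mul_div,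
      div_le_div_iff₀ (by positivity) hτ0]
    push_cast
    linarith
  have hs : Summable fun J : ℕ => 1 / ((J + 1 : ℕ) : ℝ) :=
    Summable.of_norm_bounded_eventually_nat (hsum.summable.mul_left _) hev
  exact Real.not_summable_one_div_natCast
    ((summable_nat_add_iff (f := fun n : ℕ => 1 / (n : ℝ)) 1).1 hs)

/-! ### The degree counts along a path -/

/-- The accumulated difference between the attachments to vertices of degree `k` and their
probabilities without delay. -/
def attachmentError (f : ℕ → ℝ) (p : ℕ → ℕ) (k n : ℕ) : ℝ :=
  ∑ j ∈ Finset.range n, ((if deg p (p (j + 1)) j = k then (1 : ℝ) else 0) -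
    f k * degreeCount p k j / totalRate f p j)

/-- A count gains from attachments one degree below and loses from those at its own degree; removing
the two accumulated errors from the count leaves the exact drift. In the lowest class, degree `0`
never occurs, and the newcomer supplies the term `S n`. -/
lemma IsRecursive.degreeFlow {p : ℕ → ℕ} (hp : IsRecursive p) {f : ℕ → ℝ} {c C : ℝ} (hc : 0 < c)
    (hcf : ∀ k, 1 ≤ k → c ≤ f k) (hC : ∀ k : ℕ, 1 ≤ k → f k ≤ C * k)
    (herr : ∀ k, Tendsto (fun n : ℕ => attachmentError f p k n / n) atTop (𝓝 0)) :
    DegreeFlow (fun k => f (k + 1)) (fun n k => (degreeCount p (k + 1) n : ℝ))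
      (fun n k => degreeCount p (k + 1) n - (attachmentError f p k n - attachmentError f p (k + 1) n))
      (totalRate f p) c (2 * C) := by
  have hC0 : 0 ≤ C := by
    have h1 := hcf 1 le_rfl
    have h2 := hC 1 le_rfl
    simp only [Nat.cast_one, mul_one] at h2
    linarith
  have hS0 : ∀ n : ℕ, 2 ≤ n → totalRate f p n ≠ 0 := fun n hn => by
    have h1 : (0 : ℝ) < n := by exact_mod_cast (by omega : 0 < n)
    exact (lt_of_lt_of_le (by positivity) (le_totalRate hcf p n)).ne'
  have hstep : ∀ k n, attachmentError f p k (n + 1) = attachmentError f p k n +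
      ((if deg p (p (n + 1)) n = k then (1 : ℝ) else 0) -
        f k * degreeCount p k n / totalRate f p n) := fun k n => Finset.sum_range_succ _ _
  exact
    { rate_lower_pos := hc
      le_rate := fun k => hcf _ (by omega)
      nonneg := fun n k => Nat.cast_nonneg _
      mass_le := fun n K => sum_degreeCount_le p K n
      le_mass := by
        filter_upwards [eventually_ge_atTop 2] with n hn K using hp.le_sum_degreeCount K hn
      moment_le := by
        filter_upwards [eventually_ge_atTop 2] with n hn K using hp.sum_mul_degreeCount_le K hn
      total_bounds := by
        filter_upwards [eventually_ge_atTop 2] with n hn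
        exact ⟨le_totalRate hcf p n, hp.totalRate_le hC0 hC hn⟩
      step_zero := by
        filter_upwards [eventually_ge_atTop 2] with n hn
        have := hS0 n hn
        rw [hstep, hstep, hp.degreeCount_succ _ hn, degreeCount_zero]
        simp only [zero_add, Nat.add_eq_right, if_true, Nat.cast_zero, mul_zero, zero_div]
        field_simp
        ring
      step_succ := by
        filter_upwards [eventually_ge_atTop 2] with n hn k
        have := hS0 n hn
        rw [hstep, hstep, hp.degreeCount_succ _ hn]
        simp only [Nat.add_right_cancel_iff, Nat.add_eq_zero_iff, one_ne_zero, and_false,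
          Nat.add_eq_right, if_false]
        field_simp
        ring
      close := fun k => by
        have := ((herr k).sub (herr (k + 1))).neg
        rw [sub_self, neg_zero] at this
        refine this.congr fun n => ?_
        ring }

/-- Convergence of the degree proportions along a path, given the Malthusian parameter. -/
theorem IsRecursive.tendsto_degreeCount {p : ℕ → ℕ} (hp : IsRecursive p) {f : ℕ → ℝ} {c C : ℝ}
    (hc : 0 < c) (hcf : ∀ k, 1 ≤ k → c ≤ f k) (hC : ∀ k : ℕ, 1 ≤ k → f k ≤ C * k)
    (herr : ∀ k, Tendsto (fun n : ℕ => attachmentError f p k n / n) atTop (𝓝 0))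
    (hcase : IsLinear f ∨ IsSublinear f) {l : ℝ} (hl : 0 < l)
    (hsum : HasSum (fun k => survival (fun i => f (i + 1)) l (k + 1)) 1) (k : ℕ) :
    Tendsto (fun n : ℕ => (degreeCount p (k + 1) n : ℝ) / n) atTop
      (𝓝 (limitProb (fun i => f (i + 1)) l k)) := by
  have hflow := hp.degreeFlow hc hcf hC herr
  have hf : ∀ k, 1 ≤ k → 0 < f k := fun k hk => hc.trans_le (hcf k hk)
  rcases hcase with ⟨α, hα⟩ | hsub
  · refine hflow.tendsto_of_total hl ?_ k
    have hlα : l = 2 + α := malthusian_of_linear hl (fun k => hf _ (by omega))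
      (fun k => by rw [hα _ (by omega)]; push_cast; ring) hsum
    -- For linear `f` the total rate is `(2 n - 2) + α n = l n - 2`, whatever the tree.
    have h1 : Tendsto (fun n : ℕ => l - 2 / (n : ℝ)) atTop (𝓝 (l - 0)) :=
      (tendsto_const_div_atTop_nhds_zero_nat 2).const_sub l
    rw [sub_zero] at h1
    refine h1.congr' ?_
    filter_upwards [eventually_ge_atTop 2] with n hn
    have hn0 : (n : ℝ) ≠ 0 := by exact_mod_cast (by omega : n ≠ 0)
    rw [totalRate, Finset.sum_congr rfl fun i _ => hα _ (one_le_deg p i n),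
      Finset.sum_add_distrib, hp.sum_deg_real hn, Finset.sum_const, Nat.card_Icc, nsmul_eq_mul,
      Nat.add_sub_cancel, hlα]
    field_simp
    ring
  · refine hflow.tendsto_of_sublinear hl (fun ε hε => ?_) hsum (fun ε hε => ?_) k
    · filter_upwards [(tendsto_add_atTop_nat 1).eventually (hsub.eventually_le hε)] with k hk
      exact_mod_cast hk
    · obtain ⟨K₀, hK₀⟩ := eventually_atTop.1 (hsub.eventually_le (half_pos hε))
      filter_upwards [eventually_ge_atTop K₀] with K hK
      filter_upwards [eventually_ge_atTop 2] with n hn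
      have := hp.abs_totalRate_sub_le (fun k hk => (hf k hk).le) (K := K)
        (fun k hk => hK₀ k (hK.trans hk.le)) (half_pos hε).le hn
      linarith

end

end DelayTree

/-- The proof compares the degree counts directly with the recursion without delay.  For this it
suffices that the snapshot seen by vertex `n + 1` has size `n - o(n)` in probability, which follows
from `β < 1` alone, and that `f` is linear or sublinear. -/
theorem corollary3p4 {Ω : Type*} [MeasurableSpace Ω] (P : MeasureTheory.Measure Ω)
    [MeasureTheory.IsProbabilityMeasure P]
    (β : ℝ) (hβ0 : 0 ≤ β) (hβ1 : β < 1)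
    (μ : MeasureTheory.Measure ℝ) [MeasureTheory.IsProbabilityMeasure μ]
    (hμ : μ (Set.Iio 0) = 0)
    (f : ℕ → ℝ)
    (hf : DelayTree.AttachmentAssumption f)
    (hdelay : DelayTree.DelayAssumption β μ)
    (hcase : DelayTree.IsLinear f ∨
      (DelayTree.IsSublinear f ∧ DelayTree.IsLipschitz f) ∨
      (DelayTree.IsSublinear f ∧ DelayTree.IsNondecreasing f))
    (par : ℕ → Ω → ℕ) (ξ : ℕ → Ω → ℝ)
    (hnet : DelayTree.IsNetwork P β μ f par ξ) :
    ∃ lam : ℝ, 0 < lam ∧ (∀ l : ℝ, 0 < l → (DelayTree.rhoHat f l = 1 ↔ l = lam)) ∧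
      ∀ k : ℕ, 1 ≤ k →
        (∀ᵐ ω ∂P, Filter.Tendsto
          (fun n : ℕ => (DelayTree.degreeCount (fun j => par j ω) k n : ℝ) / (n : ℝ))
          Filter.atTop (nhds (DelayTree.limitDegree f lam k))) ∧
        DelayTree.limitDegree f lam k =
          lam / (lam + f k) * ∏ j ∈ Finset.Icc 1 (k - 1), f j / (lam + f j) := by
  have hcase' : DelayTree.IsLinear f ∨ DelayTree.IsSublinear f :=
    hcase.imp_right fun h => h.elim And.left And.left
  obtain ⟨c, hc, hcf⟩ := hf.inf_pos
  obtain ⟨C, hC⟩ := hf.linear_growth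
  have hf0 : ∀ k, 1 ≤ k → 0 < f k := fun k hk => hc.trans_le (hcf k hk)
  have hlip : DelayTree.IsAlmostLipschitz f :=
    hcase'.elim (fun h => h.isAlmostLipschitz) fun h => h.isAlmostLipschitz hf0
  obtain ⟨lam, hlam, huniq, hsum⟩ := hf.exists_malthusian
  refine ⟨lam, hlam, huniq, fun k hk => ?_⟩
  obtain ⟨q, rfl⟩ : ∃ q, k = q + 1 := ⟨k - 1, by omega⟩
  rw [DelayTree.limitDegree_succ hf0 hlam]
  refine ⟨?_, ?_⟩
  · filter_upwards [hnet.ae_attachment hβ1 hμ hc hcf hC hlip] with ω hω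
    exact hω.1.tendsto_degreeCount hc hcf hC hω.2 hcase' hlam hsum q
  · rw [Nat.add_sub_cancel, DelayTree.prod_Icc_eq_survival, DelayTree.limitProb]
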